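/- **Theorem.** Pigeonhole Equal Sums can be solved by a randomized algorithm in $O^*(2^{0.4n})$ time, where $O^*$ hides factors polynomial in $n$. Here the input consists of $n$ positive integers $w_1,\dots,w_n$ with $\sum_{i=1}^n w_i<2^n-1$, and the output is a pair of different subsets $A,B\subseteq\{1,\dots,n\}$ with $\sum_{i\in A}w_i=\sum_{i\in B}w_i$. Precisely: there are one program of a random access machine with fair coin flips, whose time is measured in bit operations (logarithmic cost), and one polynomial $q$ such that, on every such input, the program halts within time $q(n)\cdot 2^{0.4n}$ for every outcome of its coin flips, and with probability at least $0.99$ over the coin flips its output is such a pair $(A,B)$. -/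

import Mathlib

open MeasureTheory

/-!
# Pigeonhole Equal Sums, and randomized random access machines with logarithmic cost

An algorithm is one fixed finite program, for inputs of every size, of a random access machine with
fair coin flips. Programs are given in structured form (sequence, branching and while loops). The
cells of the memory hold natural numbers, and the time is measured in bit operations: each
instruction pays for the bit lengths of all the values and addresses that it touches
(logarithmic cost), and multiplication and division pay the schoolbook cost, the product of the
lengths of the operands.
-/

namespace PES

/-- Binary machine operations on natural numbers. -/
inductive BinOp where
  | add
  | sub
  | mul
  | div
  | mod
  | eq
  | lt

/-- The result of an operation: subtraction is truncated at `0`, division by `0` gives `0`, `x mod 0`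
is `x`, and a comparison gives `1` for true and `0` for false. -/
def BinOp.eval : BinOp → ℕ → ℕ → ℕ
  | add, x, y => x + y
  | sub, x, y => x - y
  | mul, x, y => x * y
  | div, x, y => x / y
  | mod, x, y => x % y
  | eq, x, y => if x = y then 1 else 0
  | lt, x, y => if x < y then 1 else 0

/-- The cost of an operation in bit operations; `Nat.size x` is the bit length of `x`. -/
def BinOp.cost : BinOp → ℕ → ℕ → ℕ
  | mul, x, y => (Nat.size x + 1) * (Nat.size y + 1)
  | div, x, y => (Nat.size x + 1) * (Nat.size y + 1)
  | mod, x, y => (Nat.size x + 1) * (Nat.size y + 1)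
  | add, x, y => Nat.size x + Nat.size y + 1
  | sub, x, y => Nat.size x + Nat.size y + 1
  | eq, x, y => Nat.size x + Nat.size y + 1
  | lt, x, y => Nat.size x + Nat.size y + 1

/-- Side-effect free expressions: constants, registers, cells of an array (the name `a` of the array
is fixed in the program, the index is computed), and operations. -/
inductive Expr where
  | const (c : ℕ)
  | reg (x : ℕ)
  | read (a : ℕ) (i : Expr)
  | op (o : BinOp) (e₁ e₂ : Expr)

/-- Programs. A condition is true if its value is not `0`. -/
inductive Cmd where
  /-- do nothing -/
  | skip
  /-- register `x` := value of `e` -/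
  | assign (x : ℕ) (e : Expr)
  /-- cell number (value of `i`) of the array `a` := value of `e` -/
  | write (a : ℕ) (i e : Expr)
  /-- register `x` := a fresh fair coin flip, `0` or `1` -/
  | flip (x : ℕ)
  /-- first `c₁`, then `c₂` -/
  | seq (c₁ c₂ : Cmd)
  /-- if `e` then `c₁` else `c₂` -/
  | ite (e : Expr) (c₁ c₂ : Cmd)
  /-- while `e` do `c` -/
  | loop (e : Expr) (c : Cmd)

/-- A configuration of the memory: the registers, the arrays (`arr a i` is the cell `i` of the
array `a`), and the number of coins that have been flipped so far. -/
structure State where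
  reg : ℕ → ℕ
  arr : ℕ → ℕ → ℕ
  coins : ℕ

/-- The value of an expression. -/
def Expr.eval (s : State) : Expr → ℕ
  | const c => c
  | reg x => s.reg x
  | read a i => s.arr a (i.eval s)
  | op o e₁ e₂ => o.eval (e₁.eval s) (e₂.eval s)

/-- The cost of evaluating an expression. -/
def Expr.cost (s : State) : Expr → ℕ
  | const c => Nat.size c + 1
  | reg x => Nat.size (s.reg x) + 1
  | read a i => i.cost s + Nat.size (i.eval s) + Nat.size (s.arr a (i.eval s)) + 1
  | op o e₁ e₂ => e₁.cost s + e₂.cost s + o.cost (e₁.eval s) (e₂.eval s)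

/-- Register `x` := `v`. -/
def State.setReg (s : State) (x v : ℕ) : State :=
  { s with reg := Function.update s.reg x v }

/-- Cell `i` of the array `a` := `v`. -/
def State.setArr (s : State) (a i v : ℕ) : State :=
  { s with arr := Function.update s.arr a (Function.update (s.arr a) i v) }

/-- Register `x` := the first unused coin of the sequence `ω`. -/
def State.flip (ω : ℕ → Bool) (s : State) (x : ℕ) : State :=
  { s with reg := Function.update s.reg x (ω s.coins).toNat, coins := s.coins + 1 }

/-- `Exec ω c s s' t`: when the successive coin flips are `ω 0, ω 1, …`, the program `c`, started in
the state `s`, halts in the state `s'` after time `t`. -/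
inductive Exec (ω : ℕ → Bool) : Cmd → State → State → ℕ → Prop where
  | skip (s : State) : Exec ω .skip s s 1
  | assign (s : State) (x : ℕ) (e : Expr) :
      Exec ω (.assign x e) s (s.setReg x (e.eval s)) (e.cost s + Nat.size (e.eval s) + 1)
  | write (s : State) (a : ℕ) (i e : Expr) :
      Exec ω (.write a i e) s (s.setArr a (i.eval s) (e.eval s))
        (i.cost s + e.cost s + Nat.size (i.eval s) + Nat.size (e.eval s) + 1)
  | flip (s : State) (x : ℕ) : Exec ω (.flip x) s (s.flip ω x) 1
  | seq {c₁ c₂ : Cmd} {s s' s'' : State} {t₁ t₂ : ℕ} :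
      Exec ω c₁ s s' t₁ → Exec ω c₂ s' s'' t₂ → Exec ω (.seq c₁ c₂) s s'' (t₁ + t₂)
  | ite_true {e : Expr} {c₁ c₂ : Cmd} {s s' : State} {t : ℕ} :
      e.eval s ≠ 0 → Exec ω c₁ s s' t → Exec ω (.ite e c₁ c₂) s s' (e.cost s + 1 + t)
  | ite_false {e : Expr} {c₁ c₂ : Cmd} {s s' : State} {t : ℕ} :
      e.eval s = 0 → Exec ω c₂ s s' t → Exec ω (.ite e c₁ c₂) s s' (e.cost s + 1 + t)
  | loop_done {e : Expr} {c : Cmd} {s : State} :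
      e.eval s = 0 → Exec ω (.loop e c) s s (e.cost s + 1)
  | loop_step {e : Expr} {c : Cmd} {s s' s'' : State} {t₁ t₂ : ℕ} :
      e.eval s ≠ 0 → Exec ω c s s' t₁ → Exec ω (.loop e c) s' s'' t₂ →
      Exec ω (.loop e c) s s'' (e.cost s + 1 + t₁ + t₂)

/-- Once the coins are fixed, the final state and the running time are unique. -/
theorem Exec.unique {ω : ℕ → Bool} {c : Cmd} {s s₁ s₂ : State} {t₁ t₂ : ℕ}
    (h₁ : Exec ω c s s₁ t₁) (h₂ : Exec ω c s s₂ t₂) : s₁ = s₂ ∧ t₁ = t₂ := by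
  induction h₁ generalizing s₂ t₂ with
  | skip | assign | write | flip => cases h₂; exact ⟨rfl, rfl⟩
  | seq _ _ ih ih' =>
    cases h₂ with
    | seq k k' =>
      obtain ⟨rfl, rfl⟩ := ih k
      obtain ⟨rfl, rfl⟩ := ih' k'
      exact ⟨rfl, rfl⟩
  | ite_true h _ ih =>
    cases h₂ with
    | ite_true _ k => obtain ⟨rfl, rfl⟩ := ih k; exact ⟨rfl, rfl⟩
    | ite_false h' _ => exact absurd h' h
  | ite_false h _ ih =>
    cases h₂ with
    | ite_true h' _ => exact absurd h h'
    | ite_false _ k => obtain ⟨rfl, rfl⟩ := ih k; exact ⟨rfl, rfl⟩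
  | loop_done h =>
    cases h₂ with
    | loop_done => exact ⟨rfl, rfl⟩
    | loop_step h' => exact absurd h h'
  | loop_step h _ _ ih ih' =>
    cases h₂ with
    | loop_done h' => exact absurd h' h
    | loop_step _ k k' =>
      obtain ⟨rfl, rfl⟩ := ih k
      obtain ⟨rfl, rfl⟩ := ih' k'
      exact ⟨rfl, rfl⟩

/-- The law of a sequence of independent fair coin flips. -/
noncomputable def coinMeasure : Measure (ℕ → Bool) :=
  Measure.infinitePi fun _ => (PMF.uniformOfFintype Bool).toMeasure

/-- The initial state on the input `w`: register `0` holds `n`, the cells `0, …, n - 1` of the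
array `0` hold the input numbers, and everything else is `0`. -/
def start {n : ℕ} (w : Fin n → ℕ) : State where
  reg x := if x = 0 then n else 0
  arr a i := if h : a = 0 ∧ i < n then w ⟨i, h.2⟩ else 0
  coins := 0

/-- The subset of the indices whose characteristic function is stored in the array `a`. -/
def State.subset (s : State) (n a : ℕ) : Finset (Fin n) :=
  Finset.univ.filter fun i => s.arr a i ≠ 0

/-- The instances of Pigeonhole Equal Sums: positive integers with sum less than `2 ^ n - 1`. -/
def IsInstance {n : ℕ} (w : Fin n → ℕ) : Prop :=
  (∀ i, 0 < w i) ∧ ∑ i, w i < 2 ^ n - 1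

/-- The solutions: two different subsets of the indices with equal sums. -/
def IsSolution {n : ℕ} (w : Fin n → ℕ) (A B : Finset (Fin n)) : Prop :=
  A ≠ B ∧ ∑ i ∈ A, w i = ∑ i ∈ B, w i

end PES

namespace PES

/-! ### Notation for programs -/

/-! Subsets are masks `z < 2 ^ n` over the weights sorted increasingly, `v 0 ≤ … ≤ v (n - 1)`. Put
`k = ⌊2n/5⌋`, `D = 4 ^ k`, and let `N` be the number of distinct subset sums. Either `2 ^ n - N ≤ D`
or `2 ^ n - N > D`. The program cannot tell which, so it runs one method for each case and puts
every mask it meets into a dictionary keyed by weight. A repeated key with a new mask is a solution.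

Few collisions, `2 ^ n - N ≤ D`. The sums nearly fill `[0, 2 ^ n)`, which forces `2 ^ i - n D ≤ v i
≤ 2 ^ i + D` (`weight_upper`, `weight_lower`). Let `below X` count the masks of weight less than
`X`. Then `below 0 = 0`, while `below (2 ^ n - 1) = 2 ^ n`, so binary search finds an `X` with
`below X ≤ X` and `below (X + 1) > X + 1`, and two masks weigh exactly `X` (`searchIter_spec`). To
evaluate `below`, split a mask into `k` low, `k` middle and `n - 2k` top bits. Because the weights
are nearly powers of two, the top bits alone decide the comparison with `X` except for `O(n²)`
values (`lt_of_lt_scanLo`, `lt_of_scanHi_le`). For these the low parts are enumerated and the middle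
parts are counted with a trie (`scanCount_eq_below`), in about `2 ^ k` steps. An inverse table of
the middle sums exhibits the masks of weight `X` (`mem_or_collides`).

Many collisions, `2 ^ n - N > D`. Some dyadic level `l` has a set `T` of sums with about `2 ^ l`
preimages each and `4 n 2 ^ l |T| ≥ D` (`exists_level`). Take a random modulus up to `2 ^ (a + 1)`
and a random residue. For most prime moduli the residue class of a given target contains not many
more masks than its fair share (`card_mul_card_le_sum_goodTargets`), and distinct targets seldom
share a class (`sum_sq_card_goodTargets_le`). A table of residue counts turns a random index into a
mask of the class. A second moment computation, over the modulus, the residue and two batches of `2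
^ k` samples, shows that the batches contain a colliding pair with probability at least `1 / (2 ^ 19
n ^ 6)` (`one_le_mul_expect_hit_of_moments`, `exists_trial_parameters`). The table needs `a ≤ k`,
and the birthday effect needs `2n ≤ a + l + 4k` up to a constant. The worst case `a = k`, `l = 0` is
what fixes `k = 2n/5`. Since `a` and `b` (the number of bits of an index) are unknown, all pairs are
tried, polynomially often.

The passage from the machine to this mathematics is a total-correctness calculus (`Run`): if all
stored values have at most `B` bits, the time is at most `(B + 1) ^ 2` times a count of weighted
steps, with `B = 12n + 60` here. -/

instance : Add Expr := ⟨Expr.op .add⟩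
instance : Sub Expr := ⟨Expr.op .sub⟩
instance : Mul Expr := ⟨Expr.op .mul⟩
instance : Div Expr := ⟨Expr.op .div⟩
instance : Mod Expr := ⟨Expr.op .mod⟩
instance (c : ℕ) : OfNat Expr c := ⟨Expr.const c⟩

infixr:60 " ;; " => Cmd.seq

@[simp] theorem Expr.eval_add (s : State) (e f : Expr) : (e + f).eval s = e.eval s + f.eval s := rfl
@[simp] theorem Expr.eval_sub (s : State) (e f : Expr) : (e - f).eval s = e.eval s - f.eval s := rfl
@[simp] theorem Expr.eval_mul (s : State) (e f : Expr) : (e * f).eval s = e.eval s * f.eval s := rfl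
@[simp] theorem Expr.eval_div (s : State) (e f : Expr) : (e / f).eval s = e.eval s / f.eval s := rfl
@[simp] theorem Expr.eval_mod (s : State) (e f : Expr) : (e % f).eval s = e.eval s % f.eval s := rfl
@[simp] theorem Expr.eval_ofNat (s : State) (c : ℕ) : (no_index (OfNat.ofNat c) : Expr).eval s = c := rfl
@[simp] theorem Expr.eval_lt (s : State) (e f : Expr) :
    (Expr.op .lt e f).eval s = if e.eval s < f.eval s then 1 else 0 := rfl
@[simp] theorem Expr.eval_eq (s : State) (e f : Expr) :
    (Expr.op .eq e f).eval s = if e.eval s = f.eval s then 1 else 0 := rfl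
@[simp] theorem Expr.eval_reg (s : State) (x : ℕ) : (Expr.reg x).eval s = s.reg x := rfl
@[simp] theorem Expr.eval_const (s : State) (c : ℕ) : (Expr.const c).eval s = c := rfl
@[simp] theorem Expr.eval_read (s : State) (a : ℕ) (i : Expr) :
    (Expr.read a i).eval s = s.arr a (i.eval s) := rfl

@[simp] theorem State.setReg_reg (s : State) (x v y : ℕ) :
    (s.setReg x v).reg y = if y = x then v else s.reg y := by
  simp [State.setReg, Function.update_apply]
@[simp] theorem State.setReg_arr (s : State) (x v : ℕ) : (s.setReg x v).arr = s.arr := rfl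
@[simp] theorem State.setReg_coins (s : State) (x v : ℕ) : (s.setReg x v).coins = s.coins := rfl
@[simp] theorem State.setArr_reg (s : State) (a i v : ℕ) : (s.setArr a i v).reg = s.reg := rfl
@[simp] theorem State.setArr_coins (s : State) (a i v : ℕ) : (s.setArr a i v).coins = s.coins := rfl
@[simp] theorem State.setArr_arr_same (s : State) (a i v : ℕ) :
    (s.setArr a i v).arr a = Function.update (s.arr a) i v := by
  simp [State.setArr]
theorem State.setArr_arr_of_ne (s : State) {a b : ℕ} (i v : ℕ) (h : b ≠ a) :
    (s.setArr a i v).arr b = s.arr b := by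
  simp [State.setArr, h]
theorem State.setArr_arr (s : State) (a b i v : ℕ) :
    (s.setArr a i v).arr b = if b = a then Function.update (s.arr b) i v else s.arr b := by
  simp only [State.setArr, Function.update_apply]
  split_ifs with h
  · subst h; rfl
  · rfl

/-! ### Bounded states and the cost of expressions -/

/-- All registers and cells of the state have at most `B` bits. -/
structure Ok (B : ℕ) (s : State) : Prop where
  pos : 1 ≤ B
  reg : ∀ x, s.reg x < 2 ^ B
  arr : ∀ a i, s.arr a i < 2 ^ B

theorem Ok.setReg {B : ℕ} {s : State} (h : Ok B s) {x v : ℕ} (hv : v < 2 ^ B) :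
    Ok B (s.setReg x v) := by
  refine ⟨h.pos, fun y => ?_, h.arr⟩
  rw [State.setReg_reg]
  split_ifs
  · exact hv
  · exact h.reg y

theorem Ok.setArr {B : ℕ} {s : State} (h : Ok B s) {a i v : ℕ} (hv : v < 2 ^ B) :
    Ok B (s.setArr a i v) := by
  refine ⟨h.pos, h.reg, fun b j => ?_⟩
  rw [State.setArr_arr]
  split_ifs
  · rw [Function.update_apply]
    split_ifs
    · exact hv
    · exact h.arr b j
  · exact h.arr b j

/-- The values of `e` have at most `B * e.len` bits if all cells have at most `B` bits. -/
def Expr.len : Expr → ℕ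
  | const c => Nat.size c + 1
  | reg _ => 1
  | read _ _ => 1
  | op _ e f => e.len + f.len

/-- A weight of expressions that bounds their cost. -/
def Expr.wgt : Expr → ℕ
  | const c => Nat.size c + 1
  | reg _ => 1
  | read _ i => i.wgt + i.len + 2
  | op _ e f => e.wgt + f.wgt + (e.len + 1) * (f.len + 1)

theorem Expr.len_pos (e : Expr) : 1 ≤ e.len := by
  induction e with
  | const | reg | read => simp [Expr.len]
  | op o e f he hf => simp only [Expr.len]; omega

theorem Expr.size_eval_le {B : ℕ} {s : State} (h : Ok B s) (e : Expr) :
    Nat.size (e.eval s) ≤ B * e.len := by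
  have hB := h.pos
  induction e with
  | const c =>
    simp only [Expr.eval, Expr.len]
    nlinarith [Nat.zero_le (Nat.size c)]
  | reg x => simpa [Expr.eval, Expr.len] using Nat.size_le.2 (h.reg x)
  | read a i => simpa [Expr.eval, Expr.len] using Nat.size_le.2 (h.arr a _)
  | op o e f he hf =>
    rw [Nat.size_le] at *
    simp only [Expr.eval, Expr.len]
    have h1 : 1 ≤ B * e.len := Nat.one_le_iff_ne_zero.2 (by have := e.len_pos; positivity)
    have h2 : 1 ≤ B * f.len := Nat.one_le_iff_ne_zero.2 (by have := f.len_pos; positivity)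
    rw [mul_add, pow_add]
    generalize e.eval s = x at *
    generalize f.eval s = y at *
    generalize ha : 2 ^ (B * e.len) = a at *
    generalize hb : 2 ^ (B * f.len) = b at *
    have h3 : 2 ≤ a := by rw [← ha]; exact Nat.le_self_pow (by omega) 2
    have h4 : 2 ≤ b := by rw [← hb]; exact Nat.le_self_pow (by omega) 2
    -- Since both bounds are at least `2`, the multiplicative bound also covers addition and the
    -- `0`/`1` comparisons.
    have hab : a + b ≤ a * b := by nlinarith
    cases o with
    | add => simp only [BinOp.eval]; omega
    | sub => simp only [BinOp.eval]; omega
    | mul => simp only [BinOp.eval]; exact Nat.mul_lt_mul'' he hf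
    | div => simp only [BinOp.eval]; have := Nat.div_le_self x y; omega
    | mod => simp only [BinOp.eval]; have := Nat.mod_le x y; omega
    | eq => simp only [BinOp.eval]; split_ifs <;> omega
    | lt => simp only [BinOp.eval]; split_ifs <;> omega

/-- Products and quotients cost the product of two lengths, each at most a constant times `B + 1`;
hence the square. The factor `wgt` depends only on the program text, so it is an absolute constant.
-/
theorem Expr.cost_le {B : ℕ} {s : State} (h : Ok B s) (e : Expr) :
    e.cost s ≤ e.wgt * (B + 1) ^ 2 := by
  have hB := h.pos
  have hU : 1 ≤ (B + 1) ^ 2 := Nat.one_le_pow _ _ (by omega)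
  have hBU : B + 1 ≤ (B + 1) ^ 2 := by nlinarith
  induction e with
  | const c => simp only [Expr.cost, Expr.wgt]; nlinarith
  | reg x =>
    have := Nat.size_le.2 (h.reg x)
    simp only [Expr.cost, Expr.wgt]; omega
  | read a i hi =>
    have h1 := Nat.size_le.2 (h.arr a (i.eval s))
    have h2 := i.size_eval_le h
    have h3 : B * i.len ≤ i.len * (B + 1) ^ 2 := by nlinarith
    simp only [Expr.cost, Expr.wgt]
    nlinarith
  | op o e f he hf =>
    have h1 := e.size_eval_le h
    have h2 := f.size_eval_le h
    have key : (Nat.size (e.eval s) + 1) * (Nat.size (f.eval s) + 1)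
        ≤ (e.len + 1) * (f.len + 1) * (B + 1) ^ 2 := by
      calc _ ≤ (B * e.len + 1) * (B * f.len + 1) := Nat.mul_le_mul (by omega) (by omega)
        _ ≤ ((B + 1) * (e.len + 1)) * ((B + 1) * (f.len + 1)) :=
          Nat.mul_le_mul (by nlinarith) (by nlinarith)
        _ = _ := by ring
    have key' : o.cost (e.eval s) (f.eval s)
        ≤ (Nat.size (e.eval s) + 1) * (Nat.size (f.eval s) + 1) := by
      cases o <;> simp only [BinOp.cost] <;> nlinarith [Nat.zero_le (Nat.size (e.eval s) * Nat.size (f.eval s))]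
    simp only [Expr.cost, Expr.wgt]
    nlinarith

/-! ### What a program modifies -/

/-- `c.modR x`: some instruction of `c` assigns the register `x`. -/
def Cmd.modR : Cmd → ℕ → Bool
  | skip, _ => false
  | assign x _, y => decide (y = x)
  | write _ _ _, _ => false
  | flip x, y => decide (y = x)
  | seq c d, y => c.modR y || d.modR y
  | ite _ c d, y => c.modR y || d.modR y
  | loop _ c, y => c.modR y

/-- `c.modA a`: some instruction of `c` writes to the array `a`. -/
def Cmd.modA : Cmd → ℕ → Bool
  | skip, _ => false
  | assign _ _, _ => false
  | write a _ _, b => decide (b = a)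
  | flip _, _ => false
  | seq c d, y => c.modA y || d.modA y
  | ite _ c d, y => c.modA y || d.modA y
  | loop _ c, y => c.modA y

/-- The states `s` and `s'` differ only in what `c` modifies. -/
def Fr (c : Cmd) (s s' : State) : Prop :=
  (∀ x, c.modR x = false → s'.reg x = s.reg x) ∧ ∀ a, c.modA a = false → s'.arr a = s.arr a

theorem Fr.reg {c : Cmd} {s s' : State} (h : Fr c s s') (x : ℕ)
    (hx : c.modR x = false := by rfl) : s'.reg x = s.reg x := h.1 x hx

theorem Fr.arr {c : Cmd} {s s' : State} (h : Fr c s s') (a : ℕ)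
    (ha : c.modA a = false := by rfl) : s'.arr a = s.arr a := h.2 a ha

theorem Fr.refl (c : Cmd) (s : State) : Fr c s s := ⟨fun _ _ => rfl, fun _ _ => rfl⟩

theorem Fr.trans {c : Cmd} {s s' s'' : State} (h : Fr c s s') (h' : Fr c s' s'') : Fr c s s'' :=
  ⟨fun x hx => (h'.1 x hx).trans (h.1 x hx), fun a ha => (h'.2 a ha).trans (h.2 a ha)⟩

theorem Fr.of_imp {c d : Cmd} {s s' : State} (h : Fr c s s')
    (hr : ∀ x, d.modR x = false → c.modR x = false)
    (ha : ∀ x, d.modA x = false → c.modA x = false) : Fr d s s' :=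
  ⟨fun x hx => h.1 x (hr x hx), fun a h' => h.2 a (ha a h')⟩

theorem Exec.fr {ω : ℕ → Bool} {c : Cmd} {s s' : State} {t : ℕ} (h : Exec ω c s s' t) :
    Fr c s s' := by
  induction h with
  | skip s => exact Fr.refl _ _
  | assign s x e =>
    refine ⟨fun y hy => ?_, fun _ _ => rfl⟩
    have : y ≠ x := by rintro rfl; simp [Cmd.modR] at hy
    simp [this]
  | write s a i e =>
    refine ⟨fun _ _ => rfl, fun b hb => ?_⟩
    have : b ≠ a := by rintro rfl; simp [Cmd.modA] at hb
    exact State.setArr_arr_of_ne _ _ _ this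
  | flip s x =>
    refine ⟨fun y hy => ?_, fun _ _ => rfl⟩
    have : y ≠ x := by rintro rfl; simp [Cmd.modR] at hy
    simp [State.flip, this]
  | seq _ _ h1 h2 =>
    exact (h1.of_imp (by simp +contextual [Cmd.modR]) (by simp +contextual [Cmd.modA])).trans
      (h2.of_imp (by simp +contextual [Cmd.modR]) (by simp +contextual [Cmd.modA]))
  | ite_true _ _ h1 =>
    exact h1.of_imp (by simp +contextual [Cmd.modR]) (by simp +contextual [Cmd.modA])
  | ite_false _ _ h1 =>
    exact h1.of_imp (by simp +contextual [Cmd.modR]) (by simp +contextual [Cmd.modA])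
  | loop_done _ => exact Fr.refl _ _
  | loop_step _ _ _ h1 h2 =>
    exact Fr.trans (h1.of_imp (by simp +contextual [Cmd.modR]) (by simp +contextual [Cmd.modA])) h2

/-! ### Total correctness with time bounds -/

/-- The program `c` started in `s` halts within `k * (B + 1) ^ 2` steps in a `B`-bit state that
satisfies `Q`. -/
def Run (B : ℕ) (ω : ℕ → Bool) (c : Cmd) (s : State) (k : ℕ) (Q : State → Prop) : Prop :=
  ∃ s' t, Exec ω c s s' t ∧ t ≤ k * (B + 1) ^ 2 ∧ Ok B s' ∧ Q s'

variable {B : ℕ} {ω : ℕ → Bool} {c c₁ c₂ : Cmd} {s : State} {k k₁ k₂ : ℕ} {Q Q₁ : State → Prop}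

theorem Run.mono (h : Run B ω c s k₁ Q₁) (hk : k₁ ≤ k) (hQ : ∀ s', Ok B s' → Fr c s s' → Q₁ s' → Q s') :
    Run B ω c s k Q := by
  obtain ⟨s', t, he, ht, ho, hq⟩ := h
  exact ⟨s', t, he, ht.trans (Nat.mul_le_mul_right _ hk), ho, hQ s' ho he.fr hq⟩

theorem Run.le (h : Run B ω c s k₁ Q) (hk : k₁ ≤ k) : Run B ω c s k Q :=
  h.mono hk fun _ _ _ h => h

theorem Run.seq (h₁ : Run B ω c₁ s k₁ Q₁)
    (h₂ : ∀ s', Ok B s' → Fr c₁ s s' → Q₁ s' → Run B ω c₂ s' k₂ Q) :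
    Run B ω (c₁ ;; c₂) s (k₁ + k₂) Q := by
  obtain ⟨s', t, he, ht, ho, hq⟩ := h₁
  obtain ⟨s'', t', he', ht', ho', hq'⟩ := h₂ s' ho he.fr hq
  exact ⟨s'', t + t', he.seq he', by rw [add_mul]; omega, ho', hq'⟩

theorem Run.skip (hs : Ok B s) (hQ : Q s) : Run B ω .skip s 1 Q :=
  ⟨s, 1, .skip s, by have : 1 ≤ (B + 1) ^ 2 := Nat.one_le_pow _ _ (by omega)
                     omega, hs, hQ⟩

/-- The number `1000` is a uniform allowance per instruction, large enough for the expressions of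
this program; `decide` verifies it for each of them. Only the stored value has to fit into `B` bits,
not the intermediate ones. -/
theorem Run.assign {x : ℕ} {e : Expr} (hs : Ok B s) (hv : e.eval s < 2 ^ B)
    (hQ : Q (s.setReg x (e.eval s))) (hw : e.wgt + 2 ≤ 1000 := by decide) :
    Run B ω (.assign x e) s 1000 Q := by
  refine ⟨_, _, .assign s x e, ?_, hs.setReg hv, hQ⟩
  have h1 := e.cost_le hs
  have h2 := Nat.size_le.2 hv
  nlinarith

theorem Run.write {a : ℕ} {i e : Expr} (hs : Ok B s) (hv : e.eval s < 2 ^ B)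
    (hQ : Q (s.setArr a (i.eval s) (e.eval s))) (hw : i.wgt + i.len + e.wgt + 2 ≤ 1000 := by decide) :
    Run B ω (.write a i e) s 1000 Q := by
  refine ⟨_, _, .write s a i e, ?_, hs.setArr hv, hQ⟩
  have h1 := e.cost_le hs
  have h2 := Nat.size_le.2 hv
  have h3 := i.cost_le hs
  have h4 := i.size_eval_le hs
  have h5 : B * i.len ≤ i.len * (B + 1) ^ 2 := by nlinarith [Nat.zero_le i.len]
  nlinarith

theorem Run.flip {x : ℕ} (hs : Ok B s) (hQ : Q (s.flip ω x)) : Run B ω (.flip x) s 1 Q := by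
  have hB := hs.pos
  refine ⟨_, _, .flip s x, by have : 1 ≤ (B + 1) ^ 2 := Nat.one_le_pow _ _ (by omega)
                              omega, ?_, hQ⟩
  have : (ω s.coins).toNat < 2 ^ B :=
    lt_of_le_of_lt (Bool.toNat_le _) (Nat.one_lt_pow (by omega) (by norm_num))
  have ho := hs.setReg (x := x) this
  exact ⟨ho.pos, ho.reg, ho.arr⟩

theorem Run.ite {e : Expr} (hs : Ok B s)
    (h₁ : e.eval s ≠ 0 → Run B ω c₁ s k Q) (h₂ : e.eval s = 0 → Run B ω c₂ s k Q)
    (hw : e.wgt + 1 ≤ 1000 := by decide) :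
    Run B ω (.ite e c₁ c₂) s (1000 + k) Q := by
  have h1 := e.cost_le hs
  have hU : 1 ≤ (B + 1) ^ 2 := Nat.one_le_pow _ _ (by omega)
  by_cases he : e.eval s = 0
  · obtain ⟨s', t, hx, ht, ho, hq⟩ := h₂ he
    exact ⟨s', _, .ite_false he hx, by nlinarith, ho, hq⟩
  · obtain ⟨s', t, hx, ht, ho, hq⟩ := h₁ he
    exact ⟨s', _, .ite_true he hx, by nlinarith, ho, hq⟩

/-- `for i < (register N) do c`. -/
def Cmd.for (i N : ℕ) (c : Cmd) : Cmd :=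
  .assign i 0 ;; .loop (.op .lt (.reg i) (.reg N)) (c ;; .assign i (.reg i + 1))

/-- The invariant is asserted after the counter has been updated, which explains the `setReg` in its
initial and inductive forms. The body receives a frame condition relative to the state before the
loop, so untouched variables need not be part of the invariant. -/
theorem Run.for {i N m : ℕ} (I : ℕ → State → Prop) (hs : Ok B s) (hN : s.reg N = m)
    (hi : c.modR i = false) (hcN : c.modR N = false) (hiN : N ≠ i)
    (h0 : I 0 (s.setReg i 0))
    (hstep : ∀ j < m, ∀ s', Ok B s' → Fr (Cmd.for i N c) s s' → s'.reg i = j → I j s' →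
      Run B ω c s' k fun s'' => I (j + 1) (s''.setReg i (j + 1))) :
    Run B ω (Cmd.for i N c) s (m * (k + 2000) + 2000) fun s' => I m s' := by
  have hm : m < 2 ^ B := hN ▸ hs.reg N
  have hpos : 0 < 2 ^ B := by positivity
  have hU : 1 ≤ (B + 1) ^ 2 := Nat.one_le_pow _ _ (by omega)
  -- Induction on the number `d` of remaining rounds.
  have main : ∀ d j, j + d = m → ∀ s', Ok B s' → Fr (Cmd.for i N c) s s' → s'.reg i = j → I j s' →
      ∃ s'' t, Exec ω (.loop (.op .lt (.reg i) (.reg N)) (c ;; .assign i (.reg i + 1))) s' s'' t ∧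
        t ≤ (d * (k + 2000) + 1000) * (B + 1) ^ 2 ∧ Ok B s'' ∧ I m s'' := by
    intro d
    induction d with
    | zero =>
      intro j hj s' ho hF hr hI
      have hNs : s'.reg N = m := by
        rw [hF.1 N _, hN]
        simp [Cmd.for, Cmd.modR, hcN, hiN]
      have hc := Expr.cost_le ho (.op .lt (.reg i) (.reg N))
      refine ⟨s', _, .loop_done ?_, ?_, ho, ?_⟩
      · simp [hr, hNs]; omega
      · have w1 : Expr.wgt (.op .lt (.reg i) (.reg N)) = 6 := rfl
        rw [w1] at hc
        generalize (B + 1) ^ 2 = U at *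
        rw [zero_mul, zero_add]
        omega
      · have : j = m := by omega
        exact this ▸ hI
    | succ d ih =>
      intro j hj s' ho hF hr hI
      have hNs : s'.reg N = m := by
        rw [hF.1 N _, hN]
        simp [Cmd.for, Cmd.modR, hcN, hiN]
      have hc := Expr.cost_le ho (.op .lt (.reg i) (.reg N))
      obtain ⟨s₁, t₁, e₁, ht₁, ho₁, hI₁⟩ := hstep j (by omega) s' ho hF hr hI
      have hr₁ : s₁.reg i = j := by rw [e₁.fr.1 i hi, hr]
      have hv : (Expr.reg i + 1).eval s₁ = j + 1 := by simp [hr₁]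
      have ho₂ : Ok B (s₁.setReg i (j + 1)) := ho₁.setReg (by omega)
      have e₂ := Exec.assign (ω := ω) s₁ i (.reg i + 1)
      have hc₂ := Expr.cost_le ho₁ (.reg i + 1)
      have hc₃ := Nat.size_le.2 (show (Expr.reg i + 1).eval s₁ < 2 ^ B by rw [hv]; omega)
      have hF₂ : Fr (Cmd.for i N c) s (s₁.setReg i (j + 1)) := by
        have := (e₁.seq e₂).fr
        rw [hv] at this
        exact hF.trans (this.of_imp (by simp +contextual [Cmd.for, Cmd.modR])
          (by simp +contextual [Cmd.for, Cmd.modA]))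
      obtain ⟨s₃, t₃, e₃, ht₃, ho₃, hI₃⟩ := ih (j + 1) (by omega) _ ho₂ hF₂ (by simp) hI₁
      refine ⟨s₃, _, .loop_step ?_ (e₁.seq e₂) (hv.symm ▸ e₃), ?_, ho₃, hI₃⟩
      · simp [hr, hNs]; omega
      · have w1 : Expr.wgt (.op .lt (.reg i) (.reg N)) = 6 := rfl
        have w2 : Expr.wgt (.reg i + 1) = 1 + 2 + (1 + 1) * (2 + 1) := rfl
        rw [w1] at hc
        rw [w2] at hc₂
        nlinarith
  have ho₀ : Ok B (s.setReg i 0) := hs.setReg hpos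
  have e₀ := Exec.assign (ω := ω) s i 0
  have hF₀ : Fr (Cmd.for i N c) s (s.setReg i 0) :=
    e₀.fr.of_imp (by simp +contextual [Cmd.for, Cmd.modR]) (by simp +contextual [Cmd.for, Cmd.modA])
  obtain ⟨s', t, e', ht, ho, hI⟩ := main m 0 (by omega) _ ho₀ hF₀ (by simp) h0
  refine ⟨s', _, e₀.seq e', ?_, ho, hI⟩
  have hc₀ := Expr.cost_le hs 0
  have w0 : Expr.wgt 0 = 1 := rfl
  rw [w0] at hc₀
  have : Nat.size (Expr.eval s 0) = 0 := rfl
  rw [this]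
  nlinarith

end PES

/-! ### Rules for straight-line code, weights of masks, and the dictionary -/

namespace PES

variable {B : ℕ} {ω : ℕ → Bool} {c c₁ c₂ : Cmd} {s : State} {k k₁ k₂ : ℕ} {Q Q₁ : State → Prop}

/-- Symbolic execution: the continuation is proved in the explicit updated state, with the stored
value named by its mathematical meaning `y` instead of the expression that computes it. -/
theorem Run.assign_seq {x : ℕ} {e : Expr} (y : ℕ) (hs : Ok B s) (he : e.eval s = y)
    (hy : y < 2 ^ B) (h : Ok B (s.setReg x y) → Run B ω c (s.setReg x y) k Q)
    (hw : e.wgt + 2 ≤ 1000 := by decide) :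
    Run B ω (.assign x e ;; c) s (1000 + k) Q := by
  subst he
  exact Run.seq (Q₁ := fun s' => s' = s.setReg x (e.eval s)) (Run.assign hs hy rfl hw)
    fun _ ho _ hq => hq ▸ h (hq ▸ ho)

theorem Run.write_seq {a : ℕ} {i e : Expr} (j y : ℕ) (hs : Ok B s) (hi : i.eval s = j)
    (he : e.eval s = y) (hy : y < 2 ^ B) (h : Ok B (s.setArr a j y) → Run B ω c (s.setArr a j y) k Q)
    (hw : i.wgt + i.len + e.wgt + 2 ≤ 1000 := by decide) :
    Run B ω (.write a i e ;; c) s (1000 + k) Q := by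
  subst he hi
  exact Run.seq (Q₁ := fun s' => s' = s.setArr a (i.eval s) (e.eval s)) (Run.write hs hy rfl hw)
    fun _ ho _ hq => hq ▸ h (hq ▸ ho)

theorem Run.assign_last {x : ℕ} {e : Expr} (y : ℕ) (hs : Ok B s) (he : e.eval s = y)
    (hy : y < 2 ^ B) (hQ : Q (s.setReg x y)) (hw : e.wgt + 2 ≤ 1000 := by decide) :
    Run B ω (.assign x e) s 1000 Q := by
  subst he
  exact Run.assign hs hy hQ hw

theorem Run.write_last {a : ℕ} {i e : Expr} (j y : ℕ) (hs : Ok B s) (hi : i.eval s = j)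
    (he : e.eval s = y) (hy : y < 2 ^ B) (hQ : Q (s.setArr a j y))
    (hw : i.wgt + i.len + e.wgt + 2 ≤ 1000 := by decide) :
    Run B ω (.write a i e) s 1000 Q := by
  subst he hi
  exact Run.write hs hy hQ hw

/-! ### Weights of masks -/

/-- The sum of the `v t` over the bits `t < m` of `z`. -/
def wsum (v : ℕ → ℕ) (m z : ℕ) : ℕ := ∑ t ∈ Finset.range m, v t * (z / 2 ^ t % 2)

theorem wsum_le (v : ℕ → ℕ) (m z : ℕ) : wsum v m z ≤ ∑ t ∈ Finset.range m, v t :=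
  Finset.sum_le_sum fun t _ => by
    have : z / 2 ^ t % 2 ≤ 1 := by omega
    nlinarith

theorem wsum_succ (v : ℕ → ℕ) (m z : ℕ) :
    wsum v (m + 1) z = wsum v m z + v m * (z / 2 ^ m % 2) := Finset.sum_range_succ _ _

theorem sum_shift_le (v : ℕ → ℕ) {o m n : ℕ} (h : o + m ≤ n) :
    ∑ t ∈ Finset.range m, v (o + t) ≤ ∑ t ∈ Finset.range n, v t := by
  have h1 := Finset.sum_range_add v o m
  have h2 : ∑ t ∈ Finset.range (o + m), v t ≤ ∑ t ∈ Finset.range n, v t :=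
    Finset.sum_le_sum_of_subset (Finset.range_subset_range.2 h)
  omega

/-! ### The global variables -/

/-- The registers and arrays that are constant after the initialization: the parameters `n`,
`k = ⌊2n/5⌋`, powers of two, and the sorted weights `v`. -/
structure Ctx (B n : ℕ) (v : ℕ → ℕ) (s : State) : Prop where
  r0 : s.reg 0 = n
  r1 : s.reg 1 = 2 * n / 5
  r2 : s.reg 2 = 2 ^ (2 * n / 5)
  r3 : s.reg 3 = 4 ^ (2 * n / 5)
  r4 : s.reg 4 = 2 ^ n
  r5 : s.reg 5 = n - 2 * (2 * n / 5)
  r6 : s.reg 6 = 2 ^ (n - 2 * (2 * n / 5))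
  r7 : s.reg 7 = 2 ^ (n + 1)
  r8 : s.reg 8 = 2 ^ 28 * (n + 1) ^ 9
  r9 : s.reg 9 = 2 * n + 6
  a3 : s.arr 3 = v
  a10 : ∀ i ≤ 2 * n + 6, s.arr 10 i = 2 ^ i
  hB : 12 * n + 60 ≤ B
  hv : ∑ t ∈ Finset.range n, v t < 2 ^ n

/-- The program does not modify the global variables. -/
def Cmd.keeps (c : Cmd) : Bool :=
  !(c.modR 0 || c.modR 1 || c.modR 2 || c.modR 3 || c.modR 4 || c.modR 5 || c.modR 6 || c.modR 7 ||
    c.modR 8 || c.modR 9 || c.modA 3 || c.modA 10)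

variable {n : ℕ} {v : ℕ → ℕ}

/-- That a concrete program leaves the globals alone is a computation on its syntax, so the default
`rfl` discharges it. -/
theorem Ctx.fr {s' : State} (h : Ctx B n v s) (hF : Fr c s s') (hc : c.keeps = true := by rfl) :
    Ctx B n v s' := by
  simp only [Cmd.keeps, Bool.not_eq_true', Bool.or_eq_false_iff] at hc
  obtain ⟨⟨⟨⟨⟨⟨⟨⟨⟨⟨⟨h0, h1⟩, h2⟩, h3⟩, h4⟩, h5⟩, h6⟩, h7⟩, h8⟩, h9⟩, a3⟩, a10⟩ := hc
  refine ⟨?_, ?_, ?_, ?_, ?_, ?_, ?_, ?_, ?_, ?_, ?_, ?_, h.hB, h.hv⟩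
  · rw [hF.reg 0 h0, h.r0]
  · rw [hF.reg 1 h1, h.r1]
  · rw [hF.reg 2 h2, h.r2]
  · rw [hF.reg 3 h3, h.r3]
  · rw [hF.reg 4 h4, h.r4]
  · rw [hF.reg 5 h5, h.r5]
  · rw [hF.reg 6 h6, h.r6]
  · rw [hF.reg 7 h7, h.r7]
  · rw [hF.reg 8 h8, h.r8]
  · rw [hF.reg 9 h9, h.r9]
  · rw [hF.arr 3 a3, h.a3]
  · rw [hF.arr 10 a10]; exact h.a10

theorem Fr.setReg (s : State) (x y : ℕ) : Fr (.assign x 0) s (s.setReg x y) :=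
  ⟨fun z hz => by
    have : z ≠ x := by rintro rfl; simp [Cmd.modR] at hz
    simp [this], fun _ _ => rfl⟩

theorem Fr.setArr (s : State) (a i y : ℕ) : Fr (.write a 0 0) s (s.setArr a i y) :=
  ⟨fun z hz => rfl, fun b hb => by
    have : b ≠ a := by rintro rfl; simp [Cmd.modA] at hb
    exact State.setArr_arr_of_ne _ _ _ this⟩

theorem Ctx.setReg (h : Ctx B n v s) {x y : ℕ} (hx : 9 < x := by norm_num) : Ctx B n v (s.setReg x y) :=
  h.fr (Fr.setReg s x y) (by
    simp only [Cmd.keeps, Cmd.modR, Cmd.modA]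
    simp; omega)

theorem Ctx.setArr (h : Ctx B n v s) {a i y : ℕ} (hx : 10 ≠ a ∧ 3 ≠ a := by norm_num) :
    Ctx B n v (s.setArr a i y) :=
  h.fr (Fr.setArr s a i y) (by
    simp only [Cmd.keeps, Cmd.modR, Cmd.modA]
    simp; omega)

theorem Ctx.lt (h : Ctx B n v s) {x : ℕ} (e : ℕ) (hx : x ≤ 2 ^ e)
    (he : e < 12 * n + 60 := by omega) : x < 2 ^ B :=
  lt_of_le_of_lt hx (Nat.pow_lt_pow_right (by norm_num) (lt_of_lt_of_le he h.hB))

/-! ### The weight of a mask -/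

/-- Register `16` := sum of the cells `reg 14 + t` of the array `3` over the bits `t < reg 15` of
register `13`. -/
def weigh : Cmd :=
  .assign 16 0 ;; .assign 17 (.reg 13) ;;
    .for 18 15 (.assign 16 (.reg 16 + .read 3 (.reg 14 + .reg 18) * (.reg 17 % 2)) ;;
      .assign 17 (.reg 17 / 2))

theorem weigh_run (ho : Ok B s) (hC : Ctx B n v s) {z o m : ℕ} (h13 : s.reg 13 = z)
    (h14 : s.reg 14 = o) (h15 : s.reg 15 = m) (hm : o + m ≤ n) :
    Run B ω weigh s (8000 * (n + 1)) fun s' => s'.reg 16 = wsum (fun t => v (o + t)) m z := by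
  have hS : ∀ j ≤ m, wsum (fun t => v (o + t)) j z < 2 ^ B := fun j hj =>
    hC.lt n ((wsum_le _ _ _).trans ((sum_shift_le v (by omega)).trans hC.hv.le))
  refine Run.le (k₁ := 1000 + (1000 + (m * (2000 + 2000) + 2000))) ?_ (by nlinarith)
  refine Run.assign_seq 0 ho rfl (by simp) fun ho => ?_
  refine Run.assign_seq z ho (by simp [h13]) (h13 ▸ ho.reg 13) fun ho => ?_
  refine Run.mono (Run.for (m := m) (k := 1000 + 1000)
    (fun j s' => s'.reg 16 = wsum (fun t => v (o + t)) j z ∧ s'.reg 17 = z / 2 ^ j)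
    ho (by simp [h15]) rfl rfl (by norm_num) (by simp [wsum]) ?_) le_rfl fun _ _ _ h => h.1
  rintro j hj s' ho' hF hr ⟨hI, hI'⟩
  have h3 : s'.arr 3 = v := by rw [hF.arr 3]; exact hC.a3
  have h14' : s'.reg 14 = o := by rw [hF.reg 14]; simpa using h14
  refine Run.assign_seq (wsum (fun t => v (o + t)) (j + 1) z) ho'
    (by simp [hI, hI', h3, h14', hr, wsum_succ]) (hS _ hj) fun ho' => ?_
  refine Run.assign_last (z / 2 ^ (j + 1)) ho'
    (by simp [hI', pow_succ, Nat.div_div_eq_div_mul])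
    (lt_of_le_of_lt (Nat.div_le_self _ _) (h13 ▸ ‹Ok B s›.reg 13)) (by simp)

/-! ### Recording masks -/

/-- Every mask in `S` has been recorded in the dictionary `5`, and register `10` tells whether two
masks of the same weight have been found. -/
structure Rec (n : ℕ) (v : ℕ → ℕ) (S : Set ℕ) (s : State) : Prop where
  dict : ∀ y, s.arr 5 y ≠ 0 → s.arr 5 y - 1 < 2 ^ n ∧ wsum v n (s.arr 5 y - 1) = y
  mem : s.reg 10 = 0 → ∀ z ∈ S, s.arr 5 (wsum v n z) = z + 1
  found : s.reg 10 ≠ 0 → s.reg 11 ≠ s.reg 12 ∧ s.reg 11 < 2 ^ n ∧ s.reg 12 < 2 ^ n ∧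
    wsum v n (s.reg 11) = wsum v n (s.reg 12)

/-- The program does not modify the dictionary. -/
def Cmd.quiet (c : Cmd) : Bool := !(c.modR 10 || c.modR 11 || c.modR 12 || c.modA 5)

variable {S S' : Set ℕ}

theorem Rec.fr {s' : State} (h : Rec n v S s) (hF : Fr c s s') (hc : c.quiet = true := by rfl) :
    Rec n v S s' := by
  simp only [Cmd.quiet, Bool.not_eq_true', Bool.or_eq_false_iff] at hc
  obtain ⟨⟨⟨h10, h11⟩, h12⟩, h5⟩ := hc
  obtain ⟨h1, h2, h3⟩ := h
  rw [← hF.reg 10 h10, ← hF.arr 5 h5] at h2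
  rw [← hF.reg 10 h10, ← hF.reg 11 h11, ← hF.reg 12 h12] at h3
  rw [← hF.arr 5 h5] at h1
  exact ⟨h1, h2, h3⟩

/-- Having recorded additional masks never hurts, so sets of masks that are irrelevant for the proof
may be forgotten. -/
theorem Rec.subset (h : Rec n v S s) (hS : S' ⊆ S) : Rec n v S' s :=
  ⟨h.dict, fun h0 z hz => h.mem h0 z (hS hz), h.found⟩

theorem Rec.setReg (h : Rec n v S s) {x y : ℕ} (hx : 10 ≠ x ∧ 11 ≠ x ∧ 12 ≠ x := by norm_num) :
    Rec n v S (s.setReg x y) :=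
  h.fr (Fr.setReg s x y) (by
    simp only [Cmd.quiet, Cmd.modR, Cmd.modA]
    simp; omega)

theorem Rec.setArr (h : Rec n v S s) {a i y : ℕ} (hx : 5 ≠ a := by norm_num) :
    Rec n v S (s.setArr a i y) :=
  h.fr (Fr.setArr s a i y) (by
    simp only [Cmd.quiet, Cmd.modR, Cmd.modA]
    simp; omega)

/-- Otherwise the dictionary cell of the common weight would contain both `x + 1` and `y + 1`. -/
theorem Rec.exists_found (h : Rec n v S s) {x y : ℕ} (hx : x ∈ S) (hy : y ∈ S) (hne : x ≠ y)
    (he : wsum v n x = wsum v n y) : s.reg 10 ≠ 0 := by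
  intro h0
  have h1 := h.mem h0 x hx
  have h2 := h.mem h0 y hy
  rw [he] at h1
  omega

/-- Record the mask in register `19`. -/
def record : Cmd :=
  .assign 13 (.reg 19) ;; .assign 14 0 ;; .assign 15 (.reg 0) ;; weigh ;;
    .assign 20 (.read 5 (.reg 16)) ;;
    .ite (.reg 20)
      (.ite (.op .eq (.reg 20) (.reg 19 + 1)) .skip
        (.assign 11 (.reg 19) ;; .assign 12 (.reg 20 - 1) ;; .assign 10 1))
      (.write 5 (.reg 16) (.reg 19 + 1))

/-- Cells store the mask plus one, so `0` means empty. A cell holding a different mask yields a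
collision; meeting the same mask again does not. The weight is computed here, so the caller may
submit any mask, even one whose weight is not what was intended. -/
theorem record_run (ho : Ok B s) (hC : Ctx B n v s) {z : ℕ} (h19 : s.reg 19 = z) (hz : z < 2 ^ n)
    (hR : Rec n v S s) : Run B ω record s (20000 * (n + 1)) (Rec n v (insert z S)) := by
  refine Run.le (k₁ := 1000 + (1000 + (1000 + (8000 * (n + 1) + (1000 + (1000 + (1000 +
    (1000 + (1000 + 1000)))))))))
    ?_ (by omega)
  have hz2 : z + 1 < 2 ^ B := hC.lt (n + 1) (by rw [pow_succ]; omega)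
  refine Run.assign_seq z ho (by simp [h19]) (by omega) fun ho => ?_
  refine Run.assign_seq 0 ho rfl (by simp) fun ho => ?_
  refine Run.assign_seq n ho (by simp [hC.r0]) (hC.r0 ▸ ho.reg 0) fun ho => ?_
  refine Run.seq (weigh_run ho (hC.setReg.setReg.setReg) (z := z) (o := 0) (m := n)
    (by simp) (by simp) (by simp) (by simp)) fun s₁ ho₁ hF hS => ?_
  have hC₁ : Ctx B n v s₁ := (hC.setReg.setReg.setReg).fr hF
  have hR₁ : Rec n v S s₁ := (hR.setReg.setReg.setReg).fr hF
  have h19₁ : s₁.reg 19 = z := by rw [hF.reg 19]; simpa using h19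
  simp only [zero_add] at hS
  clear hF
  refine Run.assign_seq (s₁.arr 5 (wsum v n z)) ho₁ (by simp [hS]) (ho₁.arr 5 _) fun ho₂ => ?_
  refine Run.ite ho₂ (fun h => ?_) (fun h => ?_)
  · refine Run.ite ho₂ (fun h' => ?_) (fun h' => ?_)
    · refine (Run.skip ho₂ ?_).le (by norm_num)
      simp [h19₁] at h h'
      refine ⟨(hR₁.setReg (x := 20)).dict, ?_, (hR₁.setReg (x := 20)).found⟩
      rintro h0 y (rfl | hy)
      · simpa using h'
      · exact (hR₁.setReg (x := 20)).mem h0 y hy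
    · simp [h19₁] at h h'
      have h20 := ho₁.arr 5 (wsum v n z)
      refine Run.assign_seq z ho₂ (by simp [h19₁]) (by omega) fun ho₂ => ?_
      refine Run.assign_seq (s₁.arr 5 (wsum v n z) - 1) ho₂ (by simp) (by omega) fun ho₂ => ?_
      refine Run.assign_last 1 ho₂ rfl (hC.lt 0 (by simp)) ?_
      have hd := hR₁.dict _ h
      refine ⟨hR₁.dict, by simp, fun _ => ?_⟩
      simp only [State.setReg_reg]
      exact ⟨by simp; omega, by simpa using hz, by simpa using hd.1, by simpa using hd.2.symm⟩
  · refine Run.le (k₁ := 1000) ?_ (by norm_num)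
    simp at h
    refine Run.write_last (wsum v n z) (z + 1) ho₂ (by simp [hS]) (by simp [h19₁]) hz2 ?_
    refine ⟨fun y hy => ?_, fun h0 y hy => ?_, fun h0 => hR₁.found h0⟩
    · rw [State.setArr_arr_same] at hy ⊢
      by_cases hyz : y = wsum v n z
      · subst hyz; simpa using hz
      · rw [Function.update_of_ne hyz] at hy ⊢
        exact hR₁.dict y hy
    · rw [State.setArr_arr_same]
      rcases hy with rfl | hy
      · simp
      · have h1 := hR₁.mem h0 y hy
        rw [Function.update_of_ne]
        · exact h1
        · intro he
          rw [he, h] at h1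
          omega

end PES

/-! ### Tries of subset sums -/

namespace PES

variable {B : ℕ} {ω : ℕ → Bool} {c c₁ c₂ : Cmd} {s : State} {k k₁ k₂ : ℕ} {Q Q₁ : State → Prop}
variable {n : ℕ} {v : ℕ → ℕ} {S S' : Set ℕ}

/-! ### Binary tries as arrays -/

/-- The number of `b < m` such that `z` is a node of the trie above the leaf `2 ^ E + x b`. -/
def trieCount (E : ℕ) (x : ℕ → ℕ) (m z : ℕ) : ℕ :=
  ((Finset.range m).filter fun b => ∃ l ≤ E, (2 ^ E + x b) / 2 ^ l = z).card

theorem trieCount_le (E : ℕ) (x : ℕ → ℕ) (m z : ℕ) : trieCount E x m z ≤ m :=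
  (Finset.card_filter_le _ _).trans (Finset.card_range m).le

theorem trieCount_succ (E : ℕ) (x : ℕ → ℕ) (m z : ℕ) :
    trieCount E x (m + 1) z
      = trieCount E x m z + if ∃ l ≤ E, (2 ^ E + x m) / 2 ^ l = z then 1 else 0 := by
  rw [trieCount, Finset.range_add_one, Finset.filter_insert]
  split_ifs with h
  · rw [Finset.card_insert_of_notMem (by simp)]; rfl
  · rfl

/-- Each step towards the root at least halves a positive label, so the nodes on a path are distinct
and an insertion increments each of their counters exactly once. -/
theorem div_two_pow_ne {X l l' : ℕ} (h : l' < l) (hX : X / 2 ^ l ≠ 0) : X / 2 ^ l' ≠ X / 2 ^ l := by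
  obtain ⟨d, rfl⟩ := Nat.exists_eq_add_of_lt h
  rw [show l' + d + 1 = l' + (d + 1) by ring, pow_add, ← Nat.div_div_eq_div_mul] at hX ⊢
  have h2 : 2 ≤ 2 ^ (d + 1) := Nat.le_self_pow (by omega) 2
  generalize X / 2 ^ l' = W at *
  have h3 : W / 2 ^ (d + 1) ≤ W / 2 := Nat.div_le_div_left h2 (by norm_num)
  omega

/-- Nodes are numbered as in a heap: the root is `1` and the parent of `z` is `z / 2`. The labels at
height `l` fill one dyadic interval, so a label determines its height. -/
theorem trie_div_bounds {E x l : ℕ} (hx : x < 2 ^ E) (hl : l ≤ E) :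
    2 ^ (E - l) ≤ (2 ^ E + x) / 2 ^ l ∧ (2 ^ E + x) / 2 ^ l < 2 * 2 ^ (E - l) := by
  have h : 2 ^ E = 2 ^ (E - l) * 2 ^ l := by rw [← pow_add]; congr 1; omega
  constructor
  · rw [Nat.le_div_iff_mul_le (by positivity)]; omega
  · rw [Nat.div_lt_iff_lt_mul (by positivity)]; nlinarith

/-- The number of `b < m` with `x b < Y`, as far as the bits from `l` on decide it. -/
def trieLow (E : ℕ) (x : ℕ → ℕ) (m Y l : ℕ) : ℕ :=
  ((Finset.range m).filter fun b => (2 ^ E + x b) / 2 ^ l < (2 ^ E + Y) / 2 ^ l).card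

theorem trieLow_zero (E : ℕ) (x : ℕ → ℕ) (m Y : ℕ) :
    trieLow E x m Y 0 = ((Finset.range m).filter fun b => x b < Y).card := by
  simp [trieLow]

theorem trieLow_top {E : ℕ} {x : ℕ → ℕ} {m Y : ℕ} (hY : Y < 2 ^ E) : trieLow E x m Y E = 0 := by
  rw [trieLow, Finset.card_eq_zero, Finset.filter_eq_empty_iff]
  intro b _
  have h1 := trie_div_bounds hY le_rfl
  have h2 : 1 ≤ (2 ^ E + x b) / 2 ^ E := by
    rw [Nat.le_div_iff_mul_le (by positivity)]; omega
  rw [Nat.sub_self, pow_zero] at h1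
  omega

/-- One more bit decides additional comparisons only for leaves with the same parent node as `Y`,
and only if the node of `Y` is a right child. Those leaves lie below its left sibling, the label
minus one. -/
theorem trieLow_step {E : ℕ} {x : ℕ → ℕ} {m Y l : ℕ} (hx : ∀ b < m, x b < 2 ^ E) (hY : Y < 2 ^ E)
    (hl : l < E) :
    trieLow E x m Y l = trieLow E x m Y (l + 1) +
      if (2 ^ E + Y) / 2 ^ l % 2 = 0 then 0 else trieCount E x m ((2 ^ E + Y) / 2 ^ l - 1) := by
  have hZ := trie_div_bounds hY hl.le
  have h2 : 2 ≤ 2 ^ (E - l) := Nat.le_self_pow (by omega) 2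
  have hdiv : ∀ X : ℕ, X / 2 ^ (l + 1) = X / 2 ^ l / 2 := fun X => by
    rw [pow_succ, Nat.div_div_eq_div_mul]
  split_ifs with h
  · rw [add_zero, trieLow, trieLow]
    congr 1
    ext b
    simp only [Finset.mem_filter, hdiv]
    refine and_congr_right fun _ => ?_
    omega
  · rw [trieLow, trieLow, trieCount, ← Finset.card_union_of_disjoint]
    · congr 1
      ext b
      simp only [Finset.mem_filter, Finset.mem_union, ← and_or_left, hdiv, Finset.mem_range]
      refine and_congr_right fun hb => ⟨fun h' => ?_, ?_⟩
      · by_cases he : (2 ^ E + x b) / 2 ^ l = (2 ^ E + Y) / 2 ^ l - 1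
        · exact Or.inr ⟨l, hl.le, he⟩
        · left; omega
      · rintro (h' | ⟨l', hl', he⟩)
        · omega
        · have hb' := trie_div_bounds (hx b hb) hl'
          have hp : 2 ^ (E - l) % 2 = 0 := by
            rw [show E - l = (E - l - 1) + 1 by omega, pow_succ]; omega
          -- The label intervals of different heights are disjoint.
          have hll : l' = l := by
            rcases lt_trichotomy l' l with h3 | h3 | h3
            · have : 2 * 2 ^ (E - l) ≤ 2 ^ (E - l') := by
                rw [← pow_succ']; exact Nat.pow_le_pow_right (by norm_num) (by omega)
              omega
            · exact h3
            · have : 2 * 2 ^ (E - l') ≤ 2 ^ (E - l) := by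
                rw [← pow_succ']; exact Nat.pow_le_pow_right (by norm_num) (by omega)
              omega
          subst hll
          omega
    · rw [Finset.disjoint_filter]
      rintro b hb h1 ⟨l', hl', he⟩
      rw [Finset.mem_range] at hb
      have hb' := trie_div_bounds (hx b hb) hl'
      have hp : 2 ^ (E - l) % 2 = 0 := by
        rw [show E - l = (E - l - 1) + 1 by omega, pow_succ]; omega
      have hll : l' = l := by
        rcases lt_trichotomy l' l with h3 | h3 | h3
        · have : 2 * 2 ^ (E - l) ≤ 2 ^ (E - l') := by
            rw [← pow_succ']; exact Nat.pow_le_pow_right (by norm_num) (by omega)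
          omega
        · exact h3
        · have : 2 * 2 ^ (E - l') ≤ 2 ^ (E - l) := by
            rw [← pow_succ']; exact Nat.pow_le_pow_right (by norm_num) (by omega)
          omega
      subst hll
      rw [hdiv, hdiv] at h1
      omega

/-! ### The three parts of the weights -/

/-- The sum of the weights among the `⌊2n/5⌋` least ones over the bits of `a`. -/
def lowSum (n : ℕ) (v : ℕ → ℕ) (a : ℕ) : ℕ := wsum (fun t => v (0 + t)) (2 * n / 5) a

/-- The sum of the weights among the next `⌊2n/5⌋` ones over the bits of `b`. -/
def midSum (n : ℕ) (v : ℕ → ℕ) (b : ℕ) : ℕ := wsum (fun t => v (2 * n / 5 + t)) (2 * n / 5) b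

/-- The sum of the remaining weights over the bits of `u`. -/
def topSum (n : ℕ) (v : ℕ → ℕ) (u : ℕ) : ℕ :=
  wsum (fun t => v (2 * (2 * n / 5) + t)) (n - 2 * (2 * n / 5)) u

theorem midSum_lt (hv : ∑ t ∈ Finset.range n, v t < 2 ^ n) (b : ℕ) : midSum n v b < 2 ^ n :=
  ((wsum_le _ _ _).trans (sum_shift_le v (by omega))).trans_lt hv

theorem topSum_lt (hv : ∑ t ∈ Finset.range n, v t < 2 ^ n) (u : ℕ) : topSum n v u < 2 ^ n :=
  ((wsum_le _ _ _).trans (sum_shift_le v (by omega))).trans_lt hv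

/-- The trie `6` and the inverse table `7` of the middle sums of all `b < j`. -/
structure Built (n : ℕ) (v : ℕ → ℕ) (j : ℕ) (s : State) : Prop where
  trie : ∀ z, s.arr 6 z = trieCount (n + 1) (midSum n v) j z
  inv : ∀ y, s.arr 7 y ≠ 0 → s.arr 7 y - 1 < 2 ^ (2 * n / 5) ∧ midSum n v (s.arr 7 y - 1) = y
  cover : ∀ b < j, s.arr 7 (midSum n v b) ≠ 0

theorem Built.fr {s' : State} {j : ℕ} (h : Built n v j s) (hF : Fr c s s')
    (h6 : c.modA 6 = false := by rfl) (h7 : c.modA 7 = false := by rfl) : Built n v j s' := by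
  obtain ⟨h1, h2, h3⟩ := h
  rw [← hF.arr 6 h6] at h1
  rw [← hF.arr 7 h7] at h2 h3
  exact ⟨h1, h2, h3⟩

theorem Built.setReg {j x y : ℕ} (h : Built n v j s) : Built n v j (s.setReg x y) :=
  ⟨h.trie, h.inv, h.cover⟩

/-- Insert the leaf in register `22` into the trie `6`. -/
def trieInsert : Cmd :=
  .for 23 24 (.write 6 (.reg 22) (.read 6 (.reg 22) + 1) ;; .assign 22 (.reg 22 / 2))

theorem trieInsert_run (ho : Ok B s) {E m : ℕ} {x : ℕ → ℕ} (h22 : s.reg 22 = 2 ^ E + x m)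
    (h24 : s.reg 24 = E + 1) (hm : m + 1 < 2 ^ B) (ht : ∀ z, s.arr 6 z = trieCount E x m z) :
    Run B ω trieInsert s ((E + 1) * 4000 + 2000)
      fun s' => ∀ z, s'.arr 6 z = trieCount E x (m + 1) z := by
  refine Run.mono (Run.for (m := E + 1) (k := 1000 + 1000)
    (fun j s' => s'.reg 22 = (2 ^ E + x m) / 2 ^ j ∧ ∀ z, s'.arr 6 z = trieCount E x m z +
      if ∃ l < j, (2 ^ E + x m) / 2 ^ l = z then 1 else 0)
    ho h24 rfl rfl (by norm_num) ⟨by simp [h22], fun z => by simp [ht]⟩ ?_) le_rfl ?_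
  · rintro j hj s' ho' hF hr ⟨hI, hI'⟩
    -- The current node has not been visited before on this path, so its counter still has the old
    -- value.
    have hne : ¬∃ l < j, (2 ^ E + x m) / 2 ^ l = (2 ^ E + x m) / 2 ^ j := by
      rintro ⟨l, hl, he⟩
      refine div_two_pow_ne hl ?_ he
      refine (Nat.div_pos ?_ (by positivity)).ne'
      exact (Nat.pow_le_pow_right (by norm_num) (by omega)).trans (Nat.le_add_right _ _)
    have h1 := hI' ((2 ^ E + x m) / 2 ^ j)
    rw [if_neg hne, add_zero] at h1
    have h2 := trieCount_le E x m ((2 ^ E + x m) / 2 ^ j)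
    refine Run.write_seq ((2 ^ E + x m) / 2 ^ j) (trieCount E x m ((2 ^ E + x m) / 2 ^ j) + 1) ho'
      (by simp [hI]) (by simp [hI, h1]) (by omega) fun ho' => ?_
    refine Run.assign_last ((2 ^ E + x m) / 2 ^ (j + 1)) ho'
      (by simp [hI, pow_succ, Nat.div_div_eq_div_mul])
      (lt_of_le_of_lt (Nat.div_le_self _ _) (h22 ▸ ho.reg 22)) ⟨by simp, fun z => ?_⟩
    simp only [State.setReg_arr, State.setArr_arr_same, Function.update_apply]
    have hex : (∃ l < j + 1, (2 ^ E + x m) / 2 ^ l = z) ↔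
        (∃ l < j, (2 ^ E + x m) / 2 ^ l = z) ∨ z = (2 ^ E + x m) / 2 ^ j := by
      simp only [Nat.lt_succ_iff_lt_or_eq]
      constructor
      · rintro ⟨l, hl | rfl, he⟩
        · exact Or.inl ⟨l, hl, he⟩
        · exact Or.inr he.symm
      · rintro (⟨l, hl, he⟩ | he)
        · exact ⟨l, Or.inl hl, he⟩
        · exact ⟨j, Or.inr rfl, he.symm⟩
    split_ifs with hz hz' hz'
    · rw [hz]
    · exact absurd (hex.2 (Or.inr hz)) hz'
    · rw [hI' z, if_pos ((hex.1 hz').resolve_right hz)]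
    · rw [hI' z, if_neg fun h => hz' (hex.2 (Or.inl h))]
  · rintro s' - - ⟨-, h⟩ z
    rw [h, trieCount_succ]
    simp only [Nat.lt_succ_iff]

/-- Build the trie and the inverse table of the middle sums, and record the middle masks. -/
def build : Cmd :=
  .assign 24 (.reg 0 + 2) ;; .for 21 2
    (.assign 13 (.reg 21) ;; .assign 14 (.reg 1) ;; .assign 15 (.reg 1) ;; weigh ;;
      .assign 22 (.reg 7 + .reg 16) ;; trieInsert ;; .write 7 (.reg 16) (.reg 21 + 1) ;;
      .assign 19 (.reg 21 * .reg 2) ;; record)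

theorem pow_split (n : ℕ) : 2 ^ (2 * n / 5) * 2 ^ (2 * n / 5) * 2 ^ (n - 2 * (2 * n / 5)) = 2 ^ n := by
  rw [← pow_add, ← pow_add]; congr 1; omega

theorem four_pow_eq (m : ℕ) : 4 ^ m = 2 ^ m * 2 ^ m := by
  rw [← mul_pow]; norm_num

/-- The inverse table keeps only one preimage of each middle sum. Nothing is lost: the masks with
middle bits only are recorded as well, and two of them with the same sum are already a solution. -/
theorem build_run (ho : Ok B s) (hC : Ctx B n v s) (hR : Rec n v S s) (h6 : s.arr 6 = fun _ => 0)
    (h7 : s.arr 7 = fun _ => 0) :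
    Run B ω build s (60000 * (n + 1) * 2 ^ (2 * n / 5)) fun s' => Built n v (2 ^ (2 * n / 5)) s' ∧
      Rec n v (S ∪ {z | ∃ b < 2 ^ (2 * n / 5), z = b * 2 ^ (2 * n / 5)}) s' := by
  have hp : 1 ≤ 2 ^ (2 * n / 5) := Nat.one_le_two_pow
  have hsplit := pow_split n
  have hp' : 1 ≤ 2 ^ (n - 2 * (2 * n / 5)) := Nat.one_le_two_pow
  have hKn : 2 ^ (2 * n / 5) ≤ 2 ^ n := Nat.pow_le_pow_right (by norm_num) (by omega)
  refine Run.le (k₁ := 1000 + (2 ^ (2 * n / 5) * ((1000 + (1000 + (1000 + (8000 * (n + 1) + (1000 +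
    (((n + 1 + 1) * 4000 + 2000) + (1000 + (1000 + 20000 * (n + 1)))))))))
      + 2000) + 2000)) ?_ (by nlinarith)
  -- The sums are below `2 ^ n`, but queries go up to `2 ^ n` inclusive; hence depth `n + 1`, and `n
  -- + 2` nodes on a path.
  refine Run.assign_seq (n + 2) ho (by simp [hC.r0])
    (hC.lt (n + 2) (Nat.lt_two_pow_self).le) fun ho => ?_
  refine Run.mono (Run.for (m := 2 ^ (2 * n / 5))
    (fun j s' => Built n v j s' ∧ Rec n v (S ∪ {z | ∃ b < j, z = b * 2 ^ (2 * n / 5)}) s')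
    ho (by simp [hC.r2]) rfl rfl (by norm_num) ⟨⟨?_, ?_, ?_⟩, ?_⟩ ?_) le_rfl fun _ _ _ h => h
  · simp [h6, trieCount]
  · simp [h7]
  · simp
  · simpa using hR.setReg.setReg
  rintro j hj s' ho' hF hr ⟨hI, hI'⟩
  have hC' : Ctx B n v s' := (hC.setReg (x := 24)).fr hF
  have h24 : s'.reg 24 = n + 2 := by rw [hF.reg 24]; simp
  have hjB : j + 1 < 2 ^ B := hC.lt (n + 1) (by rw [pow_succ]; omega)
  have hKB : 2 * n / 5 < 2 ^ B := hC.r1 ▸ ‹Ok B s›.reg 1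
  clear hF
  refine Run.assign_seq j ho' (by simp [hr]) (by omega) fun ho' => ?_
  refine Run.assign_seq (2 * n / 5) ho' (by simp [hC'.r1]) hKB fun ho' => ?_
  refine Run.assign_seq (2 * n / 5) ho' (by simp [hC'.r1]) hKB fun ho' => ?_
  refine Run.seq (weigh_run ho' (hC'.setReg.setReg.setReg) (z := j) (o := 2 * n / 5)
    (m := 2 * n / 5) (by simp) (by simp) (by simp) (by omega)) fun s₁ ho₁ hF hS => ?_
  change s₁.reg 16 = midSum n v j at hS
  have hC₁ : Ctx B n v s₁ := (hC'.setReg.setReg.setReg).fr hF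
  have hI₁ : Built n v j s₁ := (hI.setReg.setReg.setReg).fr hF
  have hR₁ := (hI'.setReg (x := 13) (y := j) |>.setReg (x := 14) (y := 2 * n / 5)
    |>.setReg (x := 15) (y := 2 * n / 5)).fr hF
  have h24₁ : s₁.reg 24 = n + 2 := by rw [hF.reg 24]; simpa using h24
  have hr₁ : s₁.reg 21 = j := by rw [hF.reg 21]; simpa using hr
  clear hF
  have hlt := midSum_lt hC.hv j
  refine Run.assign_seq (2 ^ (n + 1) + midSum n v j) ho₁ (by simp [hC₁.r7, hS])
    (hC.lt (n + 2) (by rw [pow_succ _ (n + 1), pow_succ]; omega)) fun ho₁ => ?_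
  refine Run.seq (trieInsert_run ho₁ (E := n + 1) (m := j) (x := midSum n v) (by simp)
    (by simp [h24₁]) hjB (by simpa using hI₁.trie)) fun s₂ ho₂ hF hT => ?_
  have hC₂ : Ctx B n v s₂ := (hC₁.setReg (x := 22)).fr hF
  have hR₂ := (hR₁.setReg (x := 22) (y := 2 ^ (n + 1) + midSum n v j)).fr hF
  have h7₂ : s₂.arr 7 = s₁.arr 7 := hF.arr 7
  have hS₂ : s₂.reg 16 = midSum n v j := by rw [hF.reg 16]; simpa using hS
  have hr₂ : s₂.reg 21 = j := by rw [hF.reg 21]; simpa using hr₁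
  clear hF
  refine Run.write_seq (midSum n v j) (j + 1) ho₂ (by simp [hS₂]) (by simp [hr₂]) hjB fun ho₂ => ?_
  have hmask : j * 2 ^ (2 * n / 5) < 2 ^ n := by nlinarith
  refine Run.assign_seq (j * 2 ^ (2 * n / 5)) ho₂ (by simp [hr₂, hC₂.r2])
    (hC.lt n hmask.le) fun ho₂ => ?_
  refine Run.mono (record_run ho₂ (hC₂.setArr.setReg) (z := j * 2 ^ (2 * n / 5)) (by simp)
    hmask (hR₂.setArr.setReg)) le_rfl fun s₃ ho₃ hF hR₃ => ⟨Built.setReg (Built.fr ?_ hF), ?_⟩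
  · refine ⟨by simpa [State.setArr_arr] using hT, fun y => ?_, fun b hb => ?_⟩
    · simp only [State.setReg_arr, State.setArr_arr_same, Function.update_apply, h7₂]
      split_ifs with hy
      · intro _; subst hy; exact ⟨by simpa using hj, by simp⟩
      · exact hI₁.inv y
    · simp only [State.setReg_arr, State.setArr_arr_same, Function.update_apply, h7₂]
      split_ifs with hy
      · omega
      · refine hI₁.cover b (lt_of_le_of_ne (by omega) ?_)
        rintro rfl
        exact hy rfl
  · refine (hR₃.setReg (x := 21)).subset ?_
    rintro z (hz | ⟨b, hb, rfl⟩)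
    · exact Or.inr (Or.inl hz)
    · rcases Nat.lt_succ_iff_lt_or_eq.1 hb with hb | rfl
      · exact Or.inr (Or.inr ⟨b, hb, rfl⟩)
      · exact Or.inl rfl

end PES

/-! ### Counting masks below a bound, and the binary search -/

namespace PES

variable {B : ℕ} {ω : ℕ → Bool} {c c₁ c₂ : Cmd} {s : State} {k k₁ k₂ : ℕ} {Q Q₁ : State → Prop}
variable {n : ℕ} {v : ℕ → ℕ} {S S' : Set ℕ}

/-! ### Counting the masks of small weight -/

/-- Add to register `26` the number of leaves of the trie left of the leaf in register `33`. -/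
def trieQuery : Cmd :=
  .for 34 35 (.ite (.reg 33 % 2) (.assign 26 (.reg 26 + .read 6 (.reg 33 - 1))) .skip ;;
    .assign 33 (.reg 33 / 2))

/-- While climbing from the leaf of `Y`, the accumulated count plus the number of comparisons
decided by the remaining upper bits is constant. At the root nothing remains (`trieLow_top`). -/
theorem trieQuery_run (ho : Ok B s) {E m Y C : ℕ} {x : ℕ → ℕ} (hx : ∀ b < m, x b < 2 ^ E)
    (hY : Y < 2 ^ E) (h33 : s.reg 33 = 2 ^ E + Y) (h35 : s.reg 35 = E) (h26 : s.reg 26 = C)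
    (hC : C + m < 2 ^ B) (ht : ∀ z, s.arr 6 z = trieCount E x m z) :
    Run B ω trieQuery s (E * 5000 + 2000)
      fun s' => s'.reg 26 = C + ((Finset.range m).filter fun b => x b < Y).card := by
  rw [← trieLow_zero E x m Y]
  have hle : ∀ j, trieLow E x m Y j ≤ m := fun j =>
    (Finset.card_filter_le _ _).trans (Finset.card_range m).le
  refine Run.mono (Run.for (m := E) (k := (1000 + 1000) + 1000)
    (fun j s' => s'.reg 33 = (2 ^ E + Y) / 2 ^ j ∧
      s'.reg 26 + trieLow E x m Y j = C + trieLow E x m Y 0)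
    ho h35 rfl rfl (by norm_num) ⟨by simp [h33], by simp [h26]⟩ ?_) le_rfl ?_
  · rintro j hj s' ho' hF hr ⟨hI, hI'⟩
    have h6 : ∀ z, s'.arr 6 z = trieCount E x m z := by rw [hF.arr 6]; exact ht
    have hst := trieLow_step hx hY hj
    have hl0 := hle 0
    refine Run.seq (Q₁ := fun s' => s'.reg 33 = (2 ^ E + Y) / 2 ^ j ∧
      s'.reg 26 + trieLow E x m Y (j + 1) = C + trieLow E x m Y 0)
      (Run.ite ho' (fun h => ?_) (fun h => ?_)) ?_
    · simp [hI] at h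
      rw [if_neg (by omega)] at hst
      refine Run.assign_last (s'.reg 26 + trieCount E x m ((2 ^ E + Y) / 2 ^ j - 1)) ho'
        (by simp [hI, h6]) (by omega) ⟨by simpa using hI, ?_⟩
      simp
      omega
    · simp [hI] at h
      rw [if_pos (by omega)] at hst
      exact (Run.skip ho' ⟨hI, by omega⟩).le (by norm_num)
    · rintro s₁ ho₁ - ⟨h1, h2⟩
      refine Run.assign_last ((2 ^ E + Y) / 2 ^ (j + 1)) ho₁
        (by simp [h1, pow_succ, Nat.div_div_eq_div_mul])
        (lt_of_le_of_lt (Nat.div_le_self _ _) (h33 ▸ ho.reg 33)) ⟨by simp, by simpa using h2⟩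
  · rintro s' - - ⟨-, h⟩
    rw [trieLow_top hY] at h
    omega

/-- The number of middle parts that complete the low part `a` and the top part `u` to a weight
less than `X`. -/
def partCount (n : ℕ) (v : ℕ → ℕ) (X u a : ℕ) : ℕ :=
  ((Finset.range (2 ^ (2 * n / 5))).filter
    fun b => midSum n v b < X - (topSum n v u + lowSum n v a)).card

/-- The mask with the parts `u` and `a` that completes them to the weight `X` according to the
table `d`. -/
def partMask (n : ℕ) (v d : ℕ → ℕ) (X u a : ℕ) : ℕ :=
  u * 4 ^ (2 * n / 5) + (d (X - (topSum n v u + lowSum n v a)) - 1) * 2 ^ (2 * n / 5) + a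

/-- Count and record the masks with the low part `reg 32` and the top part `reg 27 + reg 29`. -/
def scanLow : Cmd :=
  .assign 13 (.reg 32) ;; .assign 14 0 ;; .assign 15 (.reg 1) ;; weigh ;;
    .assign 36 (.reg 25 - (.reg 31 + .reg 16)) ;; .assign 33 (.reg 7 + .reg 36) ;;
    trieQuery ;; .assign 37 (.read 7 (.reg 36)) ;;
    .ite (.reg 37)
      (.assign 19 ((.reg 27 + .reg 29) * .reg 3 + (.reg 37 - 1) * .reg 2 + .reg 32) ;; record) .skip

theorem partMask_lt {d : ℕ → ℕ} {X u a : ℕ} (hu : u < 2 ^ (n - 2 * (2 * n / 5)))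
    (ha : a < 2 ^ (2 * n / 5))
    (hd : d (X - (topSum n v u + lowSum n v a)) - 1 < 2 ^ (2 * n / 5)) :
    partMask n v d X u a < 2 ^ n := by
  rw [← pow_split n, partMask, four_pow_eq]
  generalize 2 ^ (2 * n / 5) = K at *
  generalize 2 ^ (n - 2 * (2 * n / 5)) = L at *
  generalize d (X - (topSum n v u + lowSum n v a)) - 1 = b at *
  calc u * (K * K) + b * K + a < u * (K * K) + b * K + K := by omega
    _ = u * (K * K) + (b + 1) * K := by ring
    _ ≤ u * (K * K) + K * K := by gcongr; omega
    _ = (u + 1) * (K * K) := by ring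
    _ ≤ L * (K * K) := by gcongr; omega
    _ = _ := by ring

/-- The subtraction from `X` is truncated. If the top and low sums already reach `X`, the query
value is `0` and the count is rightly `0`. If they exceed `X`, the mask recorded may have a weight
other than `X`, which is harmless because `record` weighs it itself. -/
theorem scanLow_run (ho : Ok B s) (hC : Ctx B n v s) (hR : Rec n v S s)
    (hb : Built n v (2 ^ (2 * n / 5)) s) {X u a C : ℕ} {d : ℕ → ℕ} (hd : s.arr 7 = d)
    (hX : X ≤ 2 ^ n) (hu : u < 2 ^ (n - 2 * (2 * n / 5))) (ha : a < 2 ^ (2 * n / 5))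
    (h25 : s.reg 25 = X) (h2729 : s.reg 27 + s.reg 29 = u) (h31 : s.reg 31 = topSum n v u)
    (h32 : s.reg 32 = a) (h35 : s.reg 35 = n + 1) (h26 : s.reg 26 = C) (hCn : C ≤ 2 ^ (n + 2)) :
    Run B ω scanLow s (50000 * (n + 1)) fun s' => s'.reg 26 = C + partCount n v X u a ∧
      Rec n v (S ∪ {z | d (X - (topSum n v u + lowSum n v a)) ≠ 0 ∧ z = partMask n v d X u a}) s' := by
  have hKn : 2 ^ (2 * n / 5) ≤ 2 ^ n := Nat.pow_le_pow_right (by norm_num) (by omega)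
  have hp1 : 2 ^ (n + 1) = 2 * 2 ^ n := pow_succ' _ _
  have hp2 : 2 ^ (n + 2) = 4 * 2 ^ n := by ring
  have hp3 : 2 ^ (n + 3) = 8 * 2 ^ n := by ring
  have h3B : 2 ^ (n + 3) < 2 ^ B := hC.lt _ le_rfl
  refine Run.le (k₁ := 1000 + (1000 + (1000 + (8000 * (n + 1) + (1000 + (1000 +
    (((n + 1) * 5000 + 2000) + (1000 + (1000 + (1000 + 20000 * (n + 1))))))))))) ?_ (by omega)
  refine Run.assign_seq a ho (by simp [h32]) (by omega) fun ho => ?_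
  refine Run.assign_seq 0 ho rfl (by simp) fun ho => ?_
  refine Run.assign_seq (2 * n / 5) ho (by simp [hC.r1]) (hC.r1 ▸ ‹Ok B s›.reg 1) fun ho => ?_
  refine Run.seq (weigh_run ho (hC.setReg.setReg.setReg) (z := a) (o := 0)
    (m := 2 * n / 5) (by simp) (by simp) (by simp) (by omega)) fun s₁ ho₁ hF hS => ?_
  change s₁.reg 16 = lowSum n v a at hS
  have hC₁ : Ctx B n v s₁ := (hC.setReg.setReg.setReg).fr hF
  have hb₁ : Built n v _ s₁ := (hb.setReg.setReg.setReg).fr hF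
  have hR₁ := (hR.setReg (x := 13) (y := a) |>.setReg (x := 14) (y := 0)
    |>.setReg (x := 15) (y := 2 * n / 5)).fr hF
  have h25₁ : s₁.reg 25 = X := by rw [hF.reg 25]; simpa using h25
  have h26₁ : s₁.reg 26 = C := by rw [hF.reg 26]; simpa using h26
  have h27₁ : s₁.reg 27 = s.reg 27 := by rw [hF.reg 27]; simp
  have h29₁ : s₁.reg 29 = s.reg 29 := by rw [hF.reg 29]; simp
  have h31₁ : s₁.reg 31 = topSum n v u := by rw [hF.reg 31]; simpa using h31
  have h32₁ : s₁.reg 32 = a := by rw [hF.reg 32]; simpa using h32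
  have h35₁ : s₁.reg 35 = n + 1 := by rw [hF.reg 35]; simpa using h35
  have hd₁ : s₁.arr 7 = d := by rw [hF.arr 7]; simpa using hd
  clear hF
  refine Run.assign_seq (X - (topSum n v u + lowSum n v a)) ho₁ (by simp [h25₁, h31₁, hS])
    (by omega) fun ho₁ => ?_
  refine Run.assign_seq (2 ^ (n + 1) + (X - (topSum n v u + lowSum n v a))) ho₁
    (by simp [hC₁.r7]) (by omega) fun ho₁ => ?_
  refine Run.seq (trieQuery_run ho₁ (E := n + 1) (m := 2 ^ (2 * n / 5)) (x := midSum n v) (C := C)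
    (Y := X - (topSum n v u + lowSum n v a))
    (fun b _ => by have := midSum_lt hC.hv b; omega) (by omega) (by simp) (by simp [h35₁])
    (by simp [h26₁]) (by omega) (by simpa using hb₁.trie)) fun s₂ ho₂ hF h26₂ => ?_
  have hC₂ : Ctx B n v s₂ := (hC₁.setReg.setReg).fr hF
  have hR₂ := (hR₁.setReg (x := 36) (y := X - (topSum n v u + lowSum n v a)) |>.setReg (x := 33)
    (y := 2 ^ (n + 1) + (X - (topSum n v u + lowSum n v a)))).fr hF
  have h36₂ : s₂.reg 36 = X - (topSum n v u + lowSum n v a) := by rw [hF.reg 36]; simp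
  have h27₂ : s₂.reg 27 + s₂.reg 29 = u := by rw [hF.reg 27, hF.reg 29]; simp [h27₁, h29₁, h2729]
  have h32₂ : s₂.reg 32 = a := by rw [hF.reg 32]; simpa using h32₁
  have hd₂ : s₂.arr 7 = d := by rw [hF.arr 7]; simpa using hd₁
  clear hF
  refine Run.assign_seq (d (X - (topSum n v u + lowSum n v a))) ho₂ (by simp [h36₂, hd₂])
    (by rw [← hd₂]; exact ho₂.arr 7 _) fun ho₂ => ?_
  refine Run.ite ho₂ (fun h => ?_) (fun h => ?_)
  · simp at h
    have hlt := partMask_lt (d := d) hu ha (hd ▸ (hb.inv _ (by rw [hd]; exact h)).1)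
    refine Run.assign_seq (partMask n v d X u a) ho₂
      (by simp [h27₂, hC₂.r3, hC₂.r2, partMask, h32₂])
      (by omega) fun ho₂ => ?_
    refine Run.mono (record_run ho₂ (hC₂.setReg.setReg) (z := partMask n v d X u a) (by simp)
      hlt (hR₂.setReg.setReg)) le_rfl fun s₃ ho₃ hF hR₃ => ⟨?_, hR₃.subset ?_⟩
    · rw [hF.reg 26]
      simpa [partCount] using h26₂
    · rintro z (hz | ⟨-, rfl⟩)
      · exact Or.inr hz
      · exact Or.inl rfl
  · simp at h
    refine (Run.skip ho₂ ⟨by simpa [partCount] using h26₂, hR₂.setReg.subset ?_⟩).le (by omega)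
    rintro z (hz | ⟨h', -⟩)
    · exact hz
    · exact absurd h h'

/-- Count and record the masks with the top part `reg 27 + reg 29`. -/
def scanTop : Cmd :=
  .assign 13 (.reg 27 + .reg 29) ;; .assign 14 (2 * .reg 1) ;; .assign 15 (.reg 5) ;; weigh ;;
    .assign 31 (.reg 16) ;; .for 32 2 scanLow

theorem partCount_le (n : ℕ) (v : ℕ → ℕ) (X u a : ℕ) : partCount n v X u a ≤ 2 ^ (2 * n / 5) :=
  (Finset.card_filter_le _ _).trans (Finset.card_range _).le

theorem sum_partCount_le (n : ℕ) (v : ℕ → ℕ) (X u j : ℕ) :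
    ∑ a ∈ Finset.range j, partCount n v X u a ≤ j * 2 ^ (2 * n / 5) := by
  simpa using Finset.sum_le_card_nsmul (Finset.range j) _ _ fun a _ => partCount_le n v X u a

theorem scanTop_run (ho : Ok B s) (hC : Ctx B n v s) (hR : Rec n v S s)
    (hb : Built n v (2 ^ (2 * n / 5)) s) {X u C : ℕ} {d : ℕ → ℕ} (hd : s.arr 7 = d)
    (hX : X ≤ 2 ^ n) (hu : u < 2 ^ (n - 2 * (2 * n / 5)))
    (h25 : s.reg 25 = X) (h2729 : s.reg 27 + s.reg 29 = u) (h35 : s.reg 35 = n + 1)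
    (h26 : s.reg 26 = C) (hCn : C + 4 ^ (2 * n / 5) ≤ 2 ^ (n + 2)) :
    Run B ω scanTop s (70000 * (n + 1) * 2 ^ (2 * n / 5)) fun s' =>
      s'.reg 26 = C + ∑ a ∈ Finset.range (2 ^ (2 * n / 5)), partCount n v X u a ∧
      Rec n v (S ∪ {z | ∃ a < 2 ^ (2 * n / 5), d (X - (topSum n v u + lowSum n v a)) ≠ 0 ∧
        z = partMask n v d X u a}) s' := by
  have hp : 1 ≤ 2 ^ (2 * n / 5) := Nat.one_le_two_pow
  have hLn : 2 ^ (n - 2 * (2 * n / 5)) ≤ 2 ^ n := Nat.pow_le_pow_right (by norm_num) (by omega)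
  have hnB : 2 ^ n < 2 ^ B := hC.lt _ le_rfl
  have hn2 : n < 2 ^ n := Nat.lt_two_pow_self
  refine Run.le (k₁ := 1000 + (1000 + (1000 + (8000 * (n + 1) + (1000 +
    (2 ^ (2 * n / 5) * (50000 * (n + 1) + 2000) + 2000)))))) ?_ (by nlinarith)
  refine Run.assign_seq u ho (by simp [h2729]) (by omega) fun ho => ?_
  refine Run.assign_seq (2 * (2 * n / 5)) ho (by simp [hC.r1]) (by omega) fun ho => ?_
  refine Run.assign_seq (n - 2 * (2 * n / 5)) ho (by simp [hC.r5]) (by omega) fun ho => ?_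
  refine Run.seq (weigh_run ho (hC.setReg.setReg.setReg) (z := u) (o := 2 * (2 * n / 5))
    (m := n - 2 * (2 * n / 5)) (by simp) (by simp) (by simp) (by omega)) fun s₁ ho₁ hF hS => ?_
  change s₁.reg 16 = topSum n v u at hS
  have hC₁ : Ctx B n v s₁ := (hC.setReg.setReg.setReg).fr hF
  have hb₁ : Built n v _ s₁ := (hb.setReg.setReg.setReg).fr hF
  have hR₁ := (hR.setReg (x := 13) (y := u) |>.setReg (x := 14) (y := 2 * (2 * n / 5))
    |>.setReg (x := 15) (y := n - 2 * (2 * n / 5))).fr hF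
  have h25₁ : s₁.reg 25 = X := by rw [hF.reg 25]; simpa using h25
  have h26₁ : s₁.reg 26 = C := by rw [hF.reg 26]; simpa using h26
  have h27₁ : s₁.reg 27 + s₁.reg 29 = u := by rw [hF.reg 27, hF.reg 29]; simpa using h2729
  have h35₁ : s₁.reg 35 = n + 1 := by rw [hF.reg 35]; simpa using h35
  have hd₁ : s₁.arr 7 = d := by rw [hF.arr 7]; simpa using hd
  clear hF
  refine Run.assign_seq (topSum n v u) ho₁ (by simp [hS])
    ((topSum_lt hC.hv u).trans hnB) fun ho₁ => ?_
  refine Run.mono (Run.for (m := 2 ^ (2 * n / 5)) (fun j s' =>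
      s'.reg 26 = C + ∑ a ∈ Finset.range j, partCount n v X u a ∧ s'.arr 7 = d ∧
      Built n v (2 ^ (2 * n / 5)) s' ∧
      Rec n v (S ∪ {z | ∃ a < j, d (X - (topSum n v u + lowSum n v a)) ≠ 0 ∧
        z = partMask n v d X u a}) s') ho₁ (by simp [hC₁.r2]) rfl rfl (by norm_num)
      ⟨by simp [h26₁], by simpa using hd₁, hb₁.setReg.setReg, by simpa using hR₁.setReg.setReg⟩ ?_)
    le_rfl fun _ _ _ h => ⟨h.1, h.2.2.2⟩
  rintro j hj s' ho' hF hr ⟨h26', hd', hb', hR'⟩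
  have hsum := sum_partCount_le n v X u j
  have hj4 : j * 2 ^ (2 * n / 5) ≤ 4 ^ (2 * n / 5) := by rw [four_pow_eq]; gcongr
  refine Run.mono (scanLow_run ho' ((hC₁.setReg (x := 31)).fr hF) hR' hb' hd' hX hu hj
    (by rw [hF.reg 25]; simpa using h25₁) (by rw [hF.reg 27, hF.reg 29]; simpa using h27₁)
    (by rw [hF.reg 31]; simp) hr (by rw [hF.reg 35]; simpa using h35₁) h26' (by omega))
    le_rfl fun s₂ ho₂ hF₂ h₂ => ⟨?_, ?_, (hb'.fr hF₂).setReg, ?_⟩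
  · simp only [State.setReg_reg, h₂.1, Finset.sum_range_succ]
    simp [add_assoc]
  · rw [State.setReg_arr, hF₂.arr 7, hd']
  · refine h₂.2.setReg.subset ?_
    rintro z (hz | ⟨a, ha, hz⟩)
    · exact Or.inl (Or.inl hz)
    · rcases Nat.lt_succ_iff_lt_or_eq.1 ha with ha | rfl
      · exact Or.inl (Or.inr ⟨a, ha, hz⟩)
      · exact Or.inr hz

/-- The least top part that is scanned for the weight `X`. -/
def scanLo (n X : ℕ) : ℕ := min (X / 4 ^ (2 * n / 5) - (2 * n + 1)) (2 ^ (n - 2 * (2 * n / 5)))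

/-- The end of the range of the top parts that are scanned for the weight `X`. -/
def scanHi (n X : ℕ) : ℕ := min (X / 4 ^ (2 * n / 5) + 1 + n * n) (2 ^ (n - 2 * (2 * n / 5)))

/-- The count that is computed for the weight `X`. -/
def scanCount (n : ℕ) (v : ℕ → ℕ) (X : ℕ) : ℕ :=
  scanLo n X * 4 ^ (2 * n / 5) + ∑ i ∈ Finset.range (scanHi n X - scanLo n X),
    ∑ a ∈ Finset.range (2 ^ (2 * n / 5)), partCount n v X (scanLo n X + i) a

/-- The masks that are recorded for the weight `X`. -/
def scanSet (n : ℕ) (v d : ℕ → ℕ) (X : ℕ) : Set ℕ :=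
  {z | ∃ i < scanHi n X - scanLo n X, ∃ a < 2 ^ (2 * n / 5),
    d (X - (topSum n v (scanLo n X + i) + lowSum n v a)) ≠ 0 ∧
      z = partMask n v d X (scanLo n X + i) a}

/-- Count the masks of weight less than register `25` in register `26`, and record the masks of this
weight. -/
def scan : Cmd :=
  .assign 36 (.reg 25 / .reg 3) ;;
    .assign 27 (.reg 36 - (2 * .reg 0 + 1)) ;; .assign 27 (.reg 27 - (.reg 27 - .reg 6)) ;;
    .assign 28 (.reg 36 + 1 + .reg 0 * .reg 0) ;;
    .assign 28 ((.reg 28 - (.reg 28 - .reg 6)) - .reg 27) ;;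
    .assign 26 (.reg 27 * .reg 3) ;; .assign 35 (.reg 0 + 1) ;; .for 29 28 scanTop

/-- Only polynomially many top parts are examined, for arbitrary weights; this keeps a scan at `2 ^
k` up to polynomial factors. -/
theorem scanHi_sub_scanLo (n X : ℕ) : scanHi n X - scanLo n X ≤ 2 * (n + 1) ^ 2 := by
  have : 2 * (n + 1) ^ 2 = 2 * (n * n) + 4 * n + 2 := by ring
  rw [scanHi, scanLo]
  omega

theorem scan_run (ho : Ok B s) (hC : Ctx B n v s) (hR : Rec n v S s)
    (hb : Built n v (2 ^ (2 * n / 5)) s) {X : ℕ} {d : ℕ → ℕ} (hd : s.arr 7 = d)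
    (hX : X ≤ 2 ^ n) (h25 : s.reg 25 = X) :
    Run B ω scan s (200000 * (n + 1) ^ 3 * 2 ^ (2 * n / 5)) fun s' =>
      s'.reg 26 = scanCount n v X ∧ Rec n v (S ∪ scanSet n v d X) s' ∧
        Built n v (2 ^ (2 * n / 5)) s' ∧ s'.arr 7 = d := by
  have hp : 1 ≤ 2 ^ (2 * n / 5) := Nat.one_le_two_pow
  have hLn : 2 ^ (n - 2 * (2 * n / 5)) ≤ 2 ^ n := Nat.pow_le_pow_right (by norm_num) (by omega)
  have hnB : 2 ^ (3 * n + 1) < 2 ^ B := hC.lt _ le_rfl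
  have hn2 : n < 2 ^ n := Nat.lt_two_pow_self
  have hn1 : 1 ≤ 2 ^ n := Nat.one_le_two_pow
  have hnn : 2 ^ (3 * n + 1) = 2 * (2 ^ n * 2 ^ n * 2 ^ n) := by rw [pow_succ, pow_mul']; ring
  have hnn2 : 2 ^ n + n * n + 1 ≤ 2 ^ (3 * n + 1) := by nlinarith [Nat.one_le_pow 2 (2 ^ n) hn1]
  have hXd : X / 4 ^ (2 * n / 5) ≤ 2 ^ n := (Nat.div_le_self _ _).trans hX
  have hlo : scanLo n X ≤ 2 ^ (n - 2 * (2 * n / 5)) := min_le_right _ _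
  have hhi : scanHi n X ≤ 2 ^ (n - 2 * (2 * n / 5)) := min_le_right _ _
  have hw := scanHi_sub_scanLo n X
  have hsplit := pow_split n
  rw [← four_pow_eq] at hsplit
  have hp4 : 1 ≤ 4 ^ (2 * n / 5) := Nat.one_le_pow _ _ (by norm_num)
  have hloK : scanLo n X * 4 ^ (2 * n / 5) ≤ 2 ^ n := by rw [← hsplit, mul_comm]; gcongr
  refine Run.le (k₁ := 1000 + (1000 + (1000 + (1000 + (1000 + (1000 + (1000 +
    ((scanHi n X - scanLo n X) * (70000 * (n + 1) * 2 ^ (2 * n / 5) + 2000) + 2000)))))))) ?_ ?_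
  swap
  · calc _ ≤ 9000 * ((n + 1) ^ 3 * 2 ^ (2 * n / 5)) + 2 * (n + 1) ^ 2 *
          (70000 * (n + 1) * 2 ^ (2 * n / 5) + 2000 * ((n + 1) * 2 ^ (2 * n / 5))) := by
            have h1 : 1 ≤ (n + 1) ^ 3 * 2 ^ (2 * n / 5) := Nat.mul_pos (by positivity) hp
            have h2 : 1 ≤ (n + 1) * 2 ^ (2 * n / 5) := Nat.mul_pos (by positivity) hp
            have h3 : (scanHi n X - scanLo n X) * (70000 * (n + 1) * 2 ^ (2 * n / 5) + 2000)
              ≤ 2 * (n + 1) ^ 2 *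
              (70000 * (n + 1) * 2 ^ (2 * n / 5) + 2000 * ((n + 1) * 2 ^ (2 * n / 5))) :=
              Nat.mul_le_mul hw (by omega)
            omega
      _ = 153000 * ((n + 1) ^ 3 * 2 ^ (2 * n / 5)) := by ring
      _ ≤ _ := by rw [mul_assoc]; gcongr; norm_num
  refine Run.assign_seq (X / 4 ^ (2 * n / 5)) ho (by simp [h25, hC.r3]) (by omega) fun ho => ?_
  refine Run.assign_seq (X / 4 ^ (2 * n / 5) - (2 * n + 1)) ho (by simp [hC.r0]) (by omega)
    fun ho => ?_
  -- With truncated subtraction, `x - (x - y)` is the minimum of `x` and `y`.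
  refine Run.assign_seq (scanLo n X) ho (by simp [hC.r6, scanLo]; omega) (by omega) fun ho => ?_
  refine Run.assign_seq (X / 4 ^ (2 * n / 5) + 1 + n * n) ho (by simp [hC.r0]) (by omega)
    fun ho => ?_
  refine Run.assign_seq (scanHi n X - scanLo n X) ho (by simp [hC.r6, scanHi]; omega) (by omega)
    fun ho => ?_
  -- Each top part below the scanned range is credited with all of its `4 ^ k` completions.
  refine Run.assign_seq (scanLo n X * 4 ^ (2 * n / 5)) ho (by simp [hC.r3]) (by omega)
    fun ho => ?_
  refine Run.assign_seq (n + 1) ho (by simp [hC.r0]) (by omega) fun ho => ?_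
  refine Run.mono (Run.for (m := scanHi n X - scanLo n X) (fun j s' =>
      s'.reg 26 = scanLo n X * 4 ^ (2 * n / 5) + ∑ i ∈ Finset.range j,
        ∑ a ∈ Finset.range (2 ^ (2 * n / 5)), partCount n v X (scanLo n X + i) a ∧ s'.arr 7 = d ∧
      Built n v (2 ^ (2 * n / 5)) s' ∧
      Rec n v (S ∪ {z | ∃ i < j, ∃ a < 2 ^ (2 * n / 5),
        d (X - (topSum n v (scanLo n X + i) + lowSum n v a)) ≠ 0 ∧
          z = partMask n v d X (scanLo n X + i) a}) s') ho (by simp) rfl rfl (by norm_num)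
      ⟨by simp, by simpa using hd, ?_, ?_⟩ ?_)
    le_rfl fun _ _ _ h => ⟨h.1, h.2.2.2, h.2.2.1, h.2.1⟩
  · exact ⟨hb.trie, hb.inv, hb.cover⟩
  · simpa using hR.setReg.setReg.setReg.setReg.setReg.setReg.setReg.setReg
  rintro j hj s' ho' hF hr ⟨h26', hd', hb', hR'⟩
  have hu : scanLo n X + j < 2 ^ (n - 2 * (2 * n / 5)) := by omega
  have hsum : ∑ i ∈ Finset.range j, ∑ a ∈ Finset.range (2 ^ (2 * n / 5)),
      partCount n v X (scanLo n X + i) a ≤ j * 4 ^ (2 * n / 5) := by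
    simpa [four_pow_eq] using Finset.sum_le_card_nsmul (Finset.range j) _ _ fun i _ =>
      sum_partCount_le n v X (scanLo n X + i) (2 ^ (2 * n / 5))
  have hle : scanLo n X * 4 ^ (2 * n / 5) + j * 4 ^ (2 * n / 5) + 4 ^ (2 * n / 5) ≤ 2 ^ n := by
    rw [← hsplit]
    calc _ = 4 ^ (2 * n / 5) * (scanLo n X + j + 1) := by ring
      _ ≤ _ := by gcongr; omega
  have hn4 : 2 ^ (n + 2) = 4 * 2 ^ n := by ring
  refine Run.mono (scanTop_run ho'
    ((hC.setReg.setReg.setReg.setReg.setReg.setReg.setReg).fr hF) hR' hb' hd' hX hu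
    (by rw [hF.reg 25]; simpa using h25) (by rw [hF.reg 27, hr]; simp)
    (by rw [hF.reg 35]; simp) h26' (by omega))
    le_rfl fun s₂ ho₂ hF₂ h₂ => ⟨?_, ?_, (hb'.fr hF₂).setReg, ?_⟩
  · simp only [State.setReg_reg, h₂.1, Finset.sum_range_succ]
    simp [add_assoc]
  · rw [State.setReg_arr, hF₂.arr 7, hd']
  · refine h₂.2.setReg.subset ?_
    rintro z (hz | ⟨i, hi, hz⟩)
    · exact Or.inl (Or.inl hz)
    · rcases Nat.lt_succ_iff_lt_or_eq.1 hi with hi | rfl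
      · exact Or.inl (Or.inr ⟨i, hi, hz⟩)
      · exact Or.inr hz

/-! ### Binary search -/

/-- One step of the search for a weight where the count jumps over the identity. -/
def searchStep (n : ℕ) (v : ℕ → ℕ) (p : ℕ × ℕ) : ℕ × ℕ :=
  if (p.1 + p.2) / 2 < scanCount n v ((p.1 + p.2) / 2) then (p.1, (p.1 + p.2) / 2)
  else ((p.1 + p.2) / 2, p.2)

/-- The interval after `j` steps of the search. -/
def searchIter (n : ℕ) (v : ℕ → ℕ) (j : ℕ) : ℕ × ℕ := (searchStep n v)^[j] (0, 2 ^ n - 1)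

theorem searchIter_succ (n : ℕ) (v : ℕ → ℕ) (j : ℕ) :
    searchIter n v (j + 1) = searchStep n v (searchIter n v j) := Function.iterate_succ_apply' _ _ _

theorem searchIter_le (n : ℕ) (v : ℕ → ℕ) (j : ℕ) :
    (searchIter n v j).1 ≤ 2 ^ n ∧ (searchIter n v j).2 ≤ 2 ^ n := by
  induction j with
  | zero => simp [searchIter]
  | succ j ih =>
    rw [searchIter_succ, searchStep]
    split_ifs
    · exact ⟨ih.1, by omega⟩
    · exact ⟨by omega, ih.2⟩

/-- Find a weight that is attained twice, and record the masks of this weight. -/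
def search : Cmd :=
  .assign 38 0 ;; .assign 39 (.reg 4 - 1) ;;
    .for 40 0 (.assign 25 ((.reg 38 + .reg 39) / 2) ;; scan ;;
      .ite (.op .lt (.reg 25) (.reg 26)) (.assign 39 (.reg 25)) (.assign 38 (.reg 25))) ;;
    .assign 25 (.reg 38) ;; scan

/-- The search follows `scanCount`, which for general weights need not be the true count; this
statement concerns only time and what gets recorded. Whether the final `X` is useful is settled
separately, under the hypothesis of few collisions. -/
theorem search_run (ho : Ok B s) (hC : Ctx B n v s) (hR : Rec n v S s)
    (hb : Built n v (2 ^ (2 * n / 5)) s) {d : ℕ → ℕ} (hd : s.arr 7 = d) :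
    Run B ω search s (300000 * (n + 1) ^ 4 * 2 ^ (2 * n / 5))
      (Rec n v (S ∪ scanSet n v d (searchIter n v n).1)) := by
  have hp : 1 ≤ 2 ^ (2 * n / 5) := Nat.one_le_two_pow
  have hnB : 2 ^ n < 2 ^ B := hC.lt _ le_rfl
  refine Run.le (k₁ := 1000 + (1000 + ((n * ((1000 + (200000 * (n + 1) ^ 3 * 2 ^ (2 * n / 5) +
    (1000 + 1000))) + 2000) + 2000) + (1000 + 200000 * (n + 1) ^ 3 * 2 ^ (2 * n / 5))))) ?_ ?_
  swap
  · have h1 : 1 ≤ (n + 1) ^ 3 * 2 ^ (2 * n / 5) := Nat.mul_pos (by positivity) hp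
    have h2 : 300000 * (n + 1) ^ 4 * 2 ^ (2 * n / 5)
      = 300000 * (n * ((n + 1) ^ 3 * 2 ^ (2 * n / 5))) + 300000 * ((n + 1) ^ 3 * 2 ^ (2 * n / 5)) := by
      ring
    have h3 : n ≤ n * ((n + 1) ^ 3 * 2 ^ (2 * n / 5)) := Nat.le_mul_of_pos_right _ h1
    rw [h2]
    simp only [mul_assoc, mul_add, Nat.mul_left_comm n] at *
    omega
  have hit := searchIter_le n v
  refine Run.assign_seq 0 ho rfl (by simp) fun ho => ?_
  refine Run.assign_seq (2 ^ n - 1) ho (by simp [hC.r4]) (lt_of_le_of_lt (Nat.sub_le _ _) hnB)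
    fun ho => ?_
  refine Run.seq (Run.for (m := n) (fun j s' => s'.reg 38 = (searchIter n v j).1 ∧
      s'.reg 39 = (searchIter n v j).2 ∧ s'.arr 7 = d ∧ Built n v (2 ^ (2 * n / 5)) s' ∧
      Rec n v S s') ho (by simp [hC.r0]) rfl rfl (by norm_num) ⟨by simp [searchIter],
      by simp [searchIter], by simpa using hd, hb.setReg.setReg.setReg, hR.setReg.setReg.setReg⟩ ?_) ?_
  · rintro j hj s' ho' hF hr ⟨h38, h39, hd', hb', hR'⟩
    have hC' : Ctx B n v s' := (hC.setReg.setReg).fr hF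
    have hj := hit j
    refine Run.assign_seq (((searchIter n v j).1 + (searchIter n v j).2) / 2) ho'
      (by simp [h38, h39]) (by omega) fun ho' => ?_
    refine Run.seq (scan_run ho' hC'.setReg hR'.setReg hb'.setReg (d := d)
      (X := ((searchIter n v j).1 + (searchIter n v j).2) / 2) (by simpa using hd')
      (by omega) (by simp)) ?_
    rintro s₁ ho₁ hF₁ ⟨h26, hR₁, hb₁, hd₁⟩
    have h38₁ : s₁.reg 38 = (searchIter n v j).1 := by rw [hF₁.reg 38]; simpa using h38
    have h39₁ : s₁.reg 39 = (searchIter n v j).2 := by rw [hF₁.reg 39]; simpa using h39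
    have h25₁ : s₁.reg 25 = ((searchIter n v j).1 + (searchIter n v j).2) / 2 := by
      rw [hF₁.reg 25]; simp
    -- Masks recorded at the midpoints are forgotten; only the scan at the end is used.
    have hR₂ : Rec n v S s₁ := hR₁.subset Set.subset_union_left
    refine Run.ite ho₁ (fun h => ?_) (fun h => ?_)
    · simp [h25₁, h26] at h
      refine Run.assign_last _ ho₁ rfl (by simpa using ho₁.reg 25)
        ⟨?_, ?_, by simpa using hd₁, hb₁.setReg.setReg, hR₂.setReg.setReg⟩
      · simp [searchIter_succ, searchStep, h, h38₁]
      · simp [searchIter_succ, searchStep, h, h25₁]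
    · simp [h25₁, h26] at h
      refine Run.assign_last _ ho₁ rfl (by simpa using ho₁.reg 25)
        ⟨?_, ?_, by simpa using hd₁, hb₁.setReg.setReg, hR₂.setReg.setReg⟩
      · simp [searchIter_succ, searchStep, not_lt.2 h, h25₁]
      · simp [searchIter_succ, searchStep, not_lt.2 h, h39₁]
  · rintro s' ho' hF ⟨h38, -, hd', hb', hR'⟩
    have hC' : Ctx B n v s' := (hC.setReg.setReg).fr hF
    refine Run.assign_seq (searchIter n v n).1 ho' (by simp [h38]) ((hit n).1.trans_lt hnB)
      fun ho' => ?_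
    exact Run.mono (scan_run ho' hC'.setReg hR'.setReg hb'.setReg (d := d)
      (X := (searchIter n v n).1) (by simpa using hd') (hit n).1 (by simp)) le_rfl
      fun _ _ _ h => h.2.1

end PES

/-! ### Preparing the global data: powers of two, random numbers, sorted weights -/

namespace PES

variable {B : ℕ} {ω : ℕ → Bool} {c c₁ c₂ : Cmd} {s : State} {k k₁ k₂ : ℕ} {Q Q₁ : State → Prop}
variable {n : ℕ} {v : ℕ → ℕ} {S S' : Set ℕ}

/-! ### Initialization -/

/-- Compute the table of the powers of two and the global variables. -/
def setup : Cmd :=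
  .assign 1 (2 * .reg 0 / 5) ;; .assign 9 (2 * .reg 0 + 6) ;; .assign 64 (.reg 9 + 1) ;;
    .assign 65 1 ;;
    .for 63 64 (.write 10 (.reg 63) (.reg 65) ;; .assign 65 (2 * .reg 65)) ;;
    .assign 2 (.read 10 (.reg 1)) ;; .assign 3 (.reg 2 * .reg 2) ;; .assign 4 (.read 10 (.reg 0)) ;;
    .assign 5 (.reg 0 - 2 * .reg 1) ;; .assign 6 (.read 10 (.reg 5)) ;; .assign 7 (2 * .reg 4) ;;
    .assign 66 ((.reg 0 + 1) * (.reg 0 + 1) * (.reg 0 + 1)) ;;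
    .assign 8 (268435456 * (.reg 66 * .reg 66 * .reg 66))

theorem trials_lt (n : ℕ) : 2 ^ 28 * (n + 1) ^ 9 ≤ 2 ^ (9 * n + 28) := by
  have h : n + 1 ≤ 2 ^ n := Nat.lt_two_pow_self
  calc 2 ^ 28 * (n + 1) ^ 9 ≤ 2 ^ 28 * (2 ^ n) ^ 9 := by gcongr
    _ = _ := by rw [← pow_mul, ← pow_add]; congr 1; ring

/-- The weight function of the context is `0` at this stage because the array `3` is filled only by
`sort`. -/
theorem setup_run (ho : Ok B s) (hB : 12 * n + 60 ≤ B) (h0 : s.reg 0 = n)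
    (h3 : s.arr 3 = fun _ => 0) (hc : s.coins = 0) :
    Run B ω setup s (20000 * (n + 4)) fun s' => Ctx B n (fun _ => 0) s' ∧ s'.coins = 0 := by
  have hlt : ∀ x e : ℕ, x ≤ 2 ^ e → e < 12 * n + 60 → x < 2 ^ B := fun x e hx he =>
    lt_of_le_of_lt hx (Nat.pow_lt_pow_right (by norm_num) (lt_of_lt_of_le he hB))
  have hn2 : n < 2 ^ n := Nat.lt_two_pow_self
  have hnB : 2 ^ n < 2 ^ B := hlt _ n le_rfl (by omega)
  have hnB' : 2 ^ (n + 4) < 2 ^ B := hlt _ _ le_rfl (by omega)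
  have hn4 : 2 ^ (n + 4) = 16 * 2 ^ n := by ring
  have hn3 : (n + 1) * (n + 1) * (n + 1) < 2 ^ B := by
    refine hlt _ (3 * n) ?_ (by omega)
    rw [pow_mul', pow_succ, pow_two]
    exact Nat.mul_le_mul (Nat.mul_le_mul hn2 hn2) hn2
  refine Run.le (k₁ := 1000 + (1000 + (1000 + (1000 + (((2 * n + 6 + 1) * ((1000 + 1000) + 2000) + 2000)
    + (1000 + (1000 + (1000 + (1000 + (1000 + (1000 + (1000 + 1000)))))))))))) ?_ (by omega)
  refine Run.assign_seq (2 * n / 5) ho (by simp [h0]) (by omega) fun ho => ?_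
  refine Run.assign_seq (2 * n + 6) ho (by simp [h0]) (by omega) fun ho => ?_
  refine Run.assign_seq (2 * n + 6 + 1) ho (by simp) (by omega) fun ho => ?_
  refine Run.assign_seq 1 ho rfl (by omega) fun ho => ?_
  refine Run.seq (Run.for (m := 2 * n + 6 + 1) (fun j s' => s'.reg 65 = 2 ^ j ∧
    (∀ i < j, s'.arr 10 i = 2 ^ i) ∧ s'.coins = 0) ho (by simp) rfl rfl (by norm_num)
    (by simp [hc]) ?_) ?_
  · rintro j hj s' ho' hF hr ⟨h65, h10, hc'⟩
    refine Run.write_seq j (2 ^ j) ho' (by simp [hr]) (by simp [h65])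
      (hlt _ j le_rfl (by omega)) fun ho' => ?_
    refine Run.assign_last (2 ^ (j + 1)) ho' (by simp [h65, pow_succ'])
      (hlt _ (j + 1) le_rfl (by omega)) ⟨by simp, fun i hi => ?_, by simpa using hc'⟩
    simp only [State.setReg_arr, State.setArr_arr_same, Function.update_apply]
    split_ifs with h
    · rw [h]
    · exact h10 i (by omega)
  rintro s' ho' hF ⟨-, h10, hc'⟩
  have h0' : s'.reg 0 = n := by rw [hF.reg 0]; simpa using h0
  have h1' : s'.reg 1 = 2 * n / 5 := by rw [hF.reg 1]; simp
  have h9' : s'.reg 9 = 2 * n + 6 := by rw [hF.reg 9]; simp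
  have h3' : s'.arr 3 = fun _ => 0 := by rw [hF.arr 3]; simpa using h3
  clear hF
  have hk : 2 ^ (2 * n / 5) ≤ 2 ^ n := Nat.pow_le_pow_right (by norm_num) (by omega)
  have hk4 : 4 ^ (2 * n / 5) ≤ 2 ^ n := by
    rw [four_pow_eq, ← pow_add]; exact Nat.pow_le_pow_right (by norm_num) (by omega)
  have hL : 2 ^ (n - 2 * (2 * n / 5)) ≤ 2 ^ n := Nat.pow_le_pow_right (by norm_num) (by omega)
  refine Run.assign_seq (2 ^ (2 * n / 5)) ho' (by simp [h1', h10 (2 * n / 5) (by omega)]) (by omega)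
    fun ho => ?_
  refine Run.assign_seq (4 ^ (2 * n / 5)) ho (by simp [four_pow_eq]) (by omega) fun ho => ?_
  refine Run.assign_seq (2 ^ n) ho (by simp [h0', h10 n (by omega)]) (by omega) fun ho => ?_
  refine Run.assign_seq (n - 2 * (2 * n / 5)) ho (by simp [h0', h1']) (by omega) fun ho => ?_
  refine Run.assign_seq (2 ^ (n - 2 * (2 * n / 5))) ho
    (by simp [h10 (n - 2 * (2 * n / 5)) (by omega)]) (by omega) fun ho => ?_
  refine Run.assign_seq (2 ^ (n + 1)) ho (by simp [pow_succ']) (by rw [pow_succ]; omega) fun ho => ?_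
  refine Run.assign_seq ((n + 1) * (n + 1) * (n + 1)) ho (by simp [h0']) hn3 fun ho => ?_
  refine Run.assign_last (2 ^ 28 * (n + 1) ^ 9) ho (by simp; ring)
    (hlt _ _ (trials_lt n) (by omega)) ⟨?_, by simpa using hc'⟩
  refine ⟨?_, ?_, ?_, ?_, ?_, ?_, ?_, ?_, ?_, ?_, ?_, ?_, hB, by simp⟩
  all_goals simp [h0', h1', h9', h3']
  exact fun i hi => h10 i (by omega)

/-! ### Random numbers -/

/-- The `i`-th number of `b` bits from the coins `ω`. -/
def coinNum (ω : ℕ → Bool) (b i : ℕ) : ℕ := ∑ j ∈ Finset.range b, (ω (i * b + j)).toNat * 2 ^ j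

theorem sum_bits_lt (f : ℕ → Bool) (j : ℕ) :
    ∑ t ∈ Finset.range j, (f t).toNat * 2 ^ t < 2 ^ j := by
  induction j with
  | zero => simp
  | succ j ih =>
    rw [Finset.sum_range_succ, pow_succ]
    have := Nat.mul_le_mul_right (2 ^ j) (Bool.toNat_le (f j))
    omega

/-- Fill the array `9` with random numbers. -/
def toss : Cmd :=
  .assign 42 (.reg 8 * (2 + 2 * .reg 2)) ;;
    .for 41 42 (.assign 44 0 ;;
      .for 43 9 (.flip 45 ;; .assign 44 (.reg 44 + .reg 45 * .read 10 (.reg 43))) ;;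
      .write 9 (.reg 41) (.reg 44))

/-- All coins are flipped in advance. The remaining program is then deterministic given the array
`9`, and the independence of trials is visible from the disjoint blocks of coin positions they use.
-/
theorem toss_run (ho : Ok B s) (hC : Ctx B n v s) (hc : s.coins = 0) :
    Run B ω toss s (2 ^ 28 * (n + 1) ^ 9 * (2 + 2 * 2 ^ (2 * n / 5)) * (40000 * (n + 1)) + 3000) fun s' =>
      ∀ i < 2 ^ 28 * (n + 1) ^ 9 * (2 + 2 * 2 ^ (2 * n / 5)),
        s'.arr 9 i = coinNum ω (2 * n + 6) i := by
  have hk : 2 ^ (2 * n / 5) ≤ 2 ^ n := Nat.pow_le_pow_right (by norm_num) (by omega)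
  have hn1 : 1 ≤ 2 ^ n := Nat.one_le_two_pow
  have hT : 2 ^ 28 * (n + 1) ^ 9 * (2 + 2 * 2 ^ (2 * n / 5)) < 2 ^ B := by
    refine hC.lt (9 * n + 28 + (n + 2)) ?_
    rw [pow_add]
    refine Nat.mul_le_mul (trials_lt n) ?_
    rw [pow_add]; omega
  generalize hTdef : 2 ^ 28 * (n + 1) ^ 9 * (2 + 2 * 2 ^ (2 * n / 5)) = T at *
  refine Run.le (k₁ := 1000 + (T * ((1000 + (((2 * n + 6) * ((1 + 1000) + 2000) + 2000) + 1000))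
    + 2000) + 2000)) ?_ ?_
  swap
  · have : T * (1000 + ((2 * n + 6) * (1 + 1000 + 2000) + 2000 + 1000) + 2000)
      ≤ T * (40000 * (n + 1)) := Nat.mul_le_mul_left _ (by omega)
    omega
  refine Run.assign_seq T ho (by simp [hC.r8, hC.r2, ← hTdef]) hT fun ho => ?_
  refine Run.mono (Run.for (m := T) (fun j s' => (∀ i < j, s'.arr 9 i = coinNum ω (2 * n + 6) i) ∧
    s'.coins = j * (2 * n + 6)) ho (by simp) rfl rfl (by norm_num) (by simp [hc]) ?_) le_rfl
    fun _ _ _ h => h.1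
  rintro j hj s₁ ho₁ hF hr ⟨h9, hc₁⟩
  have hC₁ : Ctx B n v s₁ := hC.setReg.fr hF
  clear hF
  refine Run.assign_seq 0 ho₁ rfl (by simp) fun ho₁ => ?_
  refine Run.seq (Run.for (m := 2 * n + 6) (fun i s' =>
    s'.reg 44 = ∑ t ∈ Finset.range i, (ω (j * (2 * n + 6) + t)).toNat * 2 ^ t ∧
    s'.coins = j * (2 * n + 6) + i) ho₁ (by simp [hC₁.r9]) rfl rfl (by norm_num) (by simp [hc₁]) ?_) ?_
  · rintro i hi s₂ ho₂ hF hr₂ ⟨h44, hc₂⟩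
    have hC₂ : Ctx B n v s₂ := hC₁.setReg.fr hF
    refine Run.seq (Run.flip (Q := fun s' => s' = s₂.flip ω 45) ho₂ rfl) ?_
    rintro s₃ ho₃ hF₃ rfl
    refine Run.assign_last (∑ t ∈ Finset.range (i + 1), (ω (j * (2 * n + 6) + t)).toNat * 2 ^ t) ho₃
      ?_ (hC.lt (i + 1) (sum_bits_lt _ _).le) ⟨by simp, by simp [State.flip, hc₂]; ring⟩
    rw [Finset.sum_range_succ]
    simp [State.flip, h44, hr₂, hc₂, hC₂.a10 i hi.le]
  · rintro s₂ ho₂ hF ⟨h44, hc₂⟩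
    have h9₂ : s₂.arr 9 = s₁.arr 9 := hF.arr 9
    have hr₂ : s₂.reg 41 = j := by rw [hF.reg 41]; simpa using hr
    refine Run.write_last j (coinNum ω (2 * n + 6) j) ho₂ (by simp [hr₂]) (by simpa [coinNum] using h44)
      (hC.lt (2 * n + 6) (sum_bits_lt _ _).le) ⟨fun i hi => ?_, by simp [hc₂]; ring⟩
    simp only [State.setReg_arr, State.setArr_arr_same, Function.update_apply, h9₂]
    split_ifs with h
    · rw [h]
    · exact h9 i (by omega)

/-! ### Sorting -/

/-- The number of indices `j < n` before `i` in the order by weight. -/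
def rank (n : ℕ) (w : ℕ → ℕ) (i : ℕ) : ℕ :=
  ((Finset.range n).filter fun j => w j < w i ∨ w j = w i ∧ j < i).card

theorem rank_lt_rank {w : ℕ → ℕ} {i j : ℕ} (hi : i < n) (h : w i < w j ∨ w i = w j ∧ i < j) :
    rank n w i < rank n w j := by
  refine Finset.card_lt_card ⟨fun l hl => ?_, fun hsub => ?_⟩
  · simp only [Finset.mem_filter] at hl ⊢
    exact ⟨hl.1, by omega⟩
  · have := hsub (show i ∈ _ by simp [hi, h])
    simp at this

theorem rank_lt {w : ℕ → ℕ} {i : ℕ} (hi : i < n) : rank n w i < n := by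
  refine lt_of_lt_of_eq (Finset.card_lt_card (Finset.filter_ssubset.2 ⟨i, ?_, ?_⟩))
    (Finset.card_range n)
  · simpa using hi
  · simp

theorem rank_injOn (n : ℕ) (w : ℕ → ℕ) : Set.InjOn (rank n w) (Finset.range n) := by
  intro i hi j hj h
  rw [Finset.mem_coe, Finset.mem_range] at hi hj
  by_contra hne
  have : (w i < w j ∨ w i = w j ∧ i < j) ∨ (w j < w i ∨ w j = w i ∧ j < i) := by omega
  rcases this with h' | h'
  · exact (rank_lt_rank hi h').ne h
  · exact (rank_lt_rank hj h').ne h.symm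

theorem rank_image (n : ℕ) (w : ℕ → ℕ) : (Finset.range n).image (rank n w) = Finset.range n := by
  refine Finset.eq_of_subset_of_card_le (fun i hi => ?_) ?_
  · obtain ⟨j, hj, rfl⟩ := Finset.mem_image.1 hi
    exact Finset.mem_range.2 (rank_lt (Finset.mem_range.1 hj))
  · rw [Finset.card_image_of_injOn (rank_injOn n w)]

theorem sum_rank {M : Type*} [AddCommMonoid M] (n : ℕ) (w : ℕ → ℕ) (f : ℕ → M) :
    ∑ i ∈ Finset.range n, f (rank n w i) = ∑ i ∈ Finset.range n, f i := by
  conv_rhs => rw [← rank_image n w]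
  rw [Finset.sum_image (rank_injOn n w)]

theorem rank_sorted {w v : ℕ → ℕ} (hv : ∀ i < n, v (rank n w i) = w i) {i j : ℕ} (hij : i ≤ j)
    (hj : j < n) : v i ≤ v j := by
  have h : ∀ l < n, ∃ l' < n, rank n w l' = l := fun l hl => by
    have : l ∈ (Finset.range n).image (rank n w) := by rw [rank_image]; simpa using hl
    obtain ⟨l', h1, h2⟩ := Finset.mem_image.1 this
    exact ⟨l', Finset.mem_range.1 h1, h2⟩
  obtain ⟨i', hi', rfl⟩ := h i (by omega)
  obtain ⟨j', hj', rfl⟩ := h j hj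
  rw [hv i' hi', hv j' hj']
  by_contra hlt
  exact absurd (rank_lt_rank hj' (Or.inl (not_le.1 hlt))) (by omega)

/-- Compute the ranks of the weights in the array `4` and the sorted weights in the array `3`. -/
def sort : Cmd :=
  .for 63 0 (.assign 65 0 ;;
    .for 64 0 (.assign 65 (.reg 65 + .op .lt (.read 0 (.reg 64)) (.read 0 (.reg 63)) +
      .op .eq (.read 0 (.reg 64)) (.read 0 (.reg 63)) * .op .lt (.reg 64) (.reg 63))) ;;
    .write 4 (.reg 63) (.reg 65) ;; .write 3 (.reg 65) (.read 0 (.reg 63)))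

theorem sort_run (ho : Ok B s) (hC : Ctx B n v s) :
    Run B ω sort s (20000 * (n + 1) ^ 2) fun s' =>
      (∀ i < n, s'.arr 4 i = rank n (s.arr 0) i) ∧
      (∀ i < n, s'.arr 3 (rank n (s.arr 0) i) = s.arr 0 i) ∧ ∀ r ≥ n, s'.arr 3 r = s.arr 3 r := by
  have hn2 : n < 2 ^ n := Nat.lt_two_pow_self
  have hnB : 2 ^ n < 2 ^ B := hC.lt _ le_rfl
  refine Run.le (k₁ := n * ((1000 + ((n * (1000 + 2000) + 2000) + (1000 + 1000))) + 2000) + 2000)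
    ?_ (by nlinarith)
  refine Run.for (m := n) (fun j s' => (∀ i < j, s'.arr 4 i = rank n (s.arr 0) i) ∧
      (∀ i < j, s'.arr 3 (rank n (s.arr 0) i) = s.arr 0 i) ∧ ∀ r ≥ n, s'.arr 3 r = s.arr 3 r) ho
      (by simp [hC.r0]) rfl rfl (by norm_num) (by simp) ?_
  rintro j hj s₁ ho₁ hF hr ⟨h4, h3, h3'⟩
  have h0 : s₁.reg 0 = n := by rw [hF.reg 0]; exact hC.r0
  have ha : s₁.arr 0 = s.arr 0 := hF.arr 0
  clear hF
  refine Run.assign_seq 0 ho₁ rfl (by simp) fun ho₁ => ?_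
  refine Run.seq (Run.for (m := n) (fun i s' => s'.reg 65 = ((Finset.range i).filter fun l =>
    s.arr 0 l < s.arr 0 j ∨ s.arr 0 l = s.arr 0 j ∧ l < j).card) ho₁ (by simp [h0]) rfl rfl
    (by norm_num) (by simp) ?_) ?_
  · rintro i hi s₂ ho₂ hF hr₂ h65
    have ha₂ : s₂.arr 0 = s.arr 0 := by rw [hF.arr 0]; simpa using ha
    have hr₂' : s₂.reg 63 = j := by rw [hF.reg 63]; simpa using hr
    refine Run.assign_last (((Finset.range (i + 1)).filter fun l =>
      s.arr 0 l < s.arr 0 j ∨ s.arr 0 l = s.arr 0 j ∧ l < j).card) ho₂ ?_ ?_ (by simp)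
    · rw [Finset.range_add_one, Finset.filter_insert]
      simp only [Expr.eval_add, Expr.eval_reg, Expr.eval_lt, Expr.eval_read, ha₂, hr₂, hr₂',
        Expr.eval_mul, Expr.eval_eq, h65]
      split_ifs with h1 h2 <;> (try rw [Finset.card_insert_of_notMem (by simp)]) <;>
        omega
    · refine lt_of_le_of_lt ((Finset.card_filter_le _ _).trans (Finset.card_range _).le) (by omega)
  · rintro s₂ ho₂ hF h65
    have ha₂ : s₂.arr 0 = s.arr 0 := by rw [hF.arr 0]; simpa using ha
    have h3₂ : s₂.arr 3 = s₁.arr 3 := by rw [hF.arr 3]; simp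
    have h4₂ : s₂.arr 4 = s₁.arr 4 := by rw [hF.arr 4]; simp
    have hr₂ : s₂.reg 63 = j := by rw [hF.reg 63]; simpa using hr
    change s₂.reg 65 = rank n (s.arr 0) j at h65
    refine Run.write_seq j (rank n (s.arr 0) j) ho₂ (by simp [hr₂]) (by simpa using h65)
      (by have := rank_lt (w := s.arr 0) hj; omega) fun ho₂ => ?_
    refine Run.write_last (rank n (s.arr 0) j) (s.arr 0 j) ho₂ (by simp [h65])
      (by simp [State.setArr_arr, ha₂, hr₂]) (ho.arr 0 j)
      ⟨fun i hi => ?_, fun i hi => ?_, fun r hr' => ?_⟩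
    · simp only [State.setReg_arr, State.setArr_arr, h4₂]
      simp only [show ¬((4 : ℕ) = 3) by norm_num, if_false, if_true,
        Function.update_apply]
      split_ifs with h
      · rw [h]
      · exact h4 i (by omega)
    · simp only [State.setReg_arr, State.setArr_arr, h3₂]
      simp only [show ¬((3 : ℕ) = 4) by norm_num, if_false, if_true,
        Function.update_apply]
      split_ifs with h
      · rw [rank_injOn n (s.arr 0) (by simp; omega) (by simpa using hj) h]
      · refine h3 i (lt_of_le_of_ne (by omega) ?_)
        rintro rfl
        exact h rfl
    · have := rank_lt (w := s.arr 0) hj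
      simp only [State.setReg_arr, State.setArr_arr, h3₂]
      simp only [show ¬((3 : ℕ) = 4) by norm_num, if_false, if_true, Function.update_apply]
      rw [if_neg (by omega), h3' r hr']

/-- The function `u` on the numbers less than `n`, sorted. -/
def sorted (n : ℕ) (u : ℕ → ℕ) (r : ℕ) : ℕ := ∑ i ∈ Finset.range n, if rank n u i = r then u i else 0

theorem sorted_rank {u : ℕ → ℕ} {i : ℕ} (hi : i < n) : sorted n u (rank n u i) = u i := by
  rw [sorted, Finset.sum_eq_single i]
  · simp
  · intro j hj hne
    rw [if_neg]
    exact fun h => hne (rank_injOn n u hj (by simpa using hi) h)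
  · simp [hi]

/-- The values beyond `n` matter too, since `Ctx` demands that the whole array `3` equal `v`. -/
theorem eq_sorted {u f : ℕ → ℕ} (h : ∀ i < n, f (rank n u i) = u i) (h' : ∀ r ≥ n, f r = 0) :
    f = sorted n u := by
  funext r
  by_cases hr : r < n
  · have : r ∈ (Finset.range n).image (rank n u) := by rw [rank_image]; simpa using hr
    obtain ⟨i, hi, rfl⟩ := Finset.mem_image.1 this
    rw [h i (Finset.mem_range.1 hi), sorted_rank (Finset.mem_range.1 hi)]
  · rw [h' r (by omega), sorted, Finset.sum_eq_zero]
    intro i hi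
    rw [if_neg]
    have := rank_lt (w := u) (Finset.mem_range.1 hi)
    omega

theorem sum_sorted (n : ℕ) (u : ℕ → ℕ) :
    ∑ i ∈ Finset.range n, sorted n u i = ∑ i ∈ Finset.range n, u i := by
  rw [← sum_rank n u]
  exact Finset.sum_congr rfl fun i hi => sorted_rank (Finset.mem_range.1 hi)

end PES

/-! ### Sampling masks from a residue class -/

namespace PES

variable {B : ℕ} {ω : ℕ → Bool} {c c₁ c₂ : Cmd} {s : State} {k k₁ k₂ : ℕ} {Q Q₁ : State → Prop}
variable {n : ℕ} {v : ℕ → ℕ} {S S' : Set ℕ}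

/-! ### Masks with a given residue of the weight -/

theorem add_div_low {t i : ℕ} (z c : ℕ) (h : t < i) : (z + 2 ^ i * c) / 2 ^ t % 2 = z / 2 ^ t % 2 := by
  obtain ⟨d, rfl⟩ := Nat.exists_eq_add_of_lt h
  rw [show z + 2 ^ (t + d + 1) * c = z + 2 ^ t * (2 * (2 ^ d * c)) by ring,
    Nat.add_mul_div_left _ _ (by positivity)]
  omega

theorem add_div_high {i : ℕ} {z : ℕ} (c t : ℕ) (hz : z < 2 ^ i) :
    (z + 2 ^ i * c) / 2 ^ (i + t) = c / 2 ^ t := by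
  rw [pow_add, ← Nat.div_div_eq_div_mul, Nat.add_mul_div_left _ _ (by positivity),
    Nat.div_eq_of_lt hz, zero_add]

theorem wsum_add_mul (v : ℕ → ℕ) (i z c : ℕ) : wsum v i (z + 2 ^ i * c) = wsum v i z :=
  Finset.sum_congr rfl fun t ht => by rw [add_div_low _ _ (Finset.mem_range.1 ht)]

theorem wsum_split (v : ℕ → ℕ) {i z : ℕ} (j c : ℕ) (hz : z < 2 ^ i) :
    wsum v (i + j) (z + 2 ^ i * c) = wsum v i z + wsum (fun t => v (i + t)) j c := by
  rw [wsum, Finset.sum_range_add]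
  congr 1
  · exact wsum_add_mul v i z c
  · exact Finset.sum_congr rfl fun t _ => by rw [add_div_high _ _ hz]

theorem wsum_succ_low (v : ℕ → ℕ) {i z : ℕ} (hz : z < 2 ^ i) : wsum v (i + 1) z = wsum v i z := by
  rw [wsum_succ, Nat.div_eq_of_lt hz]; simp

theorem wsum_succ_high (v : ℕ → ℕ) {i z : ℕ} (hz : z < 2 ^ i) :
    wsum v (i + 1) (z + 2 ^ i) = wsum v i z + v i := by
  have := wsum_split v 1 1 hz
  simpa [wsum] using this

/-- The number of masks of `i` bits whose weight is `r` modulo `p`. -/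
def resCount (v : ℕ → ℕ) (p i r : ℕ) : ℕ :=
  ((Finset.range (2 ^ i)).filter fun z => wsum v i z % p = r).card

theorem range_two_pow_succ (i : ℕ) :
    Finset.range (2 ^ (i + 1)) = Finset.range (2 ^ i) ∪ (Finset.range (2 ^ i)).map
      (addRightEmbedding (2 ^ i)) := by
  ext z
  simp only [Finset.mem_range, Finset.mem_union, Finset.mem_map, addRightEmbedding_apply, pow_succ]
  constructor
  · intro h
    by_cases hz : z < 2 ^ i
    · exact Or.inl hz
    · exact Or.inr ⟨z - 2 ^ i, by omega, by omega⟩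
  · rintro (h | ⟨y, hy, rfl⟩) <;> omega

/-- The residue of `r - y`, written so that natural subtraction does not truncate. -/
theorem sub_residue_iff {p r x y : ℕ} (hp : 0 < p) (hr : r < p) :
    (x + y) % p = r ↔ x % p = (r + (p - y % p)) % p := by
  have hy := Nat.mod_lt y hp
  have hy' := Nat.mod_add_div y p
  constructor
  · rintro rfl
    have h1 : x + y + (p - y % p) ≡ (x + y) % p + (p - y % p) [MOD p] :=
      Nat.ModEq.add_right _ (Nat.mod_modEq _ _).symm
    have h2 : x + y + (p - y % p) = x + p * (y / p + 1) := by rw [mul_add]; omega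
    rw [h2] at h1
    have h3 : x + p * (y / p + 1) ≡ x [MOD p] := by simp [Nat.ModEq]
    exact h3.symm.trans h1
  · intro h
    have h1 : x + y ≡ (r + (p - y % p)) + y [MOD p] := Nat.ModEq.add_right _ h
    have h2 : (r + (p - y % p)) + y = r + p * (y / p + 1) := by rw [mul_add]; omega
    rw [h2] at h1
    have h3 : r + p * (y / p + 1) ≡ r [MOD p] := by simp [Nat.ModEq]
    have := h1.trans h3
    rw [Nat.ModEq, Nat.mod_eq_of_lt hr] at this
    exact this

/-- Split by the highest bit: if it is set, the lower bits must have residue `r - v i`. This is the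
recurrence of the dynamic program, and `unrank` runs it backwards. -/
theorem resCount_succ (v : ℕ → ℕ) {p r : ℕ} (i : ℕ) (hp : 0 < p) (hr : r < p) :
    resCount v p (i + 1) r = resCount v p i r + resCount v p i ((r + (p - v i % p)) % p) := by
  rw [resCount, range_two_pow_succ, Finset.filter_union, Finset.card_union_of_disjoint]
  · congr 1
    · rw [resCount]
      congr 1
      refine Finset.filter_congr fun z hz => ?_
      rw [wsum_succ_low v (Finset.mem_range.1 hz)]
    · rw [Finset.filter_map, Finset.card_map, resCount]
      congr 1
      refine Finset.filter_congr fun z hz => ?_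
      simp only [Function.comp, addRightEmbedding_apply]
      rw [wsum_succ_high v (Finset.mem_range.1 hz), sub_residue_iff hp hr]
  · refine Finset.disjoint_filter_filter ?_
    rw [Finset.disjoint_left]
    simp only [Finset.mem_range, Finset.mem_map, addRightEmbedding_apply]
    rintro z hz ⟨y, hy, rfl⟩
    omega

theorem resCount_zero (v : ℕ → ℕ) {p r : ℕ} :
    resCount v p 0 r = if r = 0 then 1 else 0 := by
  simp only [resCount, wsum, pow_zero, Finset.range_one, Finset.range_zero, Finset.sum_empty,
    Nat.zero_mod, Finset.filter_singleton]
  split_ifs with h1 h2 h2 <;> simp_all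

theorem resCount_le (v : ℕ → ℕ) (p i r : ℕ) : resCount v p i r ≤ 2 ^ i :=
  (Finset.card_filter_le _ _).trans (Finset.card_range _).le

/-- The mask number `u` among the masks of `i` bits whose weight is `r` modulo `p`. -/
def unrank (v : ℕ → ℕ) (p : ℕ) : ℕ → ℕ → ℕ → ℕ
  | 0, _, _ => 0
  | i + 1, r, u =>
    if u < resCount v p i r then unrank v p i r u
    else unrank v p i ((r + (p - v i % p)) % p) (u - resCount v p i r) + 2 ^ i

theorem unrank_lt (v : ℕ → ℕ) (p i r u : ℕ) : unrank v p i r u < 2 ^ i := by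
  induction i generalizing r u with
  | zero => simp [unrank]
  | succ i ih =>
    have h1 := ih r u
    have h2 := ih ((r + (p - v i % p)) % p) (u - resCount v p i r)
    rw [unrank, pow_succ]
    split_ifs <;> omega

/-- Every mask of the class has an index, which is all that the success analysis needs. Indices
beyond the size of the class produce some arbitrary mask, for which `unrank_lt` suffices. -/
theorem exists_unrank (v : ℕ → ℕ) {p : ℕ} (hp : 0 < p) (i : ℕ) {r z : ℕ} (hr : r < p) (hz : z < 2 ^ i)
    (h : wsum v i z % p = r) : ∃ u < resCount v p i r, unrank v p i r u = z := by
  induction i generalizing r z with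
  | zero =>
    have : r = 0 := by simpa [wsum] using h.symm
    exact ⟨0, by simp [resCount_zero, this], by simp [unrank]; omega⟩
  | succ i ih =>
    rw [resCount_succ v i hp hr]
    by_cases hzi : z < 2 ^ i
    · rw [wsum_succ_low v hzi] at h
      obtain ⟨u, hu, he⟩ := ih hr hzi h
      exact ⟨u, by omega, by rw [unrank, if_pos hu, he]⟩
    · obtain ⟨y, rfl⟩ : ∃ y, z = y + 2 ^ i := ⟨z - 2 ^ i, by omega⟩
      have hy : y < 2 ^ i := by rw [pow_succ] at hz; omega
      rw [wsum_succ_high v hy, sub_residue_iff hp hr] at h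
      obtain ⟨u, hu, he⟩ := ih (Nat.mod_lt _ hp) hy h
      refine ⟨u + resCount v p i r, by omega, ?_⟩
      rw [unrank, if_neg (by omega), Nat.add_sub_cancel, he]

/-- Tabulate the residue counts modulo register `50` in the array `8`. -/
def tabulate : Cmd :=
  .for 52 50 (.write 8 ((.reg 0 + 1) * .reg 52) (.op .eq (.reg 52) 0)) ;;
    .for 53 0 (.assign 54 (.read 3 (.reg 53) % .reg 50) ;;
      .for 52 50 (.write 8 ((.reg 0 + 1) * .reg 52 + .reg 53 + 1)
        (.read 8 ((.reg 0 + 1) * .reg 52 + .reg 53) +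
          .read 8 ((.reg 0 + 1) * ((.reg 52 + (.reg 50 - .reg 54)) % .reg 50) + .reg 53))))

theorem addr_inj {r r' i i' : ℕ} (hi : i ≤ n) (hi' : i' ≤ n)
    (h : (n + 1) * r + i = (n + 1) * r' + i') : r = r' ∧ i = i' := by
  have h1 : ((n + 1) * r + i) / (n + 1) = r := by
    rw [Nat.mul_add_div (by omega), Nat.div_eq_of_lt (by omega), add_zero]
  have h2 : ((n + 1) * r' + i') / (n + 1) = r' := by
    rw [Nat.mul_add_div (by omega), Nat.div_eq_of_lt (by omega), add_zero]
  have h3 : r = r' := by rw [← h1, h, h2]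
  subst h3
  exact ⟨rfl, by omega⟩

/-- Column `i + 1` is computed from column `i`, at a cost of about `n * p`. This cost is why moduli
must not exceed about `2 ^ k`. -/
theorem tabulate_run (ho : Ok B s) (hC : Ctx B n v s) {p : ℕ} (hp : 0 < p) (h50 : s.reg 50 = p) :
    Run B ω tabulate s (20000 * (n + 1) * p) fun s' =>
      ∀ i ≤ n, ∀ r < p, s'.arr 8 ((n + 1) * r + i) = resCount v p i r := by
  have hcB : ∀ i ≤ n, ∀ r, resCount v p i r < 2 ^ B := fun i hi r =>
    hC.lt n ((resCount_le v p i r).trans (Nat.pow_le_pow_right (by norm_num) hi))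
  refine Run.le (k₁ := (p * (1000 + 2000) + 2000) + (n * ((1000 + (p * (1000 + 2000) + 2000))
    + 2000) + 2000)) ?_ (by nlinarith)
  refine Run.seq (Run.for (m := p) (fun j s' => ∀ r < j, s'.arr 8 ((n + 1) * r) = resCount v p 0 r)
    ho h50 rfl rfl (by norm_num) (by simp) ?_) fun s₁ ho₁ hF h₁ => ?_
  · rintro j hj s' ho' hF hr hI
    have h0 : s'.reg 0 = n := by rw [hF.reg 0]; exact hC.r0
    refine Run.write_last ((n + 1) * j) (resCount v p 0 j) ho' (by simp [h0, hr])
      (by simp [hr, resCount_zero]) (hcB 0 (by omega) j) fun r hr' => ?_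
    simp only [State.setReg_arr, State.setArr_arr_same, Function.update_apply]
    split_ifs with h
    · rw [(addr_inj (n := n) (r := r) (r' := j) (i := 0) (i' := 0) (by omega) (by omega) (by simpa using h)).1]
    · refine hI r (lt_of_le_of_ne (by omega) ?_)
      rintro rfl
      exact h rfl
  have hC₁ : Ctx B n v s₁ := hC.fr hF
  have h50₁ : s₁.reg 50 = p := by rw [hF.reg 50]; exact h50
  clear hF
  refine Run.mono (Run.for (m := n) (fun j s' => ∀ i ≤ j, ∀ r < p,
    s'.arr 8 ((n + 1) * r + i) = resCount v p i r) ho₁ hC₁.r0 rfl rfl (by norm_num) ?_ ?_)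
    le_rfl fun _ _ _ h => h
  · intro i hi r hr
    obtain rfl : i = 0 := by omega
    exact h₁ r hr
  rintro j hj s₂ ho₂ hF hr hI
  have hC₂ : Ctx B n v s₂ := hC₁.fr hF
  have h50₂ : s₂.reg 50 = p := by rw [hF.reg 50]; exact h50₁
  clear hF
  refine Run.assign_seq (v j % p) ho₂ (by simp [hC₂.a3, hr, h50₂])
    ((Nat.mod_lt _ hp).trans (h50 ▸ ho.reg 50)) fun ho₂ => ?_
  refine Run.mono (Run.for (m := p) (fun l s' => (∀ i ≤ j, ∀ r < p,
    s'.arr 8 ((n + 1) * r + i) = resCount v p i r) ∧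
      ∀ r < l, s'.arr 8 ((n + 1) * r + j + 1) = resCount v p (j + 1) r) ho₂ (by simp [h50₂]) rfl rfl
      (by norm_num) ⟨by simpa using hI, by simp⟩ ?_) le_rfl ?_
  · rintro l hl s₃ ho₃ hF hr₃ ⟨hI₁, hI₂⟩
    have h0 : s₃.reg 0 = n := by rw [hF.reg 0]; simpa using hC₂.r0
    have h50₃ : s₃.reg 50 = p := by rw [hF.reg 50]; simpa using h50₂
    have h54 : s₃.reg 54 = v j % p := by rw [hF.reg 54]; simp
    have h53 : s₃.reg 53 = j := by rw [hF.reg 53]; simpa using hr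
    refine Run.write_last ((n + 1) * l + j + 1) (resCount v p (j + 1) l) ho₃
      (by simp [h0, hr₃, h53]) ?_ (hcB _ hj l) ⟨fun i hi r hr' => ?_, fun r hr' => ?_⟩
    · simp only [Expr.eval_add, Expr.eval_read, Expr.eval_mul, Expr.eval_reg, Expr.eval_ofNat,
        Expr.eval_mod, Expr.eval_sub, h0, hr₃, h53, h50₃, h54]
      rw [resCount_succ v j hp hl, hI₁ j le_rfl l hl, hI₁ j le_rfl _ (Nat.mod_lt _ hp)]
    · simp only [State.setReg_arr, State.setArr_arr_same, Function.update_apply]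
      rw [if_neg, hI₁ i hi r hr']
      intro h
      have := (addr_inj (n := n) (r := r) (r' := l) (i := i) (i' := j + 1) (by omega) (by omega)
        (h.trans (by ring))).2
      omega
    · simp only [State.setReg_arr, State.setArr_arr_same, Function.update_apply]
      split_ifs with h
      · rw [(addr_inj (n := n) (r := r) (r' := l) (i := j + 1) (i' := j + 1) (by omega) (by omega)
          (by linarith)).1]
      · refine hI₂ r (lt_of_le_of_ne (by omega) ?_)
        rintro rfl
        exact h rfl
  · rintro s₃ - - ⟨hI₁, hI₂⟩ i hi r hr
    rcases Nat.le_succ_iff.1 hi with h | rfl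
    · exact hI₁ i h r hr
    · exact hI₂ r hr

/-- Register `55` := the mask number `reg 57` of the residue class `reg 51` modulo `reg 50`. -/
def select : Cmd :=
  .assign 55 0 ;; .assign 56 (.reg 51) ;;
    .for 58 0 (.assign 59 (.reg 0 - 1 - .reg 58) ;;
      .assign 60 (.read 8 ((.reg 0 + 1) * .reg 56 + .reg 59)) ;;
      .ite (.op .lt (.reg 57) (.reg 60)) .skip
        (.assign 57 (.reg 57 - .reg 60) ;;
          .assign 56 ((.reg 56 + (.reg 50 - .read 3 (.reg 59) % .reg 50)) % .reg 50) ;;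
          .assign 55 (.reg 55 + .read 10 (.reg 59))))

/-- The recursion of `unrank` is unrolled from the top bit down: the bits chosen so far plus
`unrank` of the current residue and index is invariant. -/
theorem select_run (ho : Ok B s) (hC : Ctx B n v s) {p r u : ℕ} (hr : r < p) (h50 : s.reg 50 = p)
    (h51 : s.reg 51 = r) (h57 : s.reg 57 = u)
    (h8 : ∀ i ≤ n, ∀ r < p, s.arr 8 ((n + 1) * r + i) = resCount v p i r) :
    Run B ω select s (10000 * (n + 1)) fun s' => s'.reg 55 = unrank v p n r u := by
  have hp : 0 < p := by omega
  have hn2 : n < 2 ^ n := Nat.lt_two_pow_self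
  have hnB : 2 ^ n < 2 ^ B := hC.lt _ le_rfl
  refine Run.le (k₁ := 1000 + (1000 + (n * ((1000 + (1000 + (1000 + (1000 + (1000 + 1000)))))
    + 2000) + 2000))) ?_ (by nlinarith)
  refine Run.assign_seq 0 ho rfl (by simp) fun ho₁ => ?_
  refine Run.assign_seq r ho₁ (by simp [h51]) (h51 ▸ ho.reg 51) fun ho₁ => ?_
  have hlt := unrank_lt v p n r u
  refine Run.mono (Run.for (m := n) (k := 1000 + (1000 + (1000 + (1000 + (1000 + 1000)))))
    (fun j s' => s'.reg 56 < p ∧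
    s'.reg 55 + unrank v p (n - j) (s'.reg 56) (s'.reg 57) = unrank v p n r u)
    ho₁ (by simp [hC.r0]) rfl rfl (by norm_num) ⟨by simpa using hr, by simp [h57]⟩ ?_) (by omega) ?_
  · rintro j hj s₂ ho₂ hF hr₂ ⟨h56, hI⟩
    have hC₂ : Ctx B n v s₂ := (hC.setReg.setReg).fr hF
    have h50₂ : s₂.reg 50 = p := by rw [hF.reg 50]; simpa using h50
    have h8₂ := h8 (n - 1 - j) (by omega) _ h56
    rw [show s.arr 8 = s₂.arr 8 by rw [hF.arr 8]; simp] at h8₂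
    have hpB : p < 2 ^ B := h50 ▸ ho.reg 50
    clear hF
    generalize hx : s₂.reg 56 = x at *
    generalize hy : s₂.reg 57 = y at *
    generalize hz : s₂.reg 55 = z at *
    have hyB : y < 2 ^ B := hy ▸ ho₂.reg 57
    rw [show n - j = (n - 1 - j) + 1 by omega, unrank] at hI
    refine Run.assign_seq (n - 1 - j) ho₂ (by simp [hC₂.r0, hr₂]) (by omega) fun ho₂ => ?_
    refine Run.assign_seq (resCount v p (n - 1 - j) x) ho₂ (by simp [hC₂.r0, hx, h8₂])
      (by rw [← h8₂]; exact ho₂.arr 8 _) fun ho₂ => ?_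
    refine Run.ite ho₂ (fun h => ?_) (fun h => ?_)
    · simp [hy] at h
      rw [if_pos h] at hI
      refine (Run.skip ho₂ ⟨by simpa [hx] using h56, ?_⟩).le (by norm_num)
      simp only [State.setReg_reg, hx, hy, hz, show n - (j + 1) = n - 1 - j by omega]
      exact hI
    · simp [hy] at h
      rw [if_neg (by omega)] at hI
      refine Run.assign_seq (y - resCount v p (n - 1 - j) x) ho₂ (by simp [hy]) (by omega)
        fun ho₂ => ?_
      refine Run.assign_seq ((x + (p - v (n - 1 - j) % p)) % p) ho₂
        (by simp [hx, h50₂, hC₂.a3]) ((Nat.mod_lt _ hp).trans hpB) fun ho₂ => ?_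
      refine Run.assign_last (z + 2 ^ (n - 1 - j)) ho₂
        (by simp [hz, hC₂.a10 (n - 1 - j) (by omega)]) (by omega)
        ⟨by simpa using Nat.mod_lt _ hp, ?_⟩
      simp only [State.setReg_reg, show n - (j + 1) = n - 1 - j by omega]
      simp
      omega
  · rintro s' - - ⟨-, h⟩
    simpa [unrank] using h

/-! ### Random trials -/

/-- The range of the modulus in the trial `e`. -/
def trialR (n e : ℕ) : ℕ := 2 ^ (e % (2 * n / 5 + 1) + 1)

/-- The range of the mask numbers in the trial `e`. -/
def trialM (n e : ℕ) : ℕ := 2 ^ (e / (2 * n / 5 + 1) % (2 * n + 6 + 1))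

/-- The place of the `i`-th random number of the trial `e`. -/
def trialPos (n e i : ℕ) : ℕ := e * (2 + 2 * 2 ^ (2 * n / 5)) + i

/-- The modulus of the trial `e`. -/
def trialP (n : ℕ) (F : ℕ → ℕ) (e : ℕ) : ℕ := 1 + F (trialPos n e 0) % trialR n e

/-- The residue of the trial `e`. -/
def trialRes (n : ℕ) (F : ℕ → ℕ) (e : ℕ) : ℕ := F (trialPos n e 1) % trialR n e % trialP n F e

/-- The `i`-th mask in the trial `e`. -/
def trialMask (n : ℕ) (v F : ℕ → ℕ) (e i : ℕ) : ℕ :=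
  unrank v (trialP n F e) n (trialRes n F e) (F (trialPos n e (2 + i)) % trialM n e)

/-- Record random masks from a random residue class. -/
def trial : Cmd :=
  .assign 67 (.reg 46 % (.reg 1 + 1)) ;; .assign 47 (.read 10 (.reg 67 + 1)) ;;
    .assign 48 (.read 10 (.reg 46 / (.reg 1 + 1) % (.reg 9 + 1))) ;;
    .assign 49 (.reg 46 * (2 + 2 * .reg 2)) ;;
    .assign 50 (1 + .read 9 (.reg 49) % .reg 47) ;;
    .assign 51 (.read 9 (.reg 49 + 1) % .reg 47 % .reg 50) ;;
    tabulate ;; .assign 68 (2 * .reg 2) ;;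
    .for 61 68 (.assign 57 (.read 9 (.reg 49 + (2 + .reg 61)) % .reg 48) ;; select ;;
      .assign 19 (.reg 55) ;; record)

/-- The modulus is at most `2 * 2 ^ k`, the number of samples equals it, and each sample takes
polynomially many steps. -/
theorem trial_run (ho : Ok B s) (hC : Ctx B n v s) (hR : Rec n v S s) {e : ℕ} {F : ℕ → ℕ}
    (h46 : s.reg 46 = e) (he : e < 2 ^ 28 * (n + 1) ^ 9) (h9 : s.arr 9 = F) :
    Run B ω trial s (200000 * (n + 1) * 2 ^ (2 * n / 5))
      (Rec n v (S ∪ {z | ∃ i < 2 * 2 ^ (2 * n / 5), z = trialMask n v F e i})) := by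
  have hp : 1 ≤ 2 ^ (2 * n / 5) := Nat.one_le_two_pow
  have hk : 2 ^ (2 * n / 5) ≤ 2 ^ n := Nat.pow_le_pow_right (by norm_num) (by omega)
  have hn1 : 1 ≤ 2 ^ n := Nat.one_le_two_pow
  have hn2 : n < 2 ^ n := Nat.lt_two_pow_self
  have hnB : 2 ^ (n + 3) < 2 ^ B := hC.lt _ le_rfl
  have hn3 : 2 ^ (n + 3) = 8 * 2 ^ n := by ring
  have hT : e * (2 + 2 * 2 ^ (2 * n / 5)) < 2 ^ B := by
    refine hC.lt (9 * n + 28 + (n + 2)) ?_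
    rw [pow_add]
    refine Nat.mul_le_mul (he.le.trans (trials_lt n)) ?_
    rw [pow_add]; omega
  have hmod : e % (2 * n / 5 + 1) < 2 * n / 5 + 1 := Nat.mod_lt _ (by omega)
  have hmod' : e / (2 * n / 5 + 1) % (2 * n + 6 + 1) < 2 * n + 6 + 1 := Nat.mod_lt _ (by omega)
  have hRle : trialR n e ≤ 2 * 2 ^ (2 * n / 5) := by
    rw [trialR, ← pow_succ']
    exact Nat.pow_le_pow_right (by norm_num) (by omega)
  have hRpos : 0 < trialR n e := by rw [trialR]; positivity
  have hMB : trialM n e < 2 ^ B := hC.lt (2 * n + 6) (Nat.pow_le_pow_right (by norm_num) (by omega))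
  have hMpos : 0 < trialM n e := by rw [trialM]; positivity
  have hPpos : 0 < trialP n F e := by rw [trialP]; omega
  have hPle : trialP n F e ≤ 2 * 2 ^ (2 * n / 5) := by
    have := Nat.mod_lt (F (trialPos n e 0)) hRpos
    rw [trialP]; omega
  refine Run.le (k₁ := 1000 + (1000 + (1000 + (1000 + (1000 + (1000 +
    (20000 * (n + 1) * trialP n F e + (1000 + (2 * 2 ^ (2 * n / 5) *
      ((1000 + (10000 * (n + 1) + (1000 + 20000 * (n + 1)))) + 2000) + 2000))))))))) ?_ ?_
  swap
  · have : 20000 * (n + 1) * trialP n F e ≤ 20000 * (n + 1) * (2 * 2 ^ (2 * n / 5)) :=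
      Nat.mul_le_mul_left _ hPle
    nlinarith
  have hRdef : trialR n e = 2 ^ (e % (2 * n / 5 + 1) + 1) := rfl
  have hMdef : trialM n e = 2 ^ (e / (2 * n / 5 + 1) % (2 * n + 6 + 1)) := rfl
  have hPdef : trialP n F e = 1 + F (trialPos n e 0) % trialR n e := rfl
  have hresdef : trialRes n F e = F (trialPos n e 1) % trialR n e % trialP n F e := rfl
  have hres : trialRes n F e < trialP n F e := Nat.mod_lt _ hPpos
  refine Run.assign_seq (e % (2 * n / 5 + 1)) ho (by simp [h46, hC.r1]) (by omega) fun ho => ?_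
  refine Run.assign_seq (trialR n e) ho (by simp [hC.a10 _ (show e % (2 * n / 5 + 1) + 1
    ≤ 2 * n + 6 by omega), hRdef]) (by omega) fun ho => ?_
  refine Run.assign_seq (trialM n e) ho (by simp [h46, hC.r1, hC.r9, hC.a10 _ (show
    e / (2 * n / 5 + 1) % (2 * n + 6 + 1) ≤ 2 * n + 6 by omega), hMdef]) hMB fun ho => ?_
  refine Run.assign_seq (e * (2 + 2 * 2 ^ (2 * n / 5))) ho (by simp [h46, hC.r2]) hT fun ho => ?_
  refine Run.assign_seq (trialP n F e) ho (by simp [h9, hPdef, trialPos]) (by omega) fun ho => ?_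
  refine Run.assign_seq (trialRes n F e) ho (by simp [h9, hresdef, trialPos]) (by omega)
    fun ho => ?_
  refine Run.seq (tabulate_run ho (hC.setReg.setReg.setReg.setReg.setReg.setReg) hPpos (by simp)) ?_
  intro s₁ ho₁ hF h8
  have hC₁ : Ctx B n v s₁ := (hC.setReg.setReg.setReg.setReg.setReg.setReg).fr hF
  have hR₁ : Rec n v S s₁ := (hR.setReg.setReg.setReg.setReg.setReg.setReg).fr hF
  have h49 : s₁.reg 49 = e * (2 + 2 * 2 ^ (2 * n / 5)) := by rw [hF.reg 49]; simp
  have h48 : s₁.reg 48 = trialM n e := by rw [hF.reg 48]; simp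
  have h50 : s₁.reg 50 = trialP n F e := by rw [hF.reg 50]; simp
  have h51 : s₁.reg 51 = trialRes n F e := by rw [hF.reg 51]; simp
  have h9₁ : s₁.arr 9 = F := by rw [hF.arr 9]; simpa using h9
  clear hF
  refine Run.assign_seq (2 * 2 ^ (2 * n / 5)) ho₁ (by simp [hC₁.r2]) (by omega) fun ho₁ => ?_
  refine Run.mono (Run.for (m := 2 * 2 ^ (2 * n / 5)) (fun j s' =>
    Rec n v (S ∪ {z | ∃ i < j, z = trialMask n v F e i}) s') ho₁ (by simp) rfl rfl (by norm_num)
    (by simpa using hR₁.setReg.setReg) ?_) le_rfl fun _ _ _ h => h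
  rintro j hj s₂ ho₂ hF hr hR₂
  have hC₂ : Ctx B n v s₂ := (hC₁.setReg (x := 68)).fr hF
  have h49₂ : s₂.reg 49 = e * (2 + 2 * 2 ^ (2 * n / 5)) := by rw [hF.reg 49]; simpa using h49
  have h48₂ : s₂.reg 48 = trialM n e := by rw [hF.reg 48]; simpa using h48
  have h50₂ : s₂.reg 50 = trialP n F e := by rw [hF.reg 50]; simpa using h50
  have h51₂ : s₂.reg 51 = trialRes n F e := by rw [hF.reg 51]; simpa using h51
  have h9₂ : s₂.arr 9 = F := by rw [hF.arr 9]; simpa using h9₁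
  have h8₂ : s₂.arr 8 = s₁.arr 8 := by rw [hF.arr 8]; simp
  clear hF
  refine Run.assign_seq (F (trialPos n e (2 + j)) % trialM n e) ho₂
    (by simp [h9₂, h49₂, hr, h48₂, trialPos]) ((Nat.mod_lt _ hMpos).trans hMB) fun ho₂ => ?_
  refine Run.seq (select_run ho₂ hC₂.setReg hres (by simp [h50₂]) (by simp [h51₂])
    (u := F (trialPos n e (2 + j)) % trialM n e) (by simp)
    (by simpa [h8₂] using h8)) fun s₃ ho₃ hF h55 => ?_
  have hC₃ : Ctx B n v s₃ := hC₂.setReg.fr hF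
  have hR₃ := (hR₂.setReg (x := 57) (y := F (trialPos n e (2 + j)) % trialM n e)).fr hF
  have hlt : trialMask n v F e j < 2 ^ n := unrank_lt _ _ _ _ _
  clear hF
  refine Run.assign_seq (trialMask n v F e j) ho₃ (by simpa [trialMask] using h55) (by omega)
    fun ho₃ => ?_
  refine Run.mono (record_run ho₃ hC₃.setReg (z := trialMask n v F e j) (by simp) hlt hR₃.setReg)
    le_rfl fun s₄ ho₄ hF hR₄ => hR₄.setReg.subset ?_
  rintro z (hz | ⟨i, hi, hz⟩)
  · exact Or.inr (Or.inl hz)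
  · rcases Nat.lt_succ_iff_lt_or_eq.1 hi with hi | rfl
    · exact Or.inr (Or.inr ⟨i, hi, hz⟩)
    · exact Or.inl hz

/-- Run all trials. -/
def trials : Cmd := .for 46 8 trial

theorem trials_run (ho : Ok B s) (hC : Ctx B n v s) (hR : Rec n v S s) {F : ℕ → ℕ}
    (h9 : s.arr 9 = F) :
    Run B ω trials s (2 ^ 28 * (n + 1) ^ 9 * (200000 * (n + 1) * 2 ^ (2 * n / 5) + 2000) + 2000)
      (Rec n v (S ∪ {z | ∃ e < 2 ^ 28 * (n + 1) ^ 9, ∃ i < 2 * 2 ^ (2 * n / 5),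
        z = trialMask n v F e i})) := by
  refine Run.mono (Run.for (m := 2 ^ 28 * (n + 1) ^ 9) (fun j s' =>
    Rec n v (S ∪ {z | ∃ e < j, ∃ i < 2 * 2 ^ (2 * n / 5), z = trialMask n v F e i}) s') ho
    (by rw [hC.r8]) rfl rfl (by norm_num) (by simpa using hR.setReg) ?_) le_rfl fun _ _ _ h => h
  rintro j hj s₂ ho₂ hF hr hR₂
  refine Run.mono (trial_run ho₂ (hC.fr hF) hR₂ hr hj (F := F)
    (by rw [hF.arr 9]; exact h9)) le_rfl
    fun s₄ ho₄ hF hR₄ => hR₄.setReg.subset ?_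
  rintro z (hz | ⟨e, he, hz⟩)
  · exact Or.inl (Or.inl hz)
  · rcases Nat.lt_succ_iff_lt_or_eq.1 he with he | rfl
    · exact Or.inl (Or.inr ⟨e, he, hz⟩)
    · exact Or.inr hz

/-! ### The output -/

/-- Write the two masks that have been found to the arrays `1` and `2`. -/
def output : Cmd :=
  .for 63 0 (.write 1 (.reg 63) (.reg 11 / .read 10 (.read 4 (.reg 63)) % 2) ;;
    .write 2 (.reg 63) (.reg 12 / .read 10 (.read 4 (.reg 63)) % 2))

theorem output_run (ho : Ok B s) (hC : Ctx B n v s) (h4 : ∀ i < n, s.arr 4 i < n) :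
    Run B ω output s (4000 * n + 2000) fun s' => ∀ i < n,
      s'.arr 1 i = s.reg 11 / 2 ^ s.arr 4 i % 2 ∧ s'.arr 2 i = s.reg 12 / 2 ^ s.arr 4 i % 2 := by
  have h1B : 1 < 2 ^ B := hC.lt 0 (by simp)
  refine Run.le (k₁ := n * ((1000 + 1000) + 2000) + 2000) ?_ (by omega)
  refine Run.mono (Run.for (m := n) (fun j s' => ∀ i < j,
      s'.arr 1 i = s.reg 11 / 2 ^ s.arr 4 i % 2 ∧ s'.arr 2 i = s.reg 12 / 2 ^ s.arr 4 i % 2) ho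
    hC.r0 rfl rfl (by norm_num) (by simp) ?_) le_rfl fun _ _ _ h => h
  rintro j hj s₁ ho₁ hF hr hI
  have hC₁ : Ctx B n v s₁ := hC.fr hF
  have h4₁ : s₁.arr 4 = s.arr 4 := hF.arr 4
  have h11 : s₁.reg 11 = s.reg 11 := hF.reg 11
  have h12 : s₁.reg 12 = s.reg 12 := hF.reg 12
  have h10 := hC₁.a10 (s.arr 4 j) (by have := h4 j hj; omega)
  clear hF
  refine Run.write_seq j (s.reg 11 / 2 ^ s.arr 4 j % 2) ho₁ (by simp [hr])
    (by simp [h11, h4₁, hr, h10]) (by omega) fun ho₁ => ?_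
  refine Run.write_last j (s.reg 12 / 2 ^ s.arr 4 j % 2) ho₁ (by simp [hr])
    (by simp [h12, h4₁, hr, h10, State.setArr_arr]) (by omega) fun i hi => ?_
  simp only [State.setReg_arr, State.setArr_arr]
  by_cases h : i = j
  · simp [h]
  · have := hI i (by omega)
    simpa [h] using this

end PES

namespace PES

variable {B : ℕ} {ω : ℕ → Bool} {c c₁ c₂ : Cmd} {s : State} {k k₁ k₂ : ℕ} {Q Q₁ : State → Prop}
variable {n : ℕ} {v : ℕ → ℕ} {S S' : Set ℕ}

/-! ### The whole program -/

/-- The algorithm. -/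
def solve : Cmd := setup ;; toss ;; sort ;; build ;; search ;; trials ;; output

/-- Two different masks in `S` have the same weight. -/
def Collides (n : ℕ) (v : ℕ → ℕ) (S : Set ℕ) : Prop :=
  ∃ x ∈ S, ∃ y ∈ S, x ≠ y ∧ wsum v n x = wsum v n y

theorem Collides.mono (h : Collides n v S) (hS : S ⊆ S') : Collides n v S' := by
  obtain ⟨x, hx, y, hy, h⟩ := h
  exact ⟨x, hS hx, y, hS hy, h⟩

/-- The masks that the deterministic part of the algorithm records. -/
def searchSet (n : ℕ) (v d : ℕ → ℕ) : Set ℕ :=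
  {z | ∃ b < 2 ^ (2 * n / 5), z = b * 2 ^ (2 * n / 5)} ∪ scanSet n v d (searchIter n v n).1

/-- The masks that the randomized part of the algorithm records. -/
def trialSet (n : ℕ) (v F : ℕ → ℕ) : Set ℕ :=
  {z | ∃ e < 2 ^ 28 * (n + 1) ^ 9, ∃ i < 2 * 2 ^ (2 * n / 5), z = trialMask n v F e i}

/-- `d` is an inverse table of the middle sums. -/
structure InvTable (n : ℕ) (v d : ℕ → ℕ) : Prop where
  inv : ∀ y, d y ≠ 0 → d y - 1 < 2 ^ (2 * n / 5) ∧ midSum n v (d y - 1) = y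
  cover : ∀ b < 2 ^ (2 * n / 5), d (midSum n v b) ≠ 0

theorem trialPos_lt {e i : ℕ} (he : e < 2 ^ 28 * (n + 1) ^ 9) (hi : i < 2 + 2 * 2 ^ (2 * n / 5)) :
    trialPos n e i < 2 ^ 28 * (n + 1) ^ 9 * (2 + 2 * 2 ^ (2 * n / 5)) := by
  have : (e + 1) * (2 + 2 * 2 ^ (2 * n / 5)) ≤ 2 ^ 28 * (n + 1) ^ 9 * (2 + 2 * 2 ^ (2 * n / 5)) :=
    Nat.mul_le_mul_right _ he
  rw [trialPos]
  rw [add_mul, one_mul] at this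
  omega

/-- The trials read only the places of the array `9` that `toss` has filled, so its contents may be
replaced by `coinNum`. -/
theorem trialSet_congr {F G : ℕ → ℕ}
    (h : ∀ i < 2 ^ 28 * (n + 1) ^ 9 * (2 + 2 * 2 ^ (2 * n / 5)), F i = G i) :
    trialSet n v F = trialSet n v G := by
  have hm : ∀ e < 2 ^ 28 * (n + 1) ^ 9, ∀ i < 2 * 2 ^ (2 * n / 5),
      trialMask n v F e i = trialMask n v G e i := fun e he i hi => by
    simp only [trialMask, trialP, trialRes]
    rw [h _ (trialPos_lt he (by omega)), h _ (trialPos_lt he (by omega)),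
      h _ (trialPos_lt he (by omega))]
  ext z
  constructor
  · rintro ⟨e, he, i, hi, rfl⟩
    exact ⟨e, he, i, hi, hm e he i hi⟩
  · rintro ⟨e, he, i, hi, rfl⟩
    exact ⟨e, he, i, hi, (hm e he i hi).symm⟩

theorem eq_of_bits {x y : ℕ} (hx : x < 2 ^ n) (hy : y < 2 ^ n)
    (h : ∀ i < n, x / 2 ^ i % 2 = y / 2 ^ i % 2) : x = y := by
  refine Nat.eq_of_testBit_eq fun i => ?_
  by_cases hi : i < n
  · rw [Nat.testBit_eq_decide_div_mod_eq, Nat.testBit_eq_decide_div_mod_eq, h i hi]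
  · have hle : 2 ^ n ≤ 2 ^ i := Nat.pow_le_pow_right (by norm_num) (by omega)
    rw [Nat.testBit_lt_two_pow (by omega), Nat.testBit_lt_two_pow (by omega)]

theorem sum_subset_eq {w : Fin n → ℕ} {u : ℕ → ℕ} (hu : ∀ i : Fin n, u i = w i) {a x : ℕ}
    (ha : ∀ i < n, s.arr a i = x / 2 ^ rank n u i % 2) :
    ∑ i ∈ s.subset n a, w i = wsum (sorted n u) n x := by
  rw [wsum, ← sum_rank n u, Finset.sum_range, State.subset, Finset.sum_filter]
  refine Finset.sum_congr rfl fun i _ => ?_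
  rw [ha i i.2, sorted_rank i.2, hu]
  have := Nat.mod_two_eq_zero_or_one (x / 2 ^ rank n u i)
  rcases this with h | h <;> simp [h]

/-- The input weights as a function on all numbers. -/
def input {n : ℕ} (w : Fin n → ℕ) (i : ℕ) : ℕ := if h : i < n then w ⟨i, h⟩ else 0

theorem start_arr_zero (w : Fin n → ℕ) : (start w).arr 0 = input w := by
  funext i; simp [start, input]

theorem sum_input (w : Fin n → ℕ) : ∑ i ∈ Finset.range n, input w i = ∑ i, w i := by
  rw [Finset.sum_range]
  exact Finset.sum_congr rfl fun i _ => by simp [input]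

/-- Masks refer to positions in the sorted order, so index `i` is selected by bit `rank i`. As
`rank` permutes the indices, different masks give different subsets and the sums are preserved. -/
theorem isSolution_of_found {w : Fin n → ℕ} {x y : ℕ} (hxy : x ≠ y) (hx : x < 2 ^ n) (hy : y < 2 ^ n)
    (he : wsum (sorted n (input w)) n x = wsum (sorted n (input w)) n y)
    (h1 : ∀ i < n, s.arr 1 i = x / 2 ^ rank n (input w) i % 2)
    (h2 : ∀ i < n, s.arr 2 i = y / 2 ^ rank n (input w) i % 2) :
    IsSolution w (s.subset n 1) (s.subset n 2) := by
  have hu : ∀ i : Fin n, input w i = w i := fun i => by simp [input]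
  refine ⟨fun hAB => hxy (eq_of_bits hx hy fun r hr => ?_), ?_⟩
  · have hr' : r ∈ (Finset.range n).image (rank n (input w)) := by rw [rank_image]; simpa using hr
    obtain ⟨i, hi, rfl⟩ := Finset.mem_image.1 hr'
    rw [Finset.mem_range] at hi
    have hmem := Finset.ext_iff.1 hAB ⟨i, hi⟩
    simp only [State.subset, Finset.mem_filter, Finset.mem_univ, true_and, h1 i hi, h2 i hi] at hmem
    omega
  · rw [sum_subset_eq hu h1, sum_subset_eq hu h2, he]

/-- The inverse table `d` is left existential: which preimages it keeps is irrelevant, as any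
inverse table serves. The `12n + 60` bits leave room for the largest stored numbers, the positions
of random numbers, which are at most `2 ^ (10n + 30)`. -/
theorem solve_run {w : Fin n → ℕ} (hw : IsInstance w) (ω : ℕ → Bool) :
    Run (12 * n + 60) ω solve (start w) (2 ^ 50 * (n + 1) ^ 10 * 2 ^ (2 * n / 5)) fun s' =>
      ∃ d, InvTable n (sorted n (input w)) d ∧
        (Collides n (sorted n (input w)) (searchSet n (sorted n (input w)) d ∪
            trialSet n (sorted n (input w)) (coinNum ω (2 * n + 6))) →
          IsSolution w (s'.subset n 1) (s'.subset n 2)) := by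
  have hsum : ∑ i ∈ Finset.range n, sorted n (input w) i < 2 ^ n := by
    rw [sum_sorted, sum_input]; have := hw.2; omega
  generalize hv : sorted n (input w) = v at *
  have hn2 : n < 2 ^ n := Nat.lt_two_pow_self
  have hn1 : 1 ≤ 2 ^ n := Nat.one_le_two_pow
  have hnB : 2 ^ n < 2 ^ (12 * n + 60) := Nat.pow_lt_pow_right (by norm_num) (by omega)
  have ho : Ok (12 * n + 60) (start w) := by
    refine ⟨by omega, fun x => ?_, fun a i => ?_⟩
    · simp only [start]; split_ifs <;> omega
    · simp only [start]
      split_ifs with h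
      · have h1 := Finset.single_le_sum (f := w) (fun _ _ => Nat.zero_le _)
          (Finset.mem_univ ⟨i, h.2⟩)
        have := hw.2
        omega
      · omega
  have harr : ∀ a ≠ 0, (start w).arr a = fun _ => 0 := fun a ha => by
    funext i; simp [start, ha]
  refine Run.le (k₁ := 20000 * (n + 4) + ((2 ^ 28 * (n + 1) ^ 9 * (2 + 2 * 2 ^ (2 * n / 5)) *
    (40000 * (n + 1)) + 3000) + (20000 * (n + 1) ^ 2 + (60000 * (n + 1) * 2 ^ (2 * n / 5) +
    (300000 * (n + 1) ^ 4 * 2 ^ (2 * n / 5) + ((2 ^ 28 * (n + 1) ^ 9 *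
    (200000 * (n + 1) * 2 ^ (2 * n / 5) + 2000) + 2000) + (4000 * n + 2000))))))) ?_ ?_
  swap
  · have hP : 1 ≤ 2 ^ (2 * n / 5) := Nat.one_le_two_pow
    generalize 2 ^ (2 * n / 5) = P at *
    have hle : ∀ i ≤ 10, (n + 1) ^ i ≤ (n + 1) ^ 10 * P := fun i hi =>
      (Nat.pow_le_pow_right (by omega) hi).trans (Nat.le_mul_of_pos_right _ hP)
    have hle' : ∀ i ≤ 10, (n + 1) ^ i * P ≤ (n + 1) ^ 10 * P := fun i hi =>
      Nat.mul_le_mul_right _ (Nat.pow_le_pow_right (by omega) hi)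
    have e1 := hle 1 (by omega)
    have e2 := hle 2 (by omega)
    have e9 := hle 9 (by omega)
    have e10 := hle 10 (by omega)
    have f1 := hle' 1 (by omega)
    have f4 := hle' 4 (by omega)
    rw [pow_one] at e1 f1
    calc _ = 20000 * (n + 4) + (2 ^ 28 * 80000 * (n + 1) ^ 10 + 2 ^ 28 * 80000 * ((n + 1) ^ 10 * P)
          + 3000 + (20000 * (n + 1) ^ 2 + (60000 * ((n + 1) * P) +
          (300000 * ((n + 1) ^ 4 * P) + ((2 ^ 28 * 200000 * ((n + 1) ^ 10 * P) +
            2 ^ 28 * 2000 * (n + 1) ^ 9 + 2000) + (4000 * n + 2000)))))) := by ring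
      _ ≤ 2 ^ 50 * ((n + 1) ^ 10 * P) := by omega
      _ = _ := by ring
  refine Run.seq (setup_run ho le_rfl (by simp [start]) (harr 3 (by norm_num)) rfl) ?_
  rintro s₁ ho₁ hF₁ ⟨hC₁, hc₁⟩
  have z₁ : s₁.arr 0 = input w ∧ s₁.arr 5 = (fun _ => 0) ∧ s₁.arr 6 = (fun _ => 0) ∧
      s₁.arr 7 = (fun _ => 0) ∧ s₁.reg 10 = 0 :=
    ⟨by rw [hF₁.arr 0, start_arr_zero], by rw [hF₁.arr 5, harr 5 (by norm_num)],
      by rw [hF₁.arr 6, harr 6 (by norm_num)], by rw [hF₁.arr 7, harr 7 (by norm_num)],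
      by rw [hF₁.reg 10]; simp [start]⟩
  refine Run.seq (toss_run ho₁ hC₁ hc₁) fun s₂ ho₂ hF₂ h9 => ?_
  have hC₂ := hC₁.fr hF₂
  have z₂ : s₂.arr 0 = input w ∧ s₂.arr 5 = (fun _ => 0) ∧ s₂.arr 6 = (fun _ => 0) ∧
      s₂.arr 7 = (fun _ => 0) ∧ s₂.reg 10 = 0 := by
    rw [hF₂.arr 0, hF₂.arr 5, hF₂.arr 6, hF₂.arr 7, hF₂.reg 10]; exact z₁
  refine Run.seq (sort_run ho₂ hC₂) ?_
  rintro s₃ ho₃ hF₃ ⟨h4, h3, h3'⟩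
  have z₃ : s₃.arr 5 = (fun _ => 0) ∧ s₃.arr 6 = (fun _ => 0) ∧
      s₃.arr 7 = (fun _ => 0) ∧ s₃.reg 10 = 0 := by
    rw [hF₃.arr 5, hF₃.arr 6, hF₃.arr 7, hF₃.reg 10]; exact z₂.2
  have h9₃ : s₃.arr 9 = s₂.arr 9 := hF₃.arr 9
  rw [z₂.1] at h4 h3
  have h3v : s₃.arr 3 = v := by
    rw [← hv]
    exact eq_sorted h3 fun r hr => by rw [h3' r hr, hC₂.a3]
  have hC₃ : Ctx (12 * n + 60) n v s₃ :=
    ⟨by rw [hF₃.reg 0, hC₂.r0], by rw [hF₃.reg 1, hC₂.r1], by rw [hF₃.reg 2, hC₂.r2],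
      by rw [hF₃.reg 3, hC₂.r3], by rw [hF₃.reg 4, hC₂.r4], by rw [hF₃.reg 5, hC₂.r5],
      by rw [hF₃.reg 6, hC₂.r6], by rw [hF₃.reg 7, hC₂.r7], by rw [hF₃.reg 8, hC₂.r8],
      by rw [hF₃.reg 9, hC₂.r9], h3v, by rw [hF₃.arr 10]; exact hC₂.a10, le_rfl, hsum⟩
  have hR₃ : Rec n v ∅ s₃ := by
    refine ⟨fun y hy => absurd (by rw [z₃.1]) hy, fun _ z hz => absurd hz (by simp),
      fun h => absurd z₃.2.2.2 h⟩
  refine Run.seq (build_run ho₃ hC₃ hR₃ z₃.2.1 z₃.2.2.1) ?_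
  rintro s₄ ho₄ hF₄ ⟨hb₄, hR₄⟩
  have hC₄ := hC₃.fr hF₄
  refine Run.seq (search_run ho₄ hC₄ hR₄ hb₄ rfl) fun s₅ ho₅ hF₅ hR₅ => ?_
  have hC₅ := hC₄.fr hF₅
  have h9₅ : s₅.arr 9 = s₂.arr 9 := by rw [hF₅.arr 9, hF₄.arr 9, h9₃]
  refine Run.seq (trials_run ho₅ hC₅ hR₅ h9₅) fun s₆ ho₆ hF₆ hR₆ => ?_
  have hC₆ := hC₅.fr hF₆
  have h4₆ : ∀ i < n, s₆.arr 4 i = rank n (input w) i := by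
    rw [hF₆.arr 4, hF₅.arr 4, hF₄.arr 4]; exact h4
  refine Run.mono (output_run ho₆ hC₆ fun i hi => by rw [h4₆ i hi]; exact rank_lt hi) le_rfl ?_
  intro s₇ _ _ hout
  refine ⟨s₄.arr 7, ⟨hb₄.inv, hb₄.cover⟩, ?_⟩
  rintro ⟨x, hx, y, hy, hne, he⟩
  have hsub : searchSet n v (s₄.arr 7) ∪ trialSet n v (coinNum ω (2 * n + 6)) ⊆
      (∅ ∪ {z | ∃ b < 2 ^ (2 * n / 5), z = b * 2 ^ (2 * n / 5)}) ∪
        scanSet n v (s₄.arr 7) (searchIter n v n).1 ∪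
        {z | ∃ e < 2 ^ 28 * (n + 1) ^ 9, ∃ i < 2 * 2 ^ (2 * n / 5),
          z = trialMask n v (s₂.arr 9) e i} := by
    rw [← trialSet_congr h9, Set.empty_union]
    exact subset_rfl
  have hf := hR₆.found (hR₆.exists_found (hsub hx) (hsub hy) hne he)
  subst hv
  exact isSolution_of_found hf.1 hf.2.1 hf.2.2.1 hf.2.2.2
    (fun i hi => by rw [(hout i hi).1, h4₆ i hi]) (fun i hi => by rw [(hout i hi).2, h4₆ i hi])

end PES

/-! ### Few collisions: the deterministic part finds a solution -/

namespace PES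

variable {n : ℕ} {v : ℕ → ℕ}

/-! ### Nearly injective weights are nearly powers of two -/

theorem sum_bits_eq {m z : ℕ} (hz : z < 2 ^ m) : ∑ t ∈ Finset.range m, 2 ^ t * (z / 2 ^ t % 2) = z := by
  induction m generalizing z with
  | zero => simp at hz ⊢; omega
  | succ m ih =>
    rw [Finset.sum_range_succ']
    have h := ih (z := z / 2) (by rw [pow_succ] at hz; omega)
    have h2 : ∑ t ∈ Finset.range m, 2 ^ (t + 1) * (z / 2 ^ (t + 1) % 2) = 2 * (z / 2) := by
      rw [← h, Finset.mul_sum]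
      refine Finset.sum_congr rfl fun t _ => ?_
      rw [pow_succ', ← Nat.div_div_eq_div_mul, mul_assoc]
    rw [h2]
    simp
    omega

theorem le_wsum {t z : ℕ} (ht : t < n) (h : z / 2 ^ t % 2 = 1) : v t ≤ wsum v n z := by
  have := Finset.single_le_sum (f := fun t => v t * (z / 2 ^ t % 2)) (fun _ _ => Nat.zero_le _)
    (Finset.mem_range.2 ht)
  simp only [h, mul_one] at this
  exact this

theorem lt_two_pow_of_bits {z i : ℕ} (hz : z < 2 ^ n) (h : ∀ t < n, i ≤ t → z / 2 ^ t % 2 = 0) :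
    z < 2 ^ i := by
  by_contra hlt
  have hin : i < n := by
    by_contra hni
    exact hlt (hz.trans_le (Nat.pow_le_pow_right (by norm_num) (by omega)))
  have hzero : z / 2 ^ i = 0 := by
    refine eq_of_bits (n := n - i) ?_ (by positivity) fun t ht => ?_
    · rw [Nat.div_lt_iff_lt_mul (by positivity), ← pow_add]
      rwa [show n - i + i = n by omega]
    · rw [Nat.div_div_eq_div_mul, ← pow_add, h _ (by omega) (by omega)]
      simp
  rw [Nat.div_eq_zero_iff] at hzero
  rcases hzero with h0 | h0
  · exact absurd h0 (by positivity)
  · exact hlt h0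

/-- The weights that occur. -/
def weights (n : ℕ) (v : ℕ → ℕ) : Finset ℕ := (Finset.range (2 ^ n)).image (wsum v n)

theorem weights_subset (n : ℕ) (v : ℕ → ℕ) :
    weights n v ⊆ Finset.range (∑ t ∈ Finset.range n, v t + 1) := fun y hy => by
  obtain ⟨z, -, rfl⟩ := Finset.mem_image.1 hy
  exact Finset.mem_range.2 (Nat.lt_succ_of_le (wsum_le _ _ _))

/-- A sum less than `v i` uses only indices below `i`, by sortedness, so there are at most `2 ^ i`
of them. All other sums lie between `v i` and the total, which leaves room for fewer than `2 ^ n - v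
i`. Compare with the assumed number of sums. -/
theorem weight_upper {D : ℕ} (hs : ∀ i j, i ≤ j → j < n → v i ≤ v j)
    (hW : ∑ t ∈ Finset.range n, v t < 2 ^ n - 1) (hD : 2 ^ n ≤ (weights n v).card + D) {i : ℕ}
    (hi : i < n) : v i ≤ 2 ^ i + D := by
  have hsub : weights n v ⊆ (Finset.range (2 ^ i)).image (wsum v n) ∪
      Finset.Ico (v i) (∑ t ∈ Finset.range n, v t + 1) := fun y hy => by
    have hy' := Finset.mem_range.1 (weights_subset n v hy)
    obtain ⟨z, hz, rfl⟩ := Finset.mem_image.1 hy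
    rw [Finset.mem_union]
    by_cases h : wsum v n z < v i
    · refine Or.inl (Finset.mem_image_of_mem _ (Finset.mem_range.2 ?_))
      refine lt_two_pow_of_bits (Finset.mem_range.1 hz) fun t ht hit => ?_
      by_contra hne
      have := le_wsum (v := v) ht (show z / 2 ^ t % 2 = 1 by omega)
      have := hs i t hit ht
      omega
    · exact Or.inr (Finset.mem_Ico.2 ⟨by omega, hy'⟩)
  have hcard := (Finset.card_le_card hsub).trans (Finset.card_union_le _ _)
  have h1 : ((Finset.range (2 ^ i)).image (wsum v n)).card ≤ 2 ^ i :=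
    Finset.card_image_le.trans (Finset.card_range _).le
  rw [Nat.card_Ico] at hcard
  have h2 : v i ≤ ∑ t ∈ Finset.range n, v t :=
    Finset.single_le_sum (fun _ _ => Nat.zero_le _) (Finset.mem_range.2 hi)
  omega

theorem sum_two_pow (m : ℕ) : ∑ t ∈ Finset.range m, 2 ^ t + 1 = 2 ^ m := by
  induction m with
  | zero => simp
  | succ m ih => rw [Finset.sum_range_succ, pow_succ]; omega

/-- So many distinct sums force the total weight to be at least `2 ^ n - 1 - D`, which is the sum of
all `2 ^ t` minus `D`. Subtracting the upper bounds for the other `n - 1` weights leaves the lower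
bound for this one. -/
theorem weight_lower {D : ℕ} (hu : ∀ i < n, v i ≤ 2 ^ i + D)
    (hD : 2 ^ n ≤ (weights n v).card + D) {i : ℕ} (hi : i < n) : 2 ^ i ≤ v i + n * D := by
  have hcard := Finset.card_le_card (weights_subset n v)
  rw [Finset.card_range] at hcard
  have hmem := Finset.mem_range.2 hi
  have h1 := Finset.add_sum_erase (Finset.range n) v hmem
  have h2 := Finset.add_sum_erase (Finset.range n) (fun t => 2 ^ t) hmem
  have h3 : ∑ t ∈ (Finset.range n).erase i, v t
      ≤ ∑ t ∈ (Finset.range n).erase i, 2 ^ t + (n - 1) * D := by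
    have : ∑ t ∈ (Finset.range n).erase i, v t ≤ ∑ t ∈ (Finset.range n).erase i, (2 ^ t + D) :=
      Finset.sum_le_sum fun t ht => hu t (Finset.mem_range.1 (Finset.mem_of_mem_erase ht))
    rw [Finset.sum_add_distrib, Finset.sum_const, Finset.card_erase_of_mem hmem,
      Finset.card_range, smul_eq_mul] at this
    exact this
  have h4 := sum_two_pow n
  have h5 : n * D = (n - 1) * D + D := by
    conv_lhs => rw [show n = (n - 1) + 1 by omega]
    ring
  omega

/-! ### The scans are exact on such weights -/

/-- All weights differ by at most about `n * D` from the powers of two. -/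
structure NearPow (n : ℕ) (v : ℕ → ℕ) (D : ℕ) : Prop where
  upper : ∀ i < n, v i ≤ 2 ^ i + D
  lower : ∀ i < n, 2 ^ i ≤ v i + n * D

theorem four_pow_two (m : ℕ) : 4 ^ m = 2 ^ (2 * m) := by rw [pow_mul]; norm_num

/-- The top weights are `4 ^ k * 2 ^ t` with an error of at most `D = 4 ^ k` each, so up to fewer
than `n` such errors the top sum is `u * 4 ^ k`. The choice of `D` makes the error comparable to the
size of the low and middle parts. -/
theorem topSum_upper (h : NearPow n v (4 ^ (2 * n / 5))) {u : ℕ} (hu : u < 2 ^ (n - 2 * (2 * n / 5))) :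
    topSum n v u ≤ (u + n) * 4 ^ (2 * n / 5) := by
  have h1 : topSum n v u ≤ ∑ t ∈ Finset.range (n - 2 * (2 * n / 5)),
      (4 ^ (2 * n / 5) * (2 ^ t * (u / 2 ^ t % 2)) + 4 ^ (2 * n / 5)) := by
    unfold topSum wsum
    refine Finset.sum_le_sum fun t ht => ?_
    rw [Finset.mem_range] at ht
    have h2 := h.upper (2 * (2 * n / 5) + t) (by omega)
    rw [pow_add, ← four_pow_two] at h2
    rcases Nat.mod_two_eq_zero_or_one (u / 2 ^ t) with h3 | h3
    · simp [h3]
    · simpa [h3] using h2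
  rw [Finset.sum_add_distrib, ← Finset.mul_sum, sum_bits_eq hu, Finset.sum_const,
    Finset.card_range, smul_eq_mul] at h1
  have h2 : (n - 2 * (2 * n / 5)) * 4 ^ (2 * n / 5) ≤ n * 4 ^ (2 * n / 5) :=
    Nat.mul_le_mul_right _ (by omega)
  linarith

theorem topSum_lower (h : NearPow n v (4 ^ (2 * n / 5))) {u : ℕ} (hu : u < 2 ^ (n - 2 * (2 * n / 5))) :
    u * 4 ^ (2 * n / 5) ≤ topSum n v u + n * n * 4 ^ (2 * n / 5) := by
  have h1 : ∑ t ∈ Finset.range (n - 2 * (2 * n / 5)), 4 ^ (2 * n / 5) * (2 ^ t * (u / 2 ^ t % 2))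
      ≤ ∑ t ∈ Finset.range (n - 2 * (2 * n / 5)),
        (v (2 * (2 * n / 5) + t) * (u / 2 ^ t % 2) + n * 4 ^ (2 * n / 5)) := by
    refine Finset.sum_le_sum fun t ht => ?_
    rw [Finset.mem_range] at ht
    have h2 := h.lower (2 * (2 * n / 5) + t) (by omega)
    rw [pow_add, ← four_pow_two] at h2
    rcases Nat.mod_two_eq_zero_or_one (u / 2 ^ t) with h3 | h3
    · simp [h3]
    · simpa [h3] using h2
  rw [Finset.sum_add_distrib, ← Finset.mul_sum, sum_bits_eq hu, Finset.sum_const,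
    Finset.card_range, smul_eq_mul] at h1
  have h2 : (n - 2 * (2 * n / 5)) * (n * 4 ^ (2 * n / 5)) ≤ n * (n * 4 ^ (2 * n / 5)) :=
    Nat.mul_le_mul_right _ (by omega)
  change _ ≤ topSum n v u + _ at h1
  linarith

theorem lowSum_add_midSum_le (h : NearPow n v (4 ^ (2 * n / 5))) (a b : ℕ) :
    lowSum n v a + midSum n v b ≤ (n + 1) * 4 ^ (2 * n / 5) := by
  have h1 : lowSum n v a + midSum n v b ≤ ∑ t ∈ Finset.range (2 * n / 5 + 2 * n / 5), v t := by
    rw [Finset.sum_range_add]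
    refine Nat.add_le_add ((wsum_le _ _ _).trans_eq ?_) (wsum_le _ _ _)
    simp
  have h2 : ∑ t ∈ Finset.range (2 * n / 5 + 2 * n / 5), v t
      ≤ ∑ t ∈ Finset.range (2 * n / 5 + 2 * n / 5), (2 ^ t + 4 ^ (2 * n / 5)) :=
    Finset.sum_le_sum fun t ht => h.upper t (by rw [Finset.mem_range] at ht; omega)
  rw [Finset.sum_add_distrib, Finset.sum_const, Finset.card_range, smul_eq_mul] at h2
  have h3 := sum_two_pow (2 * n / 5 + 2 * n / 5)
  rw [← two_mul, ← four_pow_two, two_mul] at h3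
  have h4 : (2 * n / 5 + 2 * n / 5) * 4 ^ (2 * n / 5) ≤ n * 4 ^ (2 * n / 5) :=
    Nat.mul_le_mul_right _ (by omega)
  linarith

/-- The offset `2n + 1` in `scanLo` is the error `n` of the top sum plus the bound `n + 1` for the
other parts, in units of `4 ^ k`. -/
theorem lt_of_lt_scanLo (h : NearPow n v (4 ^ (2 * n / 5))) {X u : ℕ} (hu : u < scanLo n X) (a b : ℕ) :
    topSum n v u + lowSum n v a + midSum n v b < X := by
  rw [scanLo, lt_min_iff] at hu
  have h1 := topSum_upper h hu.2
  have h2 := lowSum_add_midSum_le h a b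
  have h3 : (u + n + (n + 1) + 1) * 4 ^ (2 * n / 5) ≤ X :=
    (Nat.mul_le_mul_right _ (by omega)).trans (Nat.div_mul_le_self X (4 ^ (2 * n / 5)))
  have h4 : 0 < 4 ^ (2 * n / 5) := by positivity
  linarith

/-- The term `n * n` in `scanHi` is the deficit allowed by `topSum_lower`, and the extra `1`
compensates the rounding of `X / 4 ^ k`. -/
theorem lt_of_scanHi_le (h : NearPow n v (4 ^ (2 * n / 5))) {X u : ℕ} (hu : scanHi n X ≤ u)
    (hu' : u < 2 ^ (n - 2 * (2 * n / 5))) : X < topSum n v u := by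
  have h0 : X / 4 ^ (2 * n / 5) + 1 + n * n ≤ u := by rw [scanHi] at hu; omega
  have h1 := topSum_lower h hu'
  have h3 : (X / 4 ^ (2 * n / 5) + 1 + n * n) * 4 ^ (2 * n / 5) ≤ u * 4 ^ (2 * n / 5) :=
    Nat.mul_le_mul_right _ h0
  have h4 := Nat.lt_div_mul_add (a := X) (b := 4 ^ (2 * n / 5)) (by positivity)
  linarith

theorem sum_range_mul {M : Type*} [AddCommMonoid M] (m c : ℕ) (f : ℕ → M) :
    ∑ z ∈ Finset.range (m * c), f z = ∑ y ∈ Finset.range c, ∑ x ∈ Finset.range m, f (x + m * y) := by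
  induction c with
  | zero => simp
  | succ c ih =>
    rw [mul_add, mul_one, Finset.sum_range_add, Finset.sum_range_succ, ih]
    simp only [add_comm]

/-- The mask with the given parts. -/
def mask (n u b a : ℕ) : ℕ := a + 2 ^ (2 * n / 5) * (b + 2 ^ (2 * n / 5) * u)

theorem wsum_mask (v : ℕ → ℕ) {u b a : ℕ} (ha : a < 2 ^ (2 * n / 5)) (hb : b < 2 ^ (2 * n / 5)) :
    wsum v n (mask n u b a) = topSum n v u + lowSum n v a + midSum n v b := by
  have h1 := wsum_split v (2 * n / 5 + (n - 2 * (2 * n / 5))) (b + 2 ^ (2 * n / 5) * u) ha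
  have h2 := wsum_split (fun t => v (2 * n / 5 + t)) (n - 2 * (2 * n / 5)) u hb
  rw [show 2 * n / 5 + (2 * n / 5 + (n - 2 * (2 * n / 5))) = n by omega] at h1
  have h3 : (fun t => v (2 * (2 * n / 5) + t)) = fun t => v (2 * n / 5 + (2 * n / 5 + t)) :=
    funext fun t => by rw [two_mul (2 * n / 5), add_assoc]
  rw [mask, h1, h2, lowSum, midSum, topSum, h3]
  simp only [zero_add]
  ring

/-- The number of masks of weight less than `X`. -/
def below (n : ℕ) (v : ℕ → ℕ) (X : ℕ) : ℕ :=
  ((Finset.range (2 ^ n)).filter fun z => wsum v n z < X).card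

theorem below_eq_sum (n : ℕ) (v : ℕ → ℕ) (X : ℕ) :
    below n v X = ∑ u ∈ Finset.range (2 ^ (n - 2 * (2 * n / 5))),
      ∑ a ∈ Finset.range (2 ^ (2 * n / 5)), partCount n v X u a := by
  rw [below, Finset.card_filter, ← pow_split n, mul_assoc, sum_range_mul, sum_range_mul]
  refine Finset.sum_congr rfl fun u _ => ?_
  rw [Finset.sum_comm]
  refine Finset.sum_congr rfl fun a ha => ?_
  rw [partCount, Finset.card_filter]
  refine Finset.sum_congr rfl fun b hb => ?_
  have := wsum_mask v (u := u) (Finset.mem_range.1 ha) (Finset.mem_range.1 hb)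
  rw [mask] at this
  rw [this]
  congr 1
  exact propext (by omega)

/-- Top parts before the scanned range contribute all `4 ^ k` completions, those after it none, and
those inside are counted exactly. -/
theorem scanCount_eq_below (h : NearPow n v (4 ^ (2 * n / 5))) (X : ℕ) :
    scanCount n v X = below n v X := by
  have hlo : scanLo n X ≤ scanHi n X := min_le_min
    ((Nat.sub_le _ _).trans ((Nat.le_add_right _ 1).trans (Nat.le_add_right _ _))) le_rfl
  have hhi : scanHi n X ≤ 2 ^ (n - 2 * (2 * n / 5)) := min_le_right _ _
  have hsplit : 2 ^ (n - 2 * (2 * n / 5))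
      = scanLo n X + (scanHi n X - scanLo n X) + (2 ^ (n - 2 * (2 * n / 5)) - scanHi n X) := by omega
  rw [below_eq_sum]
  conv_rhs => rw [hsplit, Finset.sum_range_add, Finset.sum_range_add]
  rw [scanCount, Finset.sum_eq_zero (s := Finset.range (2 ^ (n - 2 * (2 * n / 5)) - scanHi n X)),
    add_zero]
  · congr 1
    have : ∀ u ∈ Finset.range (scanLo n X), ∑ a ∈ Finset.range (2 ^ (2 * n / 5)), partCount n v X u a
        = 4 ^ (2 * n / 5) := fun u hu => by
      have : ∀ a ∈ Finset.range (2 ^ (2 * n / 5)), partCount n v X u a = 2 ^ (2 * n / 5) := fun a _ => by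
        rw [partCount, Finset.filter_true_of_mem, Finset.card_range]
        intro b _
        have := lt_of_lt_scanLo h (Finset.mem_range.1 hu) a b
        omega
      rw [Finset.sum_congr rfl this, Finset.sum_const, Finset.card_range, smul_eq_mul, four_pow_eq]
    rw [Finset.sum_congr rfl this, Finset.sum_const, Finset.card_range, smul_eq_mul]
  · intro i hi
    rw [Finset.mem_range] at hi
    refine Finset.sum_eq_zero fun a _ => ?_
    have := lt_of_scanHi_le h (X := X)
      (u := scanLo n X + (scanHi n X - scanLo n X) + i) (by omega) (by omega)
    rw [partCount, Finset.card_eq_zero, Finset.filter_eq_empty_iff]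
    intro b _
    omega

/-! ### The search succeeds -/

/-- The search keeps `below ≤ identity` at the left end and `below > identity` at the right end. At
the start the right end is `2 ^ n - 1`, which exceeds every subset sum; this is where the pigeonhole
hypothesis enters. -/
theorem searchIter_spec (h : NearPow n v (4 ^ (2 * n / 5))) (hn : 0 < n)
    (hW : ∑ t ∈ Finset.range n, v t < 2 ^ n - 1) {j : ℕ} (hj : j ≤ n) :
    below n v (searchIter n v j).1 ≤ (searchIter n v j).1 ∧
      (searchIter n v j).2 < below n v (searchIter n v j).2 ∧
      (searchIter n v j).1 < (searchIter n v j).2 ∧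
      (searchIter n v j).2 ≤ (searchIter n v j).1 + 2 ^ (n - j) := by
  induction j with
  | zero =>
    have h2 : 2 ≤ 2 ^ n := Nat.le_self_pow (by omega) 2
    refine ⟨by simp [searchIter, below], ?_, by simp [searchIter]; omega, by simp [searchIter]⟩
    have : below n v (2 ^ n - 1) = 2 ^ n := by
      rw [below, Finset.filter_true_of_mem, Finset.card_range]
      intro z _
      exact (wsum_le v n z).trans_lt hW
    change 2 ^ n - 1 < below n v (2 ^ n - 1)
    omega
  | succ j ih =>
    obtain ⟨h1, h2, h3, h4⟩ := ih (by omega)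
    rw [searchIter_succ, searchStep, scanCount_eq_below h]
    rw [show n - j = n - (j + 1) + 1 by omega, pow_succ] at h4
    generalize searchIter n v j = p at *
    split_ifs with hc
    · refine ⟨h1, hc, ?_, by dsimp only; omega⟩
      dsimp only
      -- If the midpoint were the left end, the two invariants would contradict each other there.
      by_contra hlt
      have : (p.1 + p.2) / 2 = p.1 := by omega
      rw [this] at hc
      omega
    · refine ⟨by dsimp only; omega, h2, by dsimp only; omega, by dsimp only; omega⟩

theorem exists_eq_mask {z : ℕ} (hz : z < 2 ^ n) : ∃ u < 2 ^ (n - 2 * (2 * n / 5)),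
    ∃ b < 2 ^ (2 * n / 5), ∃ a < 2 ^ (2 * n / 5), z = mask n u b a := by
  have hp : 0 < 2 ^ (2 * n / 5) := by positivity
  rw [← pow_split n, mul_assoc] at hz
  refine ⟨z / 2 ^ (2 * n / 5) / 2 ^ (2 * n / 5), ?_, z / 2 ^ (2 * n / 5) % 2 ^ (2 * n / 5),
    Nat.mod_lt _ hp, z % 2 ^ (2 * n / 5), Nat.mod_lt _ hp, ?_⟩
  · exact Nat.div_lt_of_lt_mul (Nat.div_lt_of_lt_mul hz)
  · rw [mask, Nat.mod_add_div, Nat.mod_add_div]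

/-- A mask of weight `X` has its top part in the scanned range, so the scan looks up its middle sum.
Either the table returns its own middle part, and the mask is recorded, or it returns another middle
part of the same sum, and the two middle masks collide. -/
theorem mem_or_collides (h : NearPow n v (4 ^ (2 * n / 5))) {d : ℕ → ℕ} (hd : InvTable n v d)
    {X z : ℕ} (hz : z < 2 ^ n) (hX : wsum v n z = X) :
    z ∈ scanSet n v d X ∨ Collides n v {z | ∃ b < 2 ^ (2 * n / 5), z = b * 2 ^ (2 * n / 5)} := by
  obtain ⟨u, hu, b, hb, a, ha, rfl⟩ := exists_eq_mask hz
  rw [wsum_mask v ha hb] at hX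
  have hlo : scanLo n X ≤ u := by
    by_contra hlt
    have := lt_of_lt_scanLo h (not_le.1 hlt) a b
    omega
  have hhi : u < scanHi n X := by
    by_contra hlt
    have := lt_of_scanHi_le h (not_lt.1 hlt) hu
    omega
  have hmid : X - (topSum n v u + lowSum n v a) = midSum n v b := by omega
  have hne := hd.cover b hb
  obtain ⟨hb', hm⟩ := hd.inv _ hne
  by_cases hbb : d (midSum n v b) - 1 = b
  · refine Or.inl ⟨u - scanLo n X, by omega, a, ha, ?_⟩
    rw [show scanLo n X + (u - scanLo n X) = u by omega, partMask, hmid]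
    exact ⟨hne, by rw [hbb, mask, four_pow_eq]; ring⟩
  · refine Or.inr ⟨_, ⟨_, hb', rfl⟩, _, ⟨b, hb, rfl⟩, fun he => hbb ?_, ?_⟩
    · exact Nat.eq_of_mul_eq_mul_right (by positivity) he
    · have h1 := wsum_mask (n := n) (u := 0) v (a := 0) (by positivity) hb'
      have h2 := wsum_mask (n := n) (u := 0) v (a := 0) (by positivity) hb
      simp only [mask, mul_zero, zero_add, add_zero] at h1 h2
      rw [mul_comm, h1, mul_comm b, h2, hm]

/-- After `n` halvings the ends are `X` and `X + 1`. The number of masks of weight `X` is `below (X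
+ 1) - below X`, which is at least `(X + 2) - X = 2`. -/
theorem collides_searchSet (hn : 0 < n) (hs : ∀ i j, i ≤ j → j < n → v i ≤ v j)
    (hW : ∑ t ∈ Finset.range n, v t < 2 ^ n - 1)
    (hD : 2 ^ n ≤ (weights n v).card + 4 ^ (2 * n / 5)) {d : ℕ → ℕ} (hd : InvTable n v d) :
    Collides n v (searchSet n v d) := by
  have hup : ∀ i < n, v i ≤ 2 ^ i + 4 ^ (2 * n / 5) := fun i hi => weight_upper hs hW hD hi
  have h : NearPow n v (4 ^ (2 * n / 5)) := ⟨hup, fun i hi => weight_lower hup hD hi⟩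
  obtain ⟨h1, h2, h3, h4⟩ := searchIter_spec h hn hW le_rfl
  rw [Nat.sub_self, pow_zero] at h4
  have hX : (searchIter n v n).2 = (searchIter n v n).1 + 1 := by omega
  rw [hX] at h2
  have hset : searchSet n v d = {z | ∃ b < 2 ^ (2 * n / 5), z = b * 2 ^ (2 * n / 5)} ∪
    scanSet n v d (searchIter n v n).1 := rfl
  generalize (searchIter n v n).1 = X at *
  have hsplit : below n v (X + 1) = below n v X +
      ((Finset.range (2 ^ n)).filter fun z => wsum v n z = X).card := by
    rw [below, below, ← Finset.card_union_of_disjoint]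
    · congr 1
      ext z
      simp only [Finset.mem_filter, Finset.mem_union, ← and_or_left, Nat.lt_succ_iff_lt_or_eq]
    · rw [Finset.disjoint_filter]
      intro z _ hz
      omega
  obtain ⟨x, hx, y, hy, hne⟩ := Finset.one_lt_card.1
    (show 1 < ((Finset.range (2 ^ n)).filter fun z => wsum v n z = X).card by omega)
  simp only [Finset.mem_filter, Finset.mem_range] at hx hy
  rw [hset]
  rcases mem_or_collides h hd hx.1 hx.2 with hx' | hc
  · rcases mem_or_collides h hd hy.1 hy.2 with hy' | hc
    · exact ⟨x, Or.inr hx', y, Or.inr hy', hne, hx.2.trans hy.2.symm⟩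
    · exact hc.mono Set.subset_union_left
  · exact hc.mono Set.subset_union_left

end PES

/-! ### Many collisions: the second moment method -/

namespace PES

open scoped BigOperators

/-! ### Averages over samples -/

variable {Y : Type*} [Fintype Y]

theorem expect_fin_succ {m : ℕ} (f : (Fin (m + 1) → Y) → ℝ) :
    𝔼 u, f u = 𝔼 y, 𝔼 u : Fin m → Y, f (Fin.cons y u) := by
  rw [← Finset.expect_product', Finset.univ_product_univ]
  exact (Fintype.expect_equiv (Fin.consEquiv fun _ => Y) _ _ fun _ => rfl).symm

theorem expect_fin_add {m m' : ℕ} (f : (Fin (m + m') → Y) → ℝ) :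
    𝔼 u, f u = 𝔼 u : Fin m → Y, 𝔼 u' : Fin m' → Y, f (Fin.append u u') := by
  rw [← Finset.expect_product', Finset.univ_product_univ]
  exact (Fintype.expect_equiv (Fin.appendEquiv m m') _ _ fun _ => rfl).symm

/-- Cauchy–Schwarz for `Z` and the indicator of `Z ≠ 0`; it bounds the probability of `Z ≠ 0` from
below by `(𝔼 Z)² / 𝔼 Z²`. -/
theorem expect_sq_le_expect_mul {Ω : Type*} [Fintype Ω] (Z : Ω → ℝ) :
    (𝔼 y, Z y) ^ 2 ≤ (𝔼 y, if Z y = 0 then (0 : ℝ) else 1) * 𝔼 y, Z y ^ 2 := by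
  have h := Finset.sum_mul_sq_le_sq_mul_sq Finset.univ (fun y => if Z y = 0 then (0 : ℝ) else 1) Z
  rw [Fintype.expect_eq_sum_div_card, Fintype.expect_eq_sum_div_card,
    Fintype.expect_eq_sum_div_card, div_pow, div_mul_div_comm, sq (Fintype.card Ω : ℝ)]
  refine div_le_div_of_nonneg_right (le_trans (le_of_eq ?_) (h.trans (le_of_eq ?_))) (by positivity)
  · congr 1
    refine Finset.sum_congr rfl fun y _ => ?_
    split_ifs with hz <;> simp [hz]
  · congr 1
    refine Finset.sum_congr rfl fun y _ => ?_
    split_ifs <;> simp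

theorem expect_sum_sample [Nonempty Y] (m : ℕ) (g : Y → ℝ) :
    𝔼 u : Fin m → Y, ∑ i, g (u i) = m * 𝔼 y, g y := by
  induction m with
  | zero => simp
  | succ m ih =>
    rw [expect_fin_succ]
    simp only [Fin.sum_univ_succ, Fin.cons_zero, Fin.cons_succ, Finset.expect_add_distrib,
      Fintype.expect_const, ih]
    push_cast
    ring

/-- Pairs of distinct samples are independent and contribute at most `(m 𝔼 g)²`; the diagonal
contributes `m 𝔼 g²`. -/
theorem expect_sq_sum_sample_le [Nonempty Y] (m : ℕ) (g : Y → ℝ) :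
    𝔼 u : Fin m → Y, (∑ i, g (u i)) ^ 2 ≤ (m * 𝔼 y, g y) ^ 2 + m * 𝔼 y, g y ^ 2 := by
  induction m with
  | zero => simp
  | succ m ih =>
    rw [expect_fin_succ]
    simp only [Fin.sum_univ_succ, Fin.cons_zero, Fin.cons_succ, add_sq,
      Finset.expect_add_distrib, Fintype.expect_const, ← Finset.mul_expect, expect_sum_sample,
      ← Finset.expect_mul]
    push_cast
    nlinarith [sq_nonneg (𝔼 y, g y)]

section Birthday

variable [Nonempty Y] (m : ℕ) (A : Y → Y → ℝ)

/-- The number of pairs of samples that are related. -/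
def hits {m : ℕ} (A : Y → Y → ℝ) (u v : Fin m → Y) : ℝ := ∑ i, ∑ j, A (u i) (v j)

theorem expect_hits : 𝔼 u : Fin m → Y, 𝔼 v : Fin m → Y, hits A u v
    = m ^ 2 * 𝔼 x, 𝔼 y, A x y := by
  have h : ∀ u : Fin m → Y, 𝔼 v : Fin m → Y, hits A u v = ∑ i, m * 𝔼 y, A (u i) y := fun u => by
    unfold hits
    rw [Finset.expect_sum_comm]
    exact Finset.sum_congr rfl fun i _ => expect_sum_sample m (A (u i))
  simp only [h]
  rw [expect_sum_sample m fun x => m * 𝔼 y, A x y, ← Finset.mul_expect]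
  ring

/-- Expand into pairs of related pairs. Those without a common sample give the square of the mean,
those sharing exactly one sample cost a factor `δ` (row or column density), and equal ones give the
mean because `A ≤ 1`. -/
theorem expect_sq_hits_le {δ : ℝ} (h0 : ∀ x y, 0 ≤ A x y) (h1 : ∀ x y, A x y ≤ 1)
    (hr : ∀ x, 𝔼 y, A x y ≤ δ) (hc : ∀ y, 𝔼 x, A x y ≤ δ) :
    𝔼 u : Fin m → Y, 𝔼 v : Fin m → Y, hits A u v ^ 2
      ≤ m ^ 4 * (𝔼 x, 𝔼 y, A x y) ^ 2 + (2 * m ^ 3 * δ + m ^ 2) * 𝔼 x, 𝔼 y, A x y := by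
  have hsq : ∀ g : Y → ℝ, (∀ y, 0 ≤ g y) → (∀ y, g y ≤ δ) → 𝔼 y, g y ^ 2 ≤ δ * 𝔼 y, g y :=
    fun g hg0 hg => by
      rw [Finset.mul_expect]
      refine Finset.expect_le_expect fun y _ => ?_
      rw [sq]
      exact mul_le_mul_of_nonneg_right (hg y) (hg0 y)
  have hx0 : ∀ y, 0 ≤ 𝔼 x, A x y := fun y => Finset.expect_nonneg fun x _ => h0 x y
  have hy0 : ∀ x, 0 ≤ 𝔼 y, A x y := fun x => Finset.expect_nonneg fun y _ => h0 x y
  have hcomm : 𝔼 y, 𝔼 x, A x y = 𝔼 x, 𝔼 y, A x y := Finset.expect_comm _ _ _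
  have hcol := hsq _ hx0 hc
  have hrow := hsq _ hy0 hr
  rw [hcomm] at hcol
  have hone : 𝔼 x, 𝔼 y, A x y ^ 2 ≤ 𝔼 x, 𝔼 y, A x y :=
    Finset.expect_le_expect fun x _ => Finset.expect_le_expect fun y _ => by
      rw [sq]; exact mul_le_of_le_one_left (h0 x y) (h1 x y)
  -- For a fixed second batch the hits are a sum over the first batch, so the one-batch bound
  -- applies; below it is applied again to each resulting term.
  have hinner : ∀ v : Fin m → Y, 𝔼 u : Fin m → Y, hits A u v ^ 2
      ≤ m ^ 2 * (∑ j, 𝔼 x, A x (v j)) ^ 2 + m * 𝔼 x, (∑ j, A x (v j)) ^ 2 := fun v => by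
    refine (expect_sq_sum_sample_le m fun x => ∑ j, A x (v j)).trans_eq ?_
    rw [Finset.expect_sum_comm, mul_pow]
  rw [Finset.expect_comm]
  calc 𝔼 v : Fin m → Y, 𝔼 u : Fin m → Y, hits A u v ^ 2
      ≤ 𝔼 v : Fin m → Y, ((m : ℝ) ^ 2 * (∑ j, 𝔼 x, A x (v j)) ^ 2
          + m * 𝔼 x, (∑ j, A x (v j)) ^ 2) := Finset.expect_le_expect fun v _ => hinner v
    _ = m ^ 2 * 𝔼 v : Fin m → Y, (∑ j, 𝔼 x, A x (v j)) ^ 2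
          + m * 𝔼 x, 𝔼 v : Fin m → Y, (∑ j, A x (v j)) ^ 2 := by
        rw [Finset.expect_add_distrib, ← Finset.mul_expect, ← Finset.mul_expect,
          Finset.expect_comm Finset.univ Finset.univ fun (v : Fin m → Y) x => (∑ j, A x (v j)) ^ 2]
    _ ≤ m ^ 2 * ((m * 𝔼 y, 𝔼 x, A x y) ^ 2 + m * 𝔼 y, (𝔼 x, A x y) ^ 2)
          + m * 𝔼 x, ((m * 𝔼 y, A x y) ^ 2 + m * 𝔼 y, A x y ^ 2) := by
        gcongr with x
        · exact expect_sq_sum_sample_le m fun y => 𝔼 x, A x y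
        · exact expect_sq_sum_sample_le m fun y => A x y
    _ = m ^ 4 * (𝔼 x, 𝔼 y, A x y) ^ 2 + m ^ 3 * (𝔼 y, (𝔼 x, A x y) ^ 2)
          + m ^ 3 * (𝔼 x, (𝔼 y, A x y) ^ 2) + m ^ 2 * 𝔼 x, 𝔼 y, A x y ^ 2 := by
        simp only [mul_pow, Finset.expect_add_distrib, ← Finset.mul_expect, hcomm]
        ring
    _ ≤ m ^ 4 * (𝔼 x, 𝔼 y, A x y) ^ 2 + m ^ 3 * (δ * 𝔼 x, 𝔼 y, A x y)
          + m ^ 3 * (δ * 𝔼 x, 𝔼 y, A x y) + m ^ 2 * 𝔼 x, 𝔼 y, A x y := by gcongr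
    _ = _ := by ring

end Birthday

end PES

namespace PES

variable {n : ℕ} {v : ℕ → ℕ}

/-! ### Primes -/

/-- Chebyshev's lower bound yields `2 ^ a ≤ π(2 ^ a) * a + (a + 1)`. For `a ≥ 3` the last term is at
most half of the left side. -/
theorem two_pow_le_mul_card_primes {a : ℕ} (ha : 1 ≤ a) :
    2 ^ a ≤ 2 * a * ((Finset.range (2 ^ a + 1)).filter Nat.Prime).card := by
  rw [← Nat.primesBelow, Nat.primesBelow_card_eq_primeCounting', ← Nat.primeCounting]
  rcases (show a = 1 ∨ a = 2 ∨ 3 ≤ a by omega) with rfl | rfl | ha3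
  · decide
  · decide
  have h := Chebyshev.pi_ge (2 ^ a)
  have hlog : 0 < Real.log 2 := Real.log_pos (by norm_num)
  have hup : Real.log ((2 ^ a : ℕ) + 1) ≤ (a + 1) * Real.log 2 := by
    have : ((2 ^ a : ℕ) + 1 : ℝ) ≤ 2 ^ (a + 1) := by
      push_cast
      rw [pow_succ]
      linarith [one_le_pow₀ (M₀ := ℝ) (a := 2) (n := a) (by norm_num)]
    refine (Real.log_le_log (by positivity) this).trans_eq ?_
    rw [Real.log_pow]
    push_cast
    ring
  have ha0 : (0 : ℝ) < a := by exact_mod_cast ha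
  rw [show Real.log ((2 ^ a : ℕ) : ℝ) = a * Real.log 2 by push_cast; rw [Real.log_pow],
    div_le_iff₀ (by positivity)] at h
  have h2 : (2 ^ a : ℝ) ≤ Nat.primeCounting (2 ^ a) * a + (a + 1) := by
    have h3 : (2 ^ a : ℝ) * Real.log 2
        ≤ (Nat.primeCounting (2 ^ a) * a + (a + 1)) * Real.log 2 := by
      push_cast at h hup
      linarith
    exact le_of_mul_le_mul_right h3 hlog
  have h4 : 2 ^ a ≤ Nat.primeCounting (2 ^ a) * a + (a + 1) := by exact_mod_cast h2
  have h5 : 2 * a + 2 ≤ 2 ^ a := by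
    clear * - ha3
    induction a, ha3 using Nat.le_induction with
    | base => norm_num
    | succ a _ ih => rw [pow_succ]; omega
  nlinarith

/-- The product of the distinct prime divisors, each at least `2`, divides `d < 2 ^ n`. Consequently
different numbers below `2 ^ n` are congruent modulo at most `n` primes. -/
theorem card_primes_dvd_le {P : Finset ℕ} (hP : ∀ p ∈ P, p.Prime) {d : ℕ} (hd : 0 < d)
    (hdn : d < 2 ^ n) : (P.filter (· ∣ d)).card ≤ n := by
  have h1 : P.filter (· ∣ d) ⊆ d.primeFactors := fun p hp => by
    rw [Finset.mem_filter] at hp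
    exact Nat.mem_primeFactors.2 ⟨hP p hp.1, hp.2, hd.ne'⟩
  have h2 : 2 ^ d.primeFactors.card ≤ ∏ p ∈ d.primeFactors, p :=
    Finset.pow_card_le_prod _ _ _ fun p hp => (Nat.prime_of_mem_primeFactors hp).two_le
  have h3 := Nat.le_of_dvd hd (Nat.prod_primeFactors_dvd d)
  exact (Finset.card_le_card h1).trans
    ((Nat.pow_lt_pow_iff_right (by norm_num)).1 ((h2.trans h3).trans_lt hdn)).le

theorem card_primes_modEq_le {P : Finset ℕ} (hP : ∀ p ∈ P, p.Prime) {x y : ℕ} (hx : x < 2 ^ n)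
    (hy : y < 2 ^ n) :
    (P.filter fun p => x % p = y % p).card ≤ (if x = y then P.card else 0) + n := by
  split_ifs with h
  · exact (Finset.card_filter_le _ _).trans (Nat.le_add_right _ _)
  · rw [zero_add]
    rcases Nat.lt_or_gt_of_ne h with hlt | hlt
    · refine le_trans (Finset.card_le_card fun p hp => ?_)
        (card_primes_dvd_le hP (d := y - x) (by omega) (by omega))
      rw [Finset.mem_filter] at hp ⊢
      exact ⟨hp.1, (Nat.modEq_iff_dvd' hlt.le).1 hp.2⟩
    · refine le_trans (Finset.card_le_card fun p hp => ?_)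
        (card_primes_dvd_le hP (d := x - y) (by omega) (by omega))
      rw [Finset.mem_filter] at hp ⊢
      exact ⟨hp.1, (Nat.modEq_iff_dvd' hlt.le).1 hp.2.symm⟩

/-! ### Collisions modulo a random prime -/

/-- The masks of weight `t`. -/
def fibre (n : ℕ) (v : ℕ → ℕ) (t : ℕ) : Finset ℕ :=
  (Finset.range (2 ^ n)).filter fun z => wsum v n z = t

/-- The targets in a residue class that is not too large. -/
def goodTargets (n : ℕ) (v : ℕ → ℕ) (T : Finset ℕ) (M p r : ℕ) : Finset ℕ :=
  T.filter fun t => t % p = r ∧ resCount v p n r ≤ M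

theorem sum_card_goodTargets (n : ℕ) (v : ℕ → ℕ) (T : Finset ℕ) (M : ℕ) {p : ℕ} (hp : 0 < p) :
    ∑ r ∈ Finset.range p, (goodTargets n v T M p r).card
      = (T.filter fun t => resCount v p n (t % p) ≤ M).card := by
  rw [Finset.card_eq_sum_card_fiberwise (f := fun t => t % p) (t := Finset.range p)
    fun t _ => Finset.mem_coe.2 (Finset.mem_range.2 (Nat.mod_lt _ hp))]
  refine Finset.sum_congr rfl fun r _ => ?_
  rw [goodTargets, Finset.filter_filter]
  congr 1
  ext t
  simp only [Finset.mem_filter]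
  constructor
  · rintro ⟨h, rfl, h2⟩
    exact ⟨h, h2, rfl⟩
  · rintro ⟨h, h2, rfl⟩
    exact ⟨h, rfl, h2⟩

/-- Masks of weight exactly `t` fall into the class of `t` for every prime; any other mask does so
for at most `n` primes. -/
theorem sum_resCount_le (hv : ∑ t ∈ Finset.range n, v t < 2 ^ n) {P : Finset ℕ}
    (hP : ∀ p ∈ P, p.Prime) {t : ℕ} (ht : t < 2 ^ n) :
    ∑ p ∈ P, resCount v p n (t % p) ≤ (fibre n v t).card * P.card + n * 2 ^ n := by
  simp only [resCount, Finset.card_filter]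
  rw [Finset.sum_comm]
  calc ∑ z ∈ Finset.range (2 ^ n), ∑ p ∈ P, (if wsum v n z % p = t % p then 1 else 0)
      ≤ ∑ z ∈ Finset.range (2 ^ n), ((if wsum v n z = t then P.card else 0) + n) := by
        refine Finset.sum_le_sum fun z _ => ?_
        rw [← Finset.card_filter]
        exact card_primes_modEq_le hP ((wsum_le v n z).trans_lt hv) ht
    _ = _ := by
        rw [Finset.sum_add_distrib, ← Finset.sum_filter, Finset.sum_const, Finset.sum_const,
          Finset.card_range, smul_eq_mul, smul_eq_mul, fibre]
        ring

/-- Markov's inequality: for each target, the average class size over the primes is at most `M / 2`,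
so at least half of the primes give a class of size at most `M`. -/
theorem card_mul_card_le_sum_goodTargets (hv : ∑ t ∈ Finset.range n, v t < 2 ^ n) {P T : Finset ℕ}
    (hP : ∀ p ∈ P, p.Prime) (hT : ∀ t ∈ T, t < 2 ^ n) {M f : ℕ}
    (hf : ∀ t ∈ T, (fibre n v t).card ≤ f) (hM0 : 0 < M)
    (hM : 2 * (f * P.card + n * 2 ^ n) ≤ M * P.card) :
    P.card * T.card ≤ 2 * ∑ p ∈ P, ∑ r ∈ Finset.range p, (goodTargets n v T M p r).card := by
  rw [Finset.sum_congr rfl fun p hp => sum_card_goodTargets n v T M (hP p hp).pos]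
  simp only [Finset.card_filter]
  rw [Finset.sum_comm, Finset.mul_sum, mul_comm, ← smul_eq_mul, ← Finset.sum_const]
  refine Finset.sum_le_sum fun t ht => ?_
  rw [← Finset.card_filter]
  have hsplit := Finset.card_filter_add_card_filter_not (s := P)
    (fun p => resCount v p n (t % p) ≤ M)
  have hbad : M * (P.filter fun p => ¬ resCount v p n (t % p) ≤ M).card
      ≤ ∑ p ∈ P, resCount v p n (t % p) := by
    rw [mul_comm, ← smul_eq_mul, ← Finset.sum_const]
    refine (Finset.sum_le_sum fun p hp => ?_).trans
      (Finset.sum_le_sum_of_subset (Finset.filter_subset (fun p => ¬ resCount v p n (t % p) ≤ M) P))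
    exact (not_le.1 (Finset.mem_filter.1 hp).2).le
  have h1 := sum_resCount_le hv hP (hT t ht)
  have h2 := Nat.mul_le_mul_right P.card (hf t ht)
  have h3 : 2 * (P.filter fun p => ¬ resCount v p n (t % p) ≤ M).card ≤ P.card := by
    refine Nat.le_of_mul_le_mul_left ?_ hM0
    linarith
  omega

/-- The squares count pairs of targets in a common class, and two different targets are congruent
modulo at most `n` primes. -/
theorem sum_sq_card_goodTargets_le {P T : Finset ℕ} (hP : ∀ p ∈ P, p.Prime)
    (hT : ∀ t ∈ T, t < 2 ^ n) (M : ℕ) :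
    ∑ p ∈ P, ∑ r ∈ Finset.range p, (goodTargets n v T M p r).card ^ 2
      ≤ P.card * T.card + n * T.card ^ 2 := by
  have h1 : ∀ p ∈ P, ∑ r ∈ Finset.range p, (goodTargets n v T M p r).card ^ 2
      ≤ ∑ x ∈ T ×ˢ T, if x.1 % p = x.2 % p then 1 else 0 := fun p hp => by
    rw [← Finset.card_filter, Finset.card_eq_sum_card_fiberwise (f := fun x => x.1 % p)
      (t := Finset.range p)
      fun t _ => Finset.mem_coe.2 (Finset.mem_range.2 (Nat.mod_lt _ (hP p hp).pos))]
    refine Finset.sum_le_sum fun r _ => ?_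
    rw [sq, ← Finset.card_product]
    refine Finset.card_le_card fun x hx => ?_
    simp only [goodTargets, Finset.mem_product, Finset.mem_filter] at hx ⊢
    exact ⟨⟨⟨hx.1.1, hx.2.1⟩, hx.1.2.1.trans hx.2.2.1.symm⟩, hx.1.2.1⟩
  refine (Finset.sum_le_sum h1).trans ?_
  rw [Finset.sum_comm]
  have h2 : ∀ x ∈ T ×ˢ T, (∑ p ∈ P, if x.1 % p = x.2 % p then 1 else 0)
      ≤ (if x.1 = x.2 then P.card else 0) + n := fun x hx => by
    rw [← Finset.card_filter]
    rw [Finset.mem_product] at hx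
    exact card_primes_modEq_le hP (hT _ hx.1) (hT _ hx.2)
  refine (Finset.sum_le_sum h2).trans_eq ?_
  rw [Finset.sum_add_distrib, Finset.sum_const, Finset.card_product, Finset.sum_product]
  simp only [Finset.sum_ite_eq]
  rw [Finset.sum_ite_mem, Finset.inter_self, Finset.sum_const, smul_eq_mul, smul_eq_mul]
  ring

/-! ### A level with many collisions -/

theorem sum_card_fibre {T : Finset ℕ} : ∑ t ∈ T, (fibre n v t).card ≤ 2 ^ n := by
  rw [← Finset.card_biUnion]
  · refine (Finset.card_le_card (t := Finset.range (2 ^ n)) ?_).trans_eq (Finset.card_range _)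
    exact Finset.biUnion_subset.2 fun t _ => Finset.filter_subset _ _
  · intro t _ t' _ htt
    rw [Function.onFun, fibre, fibre, Finset.disjoint_filter]
    rintro z _ rfl
    exact htt

/-- Dyadic pigeonhole: the excess `∑ (c t - 1) = 2 ^ n - N` over the fibre sizes `c t` exceeds `D`,
and one of the `n` levels `⌊log₂ (c t)⌋ = l + 1` carries at least the fraction `1 / n` of it. -/
theorem exists_level (hn : 0 < n) {D : ℕ} (hD : (weights n v).card + D < 2 ^ n) :
    ∃ (l : ℕ) (T : Finset ℕ), T ⊆ weights n v ∧
      (∀ t ∈ T, 2 * 2 ^ l ≤ (fibre n v t).card ∧ (fibre n v t).card ≤ 4 * 2 ^ l) ∧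
      D ≤ 4 * n * 2 ^ l * T.card ∧ 2 * 2 ^ l * T.card ≤ 2 ^ n := by
  set W := weights n v with hW
  set c : ℕ → ℕ := fun t => (fibre n v t).card with hc
  have htotal : ∑ t ∈ W, c t = 2 ^ n := by
    have h := Finset.card_eq_sum_card_image (wsum v n) (Finset.range (2 ^ n))
    rw [Finset.card_range] at h
    exact h.symm
  have hpos : ∀ t ∈ W, 1 ≤ c t := fun t ht => by
    obtain ⟨z, hz, rfl⟩ := Finset.mem_image.1 ht
    exact Finset.card_pos.2 ⟨z, Finset.mem_filter.2 ⟨hz, rfl⟩⟩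
  have hle : ∀ t ∈ W, c t ≤ 2 ^ n := fun t ht => by
    rw [← htotal]; exact Finset.single_le_sum (fun _ _ => Nat.zero_le _) ht
  have hexcess : D < ∑ t ∈ W, (c t - 1) := by
    have : ∑ t ∈ W, (c t - 1) + W.card = 2 ^ n := by
      rw [← htotal, Finset.card_eq_sum_ones, ← Finset.sum_add_distrib]
      exact Finset.sum_congr rfl fun t ht => Nat.sub_add_cancel (hpos t ht)
    omega
  have hlog : ∀ t ∈ W, Nat.log 2 (c t) ∈ Finset.range (n + 1) := fun t ht => by
    rw [Finset.mem_range, Nat.lt_succ_iff]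
    exact (Nat.log_mono_right (hle t ht)).trans_eq (Nat.log_pow (by norm_num) n)
  rw [← Finset.sum_fiberwise_of_maps_to hlog, Finset.sum_range_succ'] at hexcess
  -- Level zero consists of fibres of size one, which have no excess.
  rw [Finset.sum_eq_zero (s := W.filter fun t => Nat.log 2 (c t) = 0), add_zero] at hexcess
  swap
  · intro t ht
    rw [Finset.mem_filter, Nat.log_eq_zero_iff] at ht
    have := hpos t ht.1
    omega
  obtain ⟨l, -, hl⟩ : ∃ l ∈ Finset.range n,
      D ≤ n * ∑ t ∈ W.filter (fun t => Nat.log 2 (c t) = l + 1), (c t - 1) := by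
    by_contra hcon
    push Not at hcon
    have h1 := Finset.sum_lt_sum_of_nonempty (Finset.nonempty_range_iff.2 hn.ne') hcon
    rw [← Finset.mul_sum, Finset.sum_const, Finset.card_range, smul_eq_mul] at h1
    exact absurd (lt_of_mul_lt_mul_left h1 (Nat.zero_le n)) (by omega)
  have hfib : ∀ t ∈ W.filter (fun t => Nat.log 2 (c t) = l + 1), 2 * 2 ^ l ≤ c t ∧ c t ≤ 4 * 2 ^ l :=
    fun t ht => by
      rw [Finset.mem_filter] at ht
      have h1 := Nat.pow_log_le_self 2 (x := c t) (by have := hpos t ht.1; omega)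
      have h2 := Nat.lt_pow_succ_log_self (b := 2) (by norm_num) (c t)
      rw [ht.2] at h1 h2
      rw [Nat.succ_eq_add_one, pow_succ, pow_succ] at h2
      rw [pow_succ] at h1
      omega
  refine ⟨l, W.filter fun t => Nat.log 2 (c t) = l + 1, Finset.filter_subset _ _, hfib, ?_, ?_⟩
  · refine hl.trans ?_
    have : ∑ t ∈ W.filter (fun t => Nat.log 2 (c t) = l + 1), (c t - 1)
        ≤ (W.filter fun t => Nat.log 2 (c t) = l + 1).card * (4 * 2 ^ l) := by
      rw [← smul_eq_mul, ← Finset.sum_const]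
      exact Finset.sum_le_sum fun t ht => (Nat.sub_le _ _).trans (hfib t ht).2
    calc _ ≤ n * _ := Nat.mul_le_mul_left n this
      _ = _ := by ring
  · refine le_trans ?_ (sum_card_fibre (n := n) (v := v)
      (T := W.filter fun t => Nat.log 2 (c t) = l + 1))
    rw [mul_comm, ← smul_eq_mul, ← Finset.sum_const]
    exact Finset.sum_le_sum fun t ht => (hfib t ht).1

end PES

namespace PES

open scoped BigOperators

variable {n : ℕ} {v : ℕ → ℕ} {Y : Type*} [Fintype Y]

/-! ### One trial -/

/-- The values of `num` are uniformly distributed on the numbers with `B` bits. -/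
def UniformBits (B : ℕ) (num : Y → ℕ) : Prop :=
  ∀ h : ℕ → ℝ, 𝔼 y, h (num y) = (∑ x ∈ Finset.range (2 ^ B), h x) / 2 ^ B

theorem UniformBits.expect_mod {B : ℕ} {num : Y → ℕ} (hu : UniformBits B num) {b : ℕ} (hb : b ≤ B)
    (h : ℕ → ℝ) : 𝔼 y, h (num y % 2 ^ b) = (∑ x ∈ Finset.range (2 ^ b), h x) / 2 ^ b := by
  rw [hu fun x => h (x % 2 ^ b)]
  obtain ⟨c, rfl⟩ := Nat.exists_eq_add_of_le hb
  have : ∑ x ∈ Finset.range (2 ^ (b + c)), h (x % 2 ^ b)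
      = 2 ^ c * ∑ x ∈ Finset.range (2 ^ b), h x := by
    rw [pow_add, sum_range_mul]
    have : ∀ y ∈ Finset.range (2 ^ c), ∑ x ∈ Finset.range (2 ^ b), h ((x + 2 ^ b * y) % 2 ^ b)
        = ∑ x ∈ Finset.range (2 ^ b), h x := fun y _ =>
      Finset.sum_congr rfl fun x hx => by
        rw [Nat.add_mul_mod_self_left, Nat.mod_eq_of_lt (Finset.mem_range.1 hx)]
    rw [Finset.sum_congr rfl this, Finset.sum_const, Finset.card_range, nsmul_eq_mul]
    push_cast
    rfl
  rw [this, pow_add, mul_comm ((2 : ℝ) ^ b), mul_div_mul_left _ _ (by positivity)]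

theorem UniformBits.expect_mem {B : ℕ} {num : Y → ℕ} (hu : UniformBits B num) {b : ℕ} (hb : b ≤ B)
    {S : Finset ℕ} (hS : S ⊆ Finset.range (2 ^ b)) :
    𝔼 y, (if num y % 2 ^ b ∈ S then (1 : ℝ) else 0) = S.card / 2 ^ b := by
  rw [hu.expect_mod hb fun x => if x ∈ S then (1 : ℝ) else 0, Finset.sum_ite_mem,
    Finset.inter_eq_right.2 hS, Finset.sum_const, nsmul_eq_mul, mul_one]

theorem exists_disjoint_halves {S : Finset ℕ} {m : ℕ} (h : 2 * m ≤ S.card) :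
    ∃ L R : Finset ℕ, L ⊆ S ∧ R ⊆ S ∧ L.card = m ∧ R.card = m ∧ Disjoint L R := by
  obtain ⟨L, hL, hLm⟩ := Finset.exists_subset_card_eq (s := S) (n := m) (by omega)
  obtain ⟨R, hR, hRm⟩ := Finset.exists_subset_card_eq (s := S \ L) (n := m)
    (by rw [Finset.card_sdiff_of_subset hL]; omega)
  exact ⟨L, R, hL, hR.trans Finset.sdiff_subset, hLm, hRm,
    Finset.disjoint_sdiff.mono_right hR⟩

/-- A relation between samples whose related pairs are collisions, with known averages. -/
theorem exists_relation {B : ℕ} {num : Y → ℕ} (hu : UniformBits B num) {b : ℕ} (hb : b ≤ B)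
    {p r m : ℕ} (hr : r < p) {S : Finset ℕ}
    (hS : ∀ t ∈ S, t % p = r ∧ resCount v p n r ≤ 2 ^ b ∧ 2 * m ≤ (fibre n v t).card) :
    ∃ A : Y → Y → ℝ, (∀ x y, 0 ≤ A x y) ∧ (∀ x y, A x y ≤ 1) ∧
      (∀ x, 𝔼 y, A x y ≤ m / 2 ^ b) ∧ (∀ y, 𝔼 x, A x y ≤ m / 2 ^ b) ∧
      𝔼 x, 𝔼 y, A x y = S.card * (m / 2 ^ b) ^ 2 ∧
      ∀ x y, A x y ≠ 0 → unrank v p n r (num x % 2 ^ b) ≠ unrank v p n r (num y % 2 ^ b) ∧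
        wsum v n (unrank v p n r (num x % 2 ^ b)) = wsum v n (unrank v p n r (num y % 2 ^ b)) := by
  have hp : 0 < p := by omega
  -- Choose an index `rk z` for every mask of the residue class; it is below `2 ^ b` when the class
  -- is not too large.
  have hrank : ∀ z, ∃ u, z < 2 ^ n → wsum v n z % p = r →
      u < resCount v p n r ∧ unrank v p n r u = z := fun z => by
    by_cases h : z < 2 ^ n ∧ wsum v n z % p = r
    · obtain ⟨u, hu⟩ := exists_unrank v hp n hr h.1 h.2
      exact ⟨u, fun _ _ => hu⟩
    · exact ⟨0, fun h1 h2 => absurd ⟨h1, h2⟩ h⟩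
  choose rk hrk using hrank
  -- Two samples are related when, for some target `t`, the first yields a mask of `L t` and the
  -- second a mask of `R t`. Disjointness of the halves guarantees different masks, and makes the
  -- relation a sum of product indicators with an exact mean.
  have hhalf : ∀ t, ∃ L R : Finset ℕ, t ∈ S →
      L ⊆ fibre n v t ∧ R ⊆ fibre n v t ∧ L.card = m ∧ R.card = m ∧ Disjoint L R := fun t => by
    by_cases h : t ∈ S
    · obtain ⟨L, R, h⟩ := exists_disjoint_halves (hS t h).2.2
      exact ⟨L, R, fun _ => h⟩
    · exact ⟨∅, ∅, fun h' => absurd h' h⟩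
  choose L R hLR using hhalf
  have hfib : ∀ t ∈ S, ∀ z ∈ fibre n v t, rk z < 2 ^ b ∧ unrank v p n r (rk z) = z ∧
      wsum v n z = t := fun t ht z hz => by
    rw [fibre, Finset.mem_filter, Finset.mem_range] at hz
    have := hrk z hz.1 (by rw [hz.2]; exact (hS t ht).1)
    exact ⟨this.1.trans_le (hS t ht).2.1, this.2, hz.2⟩
  have hprop : ∀ t ∈ S, ∀ Q ⊆ fibre n v t, Q.image rk ⊆ Finset.range (2 ^ b) ∧
      (Q.image rk).card = Q.card ∧
      ∀ x ∈ Q.image rk, unrank v p n r x ∈ Q ∧ wsum v n (unrank v p n r x) = t :=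
    fun t ht Q hQ => by
      refine ⟨fun x hx => ?_, ?_, fun x hx => ?_⟩
      · obtain ⟨z, hz, rfl⟩ := Finset.mem_image.1 hx
        exact Finset.mem_range.2 (hfib t ht z (hQ hz)).1
      · refine Finset.card_image_of_injOn fun z hz z' hz' h => ?_
        rw [← (hfib t ht z (hQ hz)).2.1, h, (hfib t ht z' (hQ hz')).2.1]
      · obtain ⟨z, hz, rfl⟩ := Finset.mem_image.1 hx
        rw [(hfib t ht z (hQ hz)).2.1]
        exact ⟨hz, (hfib t ht z (hQ hz)).2.2⟩
  have hPL := fun t ht => hprop t ht (L t) (hLR t ht).1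
  have hPR := fun t ht => hprop t ht (R t) (hLR t ht).2.1
  -- An index determines its mask and hence its target, so the row and column densities do not add
  -- up over the targets.
  have hind : ∀ (P : ℕ → Finset ℕ), (∀ t ∈ S, ∀ x ∈ P t, wsum v n (unrank v p n r x) = t) →
      ∀ x, ∑ t ∈ S, (if x ∈ P t then (1 : ℝ) else 0) ≤ 1 := fun P hP x => by
    rw [← Finset.sum_filter, Finset.sum_const, nsmul_eq_mul, mul_one]
    norm_cast
    refine Finset.card_le_one.2 fun t ht t' ht' => ?_
    rw [Finset.mem_filter] at ht ht'
    rw [← hP t ht.1 x ht.2, hP t' ht'.1 x ht'.2]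
  have hindL := hind (fun t => (L t).image rk) fun t ht x hx => ((hPL t ht).2.2 x hx).2
  have hindR := hind (fun t => (R t).image rk) fun t ht x hx => ((hPR t ht).2.2 x hx).2
  have hEL : ∀ t ∈ S, 𝔼 y, (if num y % 2 ^ b ∈ (L t).image rk then (1 : ℝ) else 0) = m / 2 ^ b :=
    fun t ht => by rw [hu.expect_mem hb (hPL t ht).1, (hPL t ht).2.1, (hLR t ht).2.2.1]
  have hER : ∀ t ∈ S, 𝔼 y, (if num y % 2 ^ b ∈ (R t).image rk then (1 : ℝ) else 0) = m / 2 ^ b :=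
    fun t ht => by rw [hu.expect_mem hb (hPR t ht).1, (hPR t ht).2.1, (hLR t ht).2.2.2.1]
  have hrow : ∀ x, 𝔼 y, ∑ t ∈ S, (if num x % 2 ^ b ∈ (L t).image rk then (1 : ℝ) else 0) *
      (if num y % 2 ^ b ∈ (R t).image rk then 1 else 0)
      = (∑ t ∈ S, (if num x % 2 ^ b ∈ (L t).image rk then (1 : ℝ) else 0)) * (m / 2 ^ b) :=
    fun x => by
      rw [Finset.expect_sum_comm, Finset.sum_mul]
      exact Finset.sum_congr rfl fun t ht => by rw [← Finset.mul_expect, hER t ht]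
  have hcol : ∀ y, 𝔼 x, ∑ t ∈ S, (if num x % 2 ^ b ∈ (L t).image rk then (1 : ℝ) else 0) *
      (if num y % 2 ^ b ∈ (R t).image rk then 1 else 0)
      = (m / 2 ^ b) * ∑ t ∈ S, (if num y % 2 ^ b ∈ (R t).image rk then (1 : ℝ) else 0) :=
    fun y => by
      rw [Finset.expect_sum_comm, Finset.mul_sum]
      exact Finset.sum_congr rfl fun t ht => by rw [← Finset.expect_mul, hEL t ht]
  refine ⟨fun x y => ∑ t ∈ S, (if num x % 2 ^ b ∈ (L t).image rk then 1 else 0) *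
    (if num y % 2 ^ b ∈ (R t).image rk then 1 else 0), fun x y => ?_, fun x y => ?_, fun x => ?_,
    fun y => ?_, ?_, fun x y h => ?_⟩
  · exact Finset.sum_nonneg fun t _ => by positivity
  · refine (Finset.sum_le_sum fun t _ => ?_).trans (hindL (num x % 2 ^ b))
    split_ifs <;> norm_num
  · rw [hrow]
    exact mul_le_of_le_one_left (by positivity) (hindL _)
  · rw [hcol]
    exact mul_le_of_le_one_right (by positivity) (hindR _)
  · simp only [hrow]
    rw [← Finset.expect_mul, Finset.expect_sum_comm, Finset.sum_congr rfl hEL, Finset.sum_const,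
      nsmul_eq_mul]
    ring
  · obtain ⟨t, ht, hne⟩ := Finset.exists_ne_zero_of_sum_ne_zero h
    have hx : num x % 2 ^ b ∈ (L t).image rk := by
      by_contra hx
      simp [hx] at hne
    have hy : num y % 2 ^ b ∈ (R t).image rk := by
      by_contra hy
      simp [hy] at hne
    have h1 := (hPL t ht).2.2 _ hx
    have h2 := (hPR t ht).2.2 _ hy
    exact ⟨fun he => Finset.disjoint_left.1 (hLR t ht).2.2.2.2 h1.1 (he ▸ h2.1),
      h1.2.trans h2.2.symm⟩

/-- A trial with the given random numbers finds a collision. -/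
def Hit (n : ℕ) (v : ℕ → ℕ) (a b f f' : ℕ) {m : ℕ} (g g' : Fin m → ℕ) : Prop :=
  ∃ i j, unrank v (1 + f % 2 ^ a) n (f' % 2 ^ a % (1 + f % 2 ^ a)) (g i % 2 ^ b)
      ≠ unrank v (1 + f % 2 ^ a) n (f' % 2 ^ a % (1 + f % 2 ^ a)) (g' j % 2 ^ b) ∧
    wsum v n (unrank v (1 + f % 2 ^ a) n (f' % 2 ^ a % (1 + f % 2 ^ a)) (g i % 2 ^ b))
      = wsum v n (unrank v (1 + f % 2 ^ a) n (f' % 2 ^ a % (1 + f % 2 ^ a)) (g' j % 2 ^ b))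

/-- In the application `m = 2 ^ k` is the size of a batch, `l` half a fibre, `M` the index range,
`R` the range of moduli, `t = |T|`, `S` and `S'` the first two moments of the number of good
targets, `c = 2 ^ n`, and `K` the polynomial slack in `M R = c K`. The three summands correspond to
the kinds of pairs in `expect_sq_hits_le`; `h4` and `h5` say that the batches are large enough. -/
theorem second_moment_bound {m l M R t S S' K c : ℕ} (h1 : R * t ≤ 4 * n * S) (h2 : R ≤ 4 * n * t)
    (h3 : S' ≤ 2 * S + n * t ^ 2) (hM : M * R = c * K) (h4 : c ≤ 32 * n * (m * l * t))
    (h5 : c ^ 2 ≤ 64 * n * (R * m ^ 2 * l ^ 2 * t)) :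
    m ^ 2 * l ^ 2 * S' * R ^ 2 + 2 * m * l * S * M * R ^ 2 + S * M ^ 2 * R ^ 2
      ≤ (256 * n ^ 2 * K ^ 2 + 256 * n ^ 2 * K + 32 * n ^ 2 + 16 * n ^ 3) *
        (m ^ 2 * l ^ 2 * S ^ 2) := by
  have e1 : R ^ 2 ≤ 16 * n ^ 2 * S := by
    calc R ^ 2 ≤ R * (4 * n * t) := by rw [sq]; gcongr
      _ = 4 * n * (R * t) := by ring
      _ ≤ 4 * n * (4 * n * S) := by gcongr
      _ = _ := by ring
  have e2 : m ^ 2 * l ^ 2 * S' * R ^ 2 ≤ (32 * n ^ 2 + 16 * n ^ 3) * (m ^ 2 * l ^ 2 * S ^ 2) := by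
    calc m ^ 2 * l ^ 2 * S' * R ^ 2 ≤ m ^ 2 * l ^ 2 * (2 * S + n * t ^ 2) * R ^ 2 := by gcongr
      _ = m ^ 2 * l ^ 2 * (2 * S * R ^ 2 + n * (R * t) ^ 2) := by ring
      _ ≤ m ^ 2 * l ^ 2 * (2 * S * (16 * n ^ 2 * S) + n * (4 * n * S) ^ 2) := by gcongr
      _ = _ := by ring
  have e3 : 2 * m * l * S * M * R ^ 2 ≤ 256 * n ^ 2 * K * (m ^ 2 * l ^ 2 * S ^ 2) := by
    calc 2 * m * l * S * M * R ^ 2 = 2 * m * l * S * R * K * c := by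
          rw [show 2 * m * l * S * M * R ^ 2 = 2 * m * l * S * R * (M * R) by ring, hM]; ring
      _ ≤ 2 * m * l * S * R * K * (32 * n * (m * l * t)) := by gcongr
      _ = 64 * n * m ^ 2 * l ^ 2 * S * K * (R * t) := by ring
      _ ≤ 64 * n * m ^ 2 * l ^ 2 * S * K * (4 * n * S) := by gcongr
      _ = _ := by ring
  have e4 : S * M ^ 2 * R ^ 2 ≤ 256 * n ^ 2 * K ^ 2 * (m ^ 2 * l ^ 2 * S ^ 2) := by
    calc S * M ^ 2 * R ^ 2 = S * K ^ 2 * c ^ 2 := by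
          rw [show S * M ^ 2 * R ^ 2 = S * (M * R) ^ 2 by ring, hM]; ring
      _ ≤ S * K ^ 2 * (64 * n * (R * m ^ 2 * l ^ 2 * t)) := by gcongr
      _ = 64 * n * m ^ 2 * l ^ 2 * S * K ^ 2 * (R * t) := by ring
      _ ≤ 64 * n * m ^ 2 * l ^ 2 * S * K ^ 2 * (4 * n * S) := by gcongr
      _ = _ := by ring
  calc _ ≤ _ := Nat.add_le_add (Nat.add_le_add e2 e3) e4
    _ = _ := by ring

/-- Modulus and residue are both drawn from ranges of size `R`. Only draws with a prime modulus and
a residue already less than it enter the analysis; each such pair arises exactly once. -/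
theorem sum_range_prime_residues {R : ℕ} {P : Finset ℕ} (hP : ∀ p ∈ P, 0 < p ∧ p ≤ R)
    (φ : ℕ → ℕ → ℝ) :
    ∑ x ∈ Finset.range R, ∑ y ∈ Finset.range R, (if 1 + x ∈ P ∧ y < 1 + x then φ (1 + x) y else 0)
      = ∑ p ∈ P, ∑ r ∈ Finset.range p, φ p r := by
  have h1 := Finset.sum_Ico_add (fun p => ∑ y ∈ Finset.range R,
    if p ∈ P ∧ y < p then φ p y else 0) 0 R 1
  rw [← Finset.range_eq_Ico] at h1
  rw [h1, ← Finset.sum_subset (s₁ := P)]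
  · refine Finset.sum_congr rfl fun p hp => ?_
    rw [← Finset.sum_subset (Finset.range_mono (hP p hp).2)]
    · exact Finset.sum_congr rfl fun r hr => by simp [hp, Finset.mem_range.1 hr]
    · intro r _ hr
      rw [Finset.mem_range] at hr
      simp [hr]
  · intro p hp
    have := hP p hp
    rw [Finset.mem_Ico]
    omega
  · intro p _ hp
    exact Finset.sum_eq_zero fun r _ => by simp [hp]

end PES

/-! ### One trial succeeds with inverse polynomial probability -/

namespace PES

open scoped BigOperators

variable {n : ℕ} {v : ℕ → ℕ} {Y : Type*} [Fintype Y]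

open Classical in
-- The second moment method is applied to the number `Z` of related pairs over the joint randomness
-- of modulus, residue and both batches, with the relation taken to be empty for useless moduli and
-- residues. Averaging over modulus and residue inside the method matters, since a single class may
-- contain no good target.
theorem one_le_mul_expect_hit_of_moments [Nonempty Y] {B : ℕ} {num : Y → ℕ}
    (hu : UniformBits B num) {a b l m q : ℕ} (ha : a ≤ B) (hb : b ≤ B) (hm : 0 < m) (hl : 0 < l)
    {P T : Finset ℕ} (hP : ∀ p ∈ P, 0 < p ∧ p ≤ 2 ^ a)
    (hT : ∀ t ∈ T, 2 * l ≤ (fibre n v t).card)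
    (hS : 0 < ∑ p ∈ P, ∑ r ∈ Finset.range p, (goodTargets n v T (2 ^ b) p r).card)
    (hq : m ^ 2 * l ^ 2 * (∑ p ∈ P, ∑ r ∈ Finset.range p, (goodTargets n v T (2 ^ b) p r).card ^ 2)
          * (2 ^ a) ^ 2
        + 2 * m * l * (∑ p ∈ P, ∑ r ∈ Finset.range p, (goodTargets n v T (2 ^ b) p r).card)
          * 2 ^ b * (2 ^ a) ^ 2
        + (∑ p ∈ P, ∑ r ∈ Finset.range p, (goodTargets n v T (2 ^ b) p r).card)
          * (2 ^ b) ^ 2 * (2 ^ a) ^ 2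
      ≤ q * (m ^ 2 * l ^ 2
          * (∑ p ∈ P, ∑ r ∈ Finset.range p, (goodTargets n v T (2 ^ b) p r).card) ^ 2)) :
    1 ≤ q * 𝔼 y, 𝔼 y', 𝔼 u : Fin m → Y, 𝔼 u' : Fin m → Y,
      if Hit n v a b (num y) (num y') (fun i => num (u i)) (fun i => num (u' i))
        then (1 : ℝ) else 0 := by
  set X : ℕ → ℕ → ℕ := fun p r => (goodTargets n v T (2 ^ b) p r).card with hX
  have hrel : ∀ p r, ∃ A : Y → Y → ℝ, (∀ x y, 0 ≤ A x y) ∧ (∀ x y, A x y ≤ 1) ∧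
      (∀ x, 𝔼 y, A x y ≤ l / 2 ^ b) ∧ (∀ y, 𝔼 x, A x y ≤ l / 2 ^ b) ∧
      𝔼 x, 𝔼 y, A x y = (if p ∈ P ∧ r < p then X p r * (l / 2 ^ b : ℝ) ^ 2 else 0) ∧
      ∀ x y, A x y ≠ 0 → r < p ∧
        unrank v p n r (num x % 2 ^ b) ≠ unrank v p n r (num y % 2 ^ b) ∧
        wsum v n (unrank v p n r (num x % 2 ^ b)) = wsum v n (unrank v p n r (num y % 2 ^ b)) :=
    fun p r => by
      by_cases h : p ∈ P ∧ r < p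
      · obtain ⟨A, h1, h2, h3, h4, h5, h6⟩ := exists_relation (n := n) (v := v) (m := l) hu hb h.2
          (S := goodTargets n v T (2 ^ b) p r) fun t ht => by
            rw [goodTargets, Finset.mem_filter] at ht
            exact ⟨ht.2.1, ht.2.2, hT t ht.1⟩
        exact ⟨A, h1, h2, h3, h4, by rw [h5, if_pos h], fun x y hxy => ⟨h.2, h6 x y hxy⟩⟩
      · refine ⟨fun _ _ => 0, fun _ _ => le_rfl, fun _ _ => zero_le_one, fun _ => ?_, fun _ => ?_,
          ?_, fun _ _ h0 => absurd rfl h0⟩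
        · simp only [Finset.expect_const_zero]; positivity
        · simp only [Finset.expect_const_zero]; positivity
        · rw [if_neg h]; simp
  choose A hA0 hA1 hrow hcol hmean hhit using hrel
  have hav : ∀ ψ : ℝ → ℝ, ψ 0 = 0 →
      𝔼 y, 𝔼 y', ψ (𝔼 x, 𝔼 x', A (1 + num y % 2 ^ a) (num y' % 2 ^ a) x x')
        = (∑ p ∈ P, ∑ r ∈ Finset.range p, ψ (X p r * (l / 2 ^ b : ℝ) ^ 2)) / (2 ^ a) ^ 2 :=
    fun ψ hψ => by
      simp only [hmean, apply_ite ψ, hψ]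
      rw [← sum_range_prime_residues hP, sq ((2 : ℝ) ^ a), ← div_div, Finset.sum_div]
      rw [hu.expect_mod ha fun x => 𝔼 y', if 1 + x ∈ P ∧ num y' % 2 ^ a < 1 + x then
        ψ (X (1 + x) (num y' % 2 ^ a) * (l / 2 ^ b : ℝ) ^ 2) else 0]
      congr 1
      refine Finset.sum_congr rfl fun x _ => ?_
      rw [hu.expect_mod ha fun y' => if 1 + x ∈ P ∧ y' < 1 + x then
        ψ (X (1 + x) y' * (l / 2 ^ b : ℝ) ^ 2) else 0]
  set S : ℕ := ∑ p ∈ P, ∑ r ∈ Finset.range p, X p r with hSdef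
  set S' : ℕ := ∑ p ∈ P, ∑ r ∈ Finset.range p, X p r ^ 2 with hS'def
  set e : ℝ := l / 2 ^ b with he
  have hepos : 0 < e := by positivity
  clear_value e S S'
  have hav1 : 𝔼 y, 𝔼 y', (𝔼 x, 𝔼 x', A (1 + num y % 2 ^ a) (num y' % 2 ^ a) x x')
      = S * e ^ 2 / (2 ^ a) ^ 2 := by
    rw [hav (fun x => x) rfl, hSdef]
    push_cast
    simp only [Finset.sum_mul]
  have hav2 : 𝔼 y, 𝔼 y', (𝔼 x, 𝔼 x', A (1 + num y % 2 ^ a) (num y' % 2 ^ a) x x') ^ 2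
      = S' * e ^ 4 / (2 ^ a) ^ 2 := by
    rw [hav (fun x => x ^ 2) (by norm_num), hS'def]
    push_cast
    simp only [Finset.sum_mul]
    congr 1
    refine Finset.sum_congr rfl fun p _ => Finset.sum_congr rfl fun r _ => by ring
  set Z : Y × Y × (Fin m → Y) × (Fin m → Y) → ℝ := fun x =>
    hits (A (1 + num x.1 % 2 ^ a) (num x.2.1 % 2 ^ a)) x.2.2.1 x.2.2.2 with hZ
  have hcs := expect_sq_le_expect_mul Z
  have hnest : ∀ F : Y × Y × (Fin m → Y) × (Fin m → Y) → ℝ,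
      𝔼 x, F x = 𝔼 y, 𝔼 y', 𝔼 u, 𝔼 u', F (y, y', u, u') := fun F => by
    rw [← Finset.univ_product_univ, Finset.expect_product]
    refine Finset.expect_congr rfl fun y _ => ?_
    rw [← Finset.univ_product_univ, Finset.expect_product]
    refine Finset.expect_congr rfl fun y' _ => ?_
    rw [← Finset.univ_product_univ, Finset.expect_product]
  rw [hnest, hnest, hnest] at hcs
  have hZ1 : 𝔼 y, 𝔼 y', 𝔼 u, 𝔼 u', Z (y, y', u, u') = m ^ 2 * (S * e ^ 2 / (2 ^ a) ^ 2) := by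
    simp only [hZ, expect_hits, ← Finset.mul_expect, hav1]
  have hZ2 : 𝔼 y, 𝔼 y', 𝔼 u, 𝔼 u', Z (y, y', u, u') ^ 2 ≤ m ^ 4 * (S' * e ^ 4 / (2 ^ a) ^ 2)
      + (2 * m ^ 3 * e + m ^ 2) * (S * e ^ 2 / (2 ^ a) ^ 2) := by
    rw [← hav1, ← hav2, Finset.mul_expect, Finset.mul_expect, ← Finset.expect_add_distrib]
    refine Finset.expect_le_expect fun y _ => ?_
    rw [Finset.mul_expect, Finset.mul_expect, ← Finset.expect_add_distrib]
    refine Finset.expect_le_expect fun y' _ => ?_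
    exact expect_sq_hits_le m (A (1 + num y % 2 ^ a) (num y' % 2 ^ a)) (δ := e) (hA0 _ _) (hA1 _ _)
      (hrow _ _) (hcol _ _)
  have hind : 𝔼 y, 𝔼 y', 𝔼 u, 𝔼 u', (if Z (y, y', u, u') = 0 then (0 : ℝ) else 1)
      ≤ 𝔼 y, 𝔼 y', 𝔼 u : Fin m → Y, 𝔼 u' : Fin m → Y,
        if Hit n v a b (num y) (num y') (fun i => num (u i)) (fun i => num (u' i))
          then (1 : ℝ) else 0 := by
    refine Finset.expect_le_expect fun y _ => Finset.expect_le_expect fun y' _ =>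
      Finset.expect_le_expect fun u _ => Finset.expect_le_expect fun u' _ => ?_
    by_cases h : Z (y, y', u, u') = 0
    · rw [if_pos h]; split_ifs <;> norm_num
    · rw [if_neg h, if_pos]
      obtain ⟨i, -, hi⟩ := Finset.exists_ne_zero_of_sum_ne_zero h
      obtain ⟨j, -, hj⟩ := Finset.exists_ne_zero_of_sum_ne_zero hi
      obtain ⟨hr, h1⟩ := hhit _ _ _ _ hj
      refine ⟨i, j, ?_⟩
      -- A hit presupposes that the drawn residue is less than the modulus, so the final reduction
      -- does nothing.
      rw [Nat.mod_eq_of_lt hr]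
      exact h1
  generalize 𝔼 y, 𝔼 y', 𝔼 u : Fin m → Y, 𝔼 u' : Fin m → Y,
        (if Hit n v a b (num y) (num y') (fun i => num (u i)) (fun i => num (u' i))
          then (1 : ℝ) else 0) = pr at hind ⊢
  set W : ℝ := m ^ 4 * (S' * e ^ 4 / (2 ^ a) ^ 2)
      + (2 * m ^ 3 * e + m ^ 2) * (S * e ^ 2 / (2 ^ a) ^ 2) with hW
  have hWpos : 0 < W := by
    have : 0 < (S : ℝ) := by exact_mod_cast hS
    have : (0 : ℝ) < m := by exact_mod_cast hm
    positivity
  have hpr0 : 0 ≤ 𝔼 y, 𝔼 y', 𝔼 u, 𝔼 u', (if Z (y, y', u, u') = 0 then (0 : ℝ) else 1) :=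
    Finset.expect_nonneg fun _ _ => Finset.expect_nonneg fun _ _ => Finset.expect_nonneg fun _ _ =>
      Finset.expect_nonneg fun _ _ => by split_ifs <;> norm_num
  have h1 : (m ^ 2 * (S * e ^ 2 / (2 ^ a) ^ 2)) ^ 2 ≤ pr * W := by
    rw [← hZ1]
    exact hcs.trans ((mul_le_mul_of_nonneg_left hZ2 hpr0).trans
      (mul_le_mul_of_nonneg_right hind hWpos.le))
  have h2 : W ≤ q * (m ^ 2 * (S * e ^ 2 / (2 ^ a) ^ 2)) ^ 2 := by
    have hq' : (m : ℝ) ^ 2 * l ^ 2 * S' * (2 ^ a) ^ 2 + 2 * m * l * S * 2 ^ b * (2 ^ a) ^ 2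
        + S * (2 ^ b) ^ 2 * (2 ^ a) ^ 2 ≤ q * (m ^ 2 * l ^ 2 * S ^ 2) := by exact_mod_cast hq
    -- The integer inequality `hq` is the second moment bound with denominators cleared by this
    -- factor.
    have hfac : (0 : ℝ) ≤ m ^ 2 * l ^ 2 / ((2 ^ b) ^ 4 * (2 ^ a) ^ 4) := by positivity
    have := mul_le_mul_of_nonneg_left hq' hfac
    refine (le_of_eq ?_).trans (this.trans (le_of_eq ?_))
    · rw [hW, he]; field_simp; ring
    · rw [he]; field_simp
  have h3 : W * 1 ≤ W * (q * pr) := by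
    have := mul_le_mul_of_nonneg_left h1 (Nat.cast_nonneg (α := ℝ) q)
    linarith
  exact le_of_mul_le_mul_left h3 hWpos

theorem exists_two_pow_between {c : ℕ} (hc : 0 < c) : ∃ s, c ≤ 2 ^ s ∧ 2 ^ s ≤ 2 * c := by
  refine ⟨Nat.clog 2 c, Nat.le_pow_clog (by norm_num) c, ?_⟩
  rcases Nat.lt_or_ge 1 c with h | h
  · have h1 := Nat.pow_pred_clog_lt_self (b := 2) (by norm_num) h
    have h2 : 0 < Nat.clog 2 c := Nat.clog_pos (by norm_num) h
    rw [show Nat.clog 2 c = (Nat.clog 2 c).pred + 1 by rw [Nat.pred_eq_sub_one]; omega, pow_succ]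
    omega
  · rw [Nat.clog_of_right_le_one h]
    omega

open Classical in
-- The level `(l, T)` dictates the parameters: `2 ^ (a + 1)` bounds the modulus and `2 ^ b` is the
-- range of indices.
theorem exists_trial_parameters [Nonempty Y] {num : Y → ℕ} (hu : UniformBits (2 * n + 6) num)
    (hn : 0 < n) (hv : ∑ t ∈ Finset.range n, v t < 2 ^ n)
    (hD : (weights n v).card + 4 ^ (2 * n / 5) < 2 ^ n) :
    ∃ a ≤ 2 * n / 5, ∃ b ≤ 2 * n + 6,
      1 ≤ ((2 ^ 19 * n ^ 6 : ℕ) : ℝ) * 𝔼 y, 𝔼 y', 𝔼 u : Fin (2 ^ (2 * n / 5)) → Y,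
        𝔼 u' : Fin (2 ^ (2 * n / 5)) → Y,
        if Hit n v (a + 1) b (num y) (num y') (fun i => num (u i)) (fun i => num (u' i))
          then (1 : ℝ) else 0 := by
  obtain ⟨l, T, hTW, hT, hDT, hlT⟩ := exists_level hn hD
  obtain ⟨s, hs1, hs2⟩ := exists_two_pow_between (c := 20 * n ^ 2) (by positivity)
  have hTlt : ∀ t ∈ T, t < 2 ^ n := fun t ht =>
    (Nat.lt_succ_iff.1 (Finset.mem_range.1 (weights_subset n v (hTW ht)))).trans_lt hv
  set k := 2 * n / 5 with hk
  set τ := T.card with hτ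
  have hτ0 : 0 < τ := by
    by_contra h
    rw [Nat.eq_zero_of_not_pos h, mul_zero] at hDT
    exact absurd (Nat.le_zero.1 hDT) (by positivity)
  -- The first bound keeps the table affordable. The second gives `2 ^ (a + 1) * 2 ^ l ≤ 4 ^ k` when
  -- `l + 1 ≤ 2k`, so the modulus is at most about the number of targets.
  set a := min k (2 * k - (l + 1)) with ha
  have hsn : s ≤ n + 7 := by
    have h1 : 20 * n ^ 2 ≤ 2 ^ 6 * 2 ^ n := by
      have : n ^ 2 ≤ 3 * 2 ^ n := by
        clear * -
        induction n with
        | zero => norm_num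
        | succ n ih =>
          rcases Nat.lt_or_ge n 3 with h | h
          · interval_cases n <;> norm_num
          · rw [pow_succ 2]; nlinarith
      omega
    have h2 : 2 ^ s ≤ 2 ^ (n + 7) := by
      rw [pow_add]; omega
    exact (Nat.pow_le_pow_iff_right (by norm_num)).1 h2
  have hs5 : 1 ≤ s := by
    by_contra h
    rw [show s = 0 by omega] at hs1
    have : 1 ≤ n ^ 2 := Nat.one_le_pow _ _ hn
    omega
  -- The index range is the average class size `2 ^ n / 2 ^ (a + 1)` times the slack `2 ^ s`,
  -- between `20 n²` and `40 n²`. With `s ≤ n + 7` this needs at most `2n + 6` bits, the length of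
  -- the random numbers.
  set b := n + s - (a + 1) with hb
  have hR : 2 ^ (a + 1) ≤ 4 * n * τ := by
    rcases Nat.lt_or_ge (2 * k) (l + 1) with h | h
    · rw [show a = 0 by omega, zero_add, pow_one]
      have : 1 ≤ n * τ := Nat.mul_pos hn hτ0
      linarith
    · have h1 : 2 ^ (a + 1) * 2 ^ l ≤ 4 ^ k := by
        rw [four_pow_two, ← pow_add]
        exact Nat.pow_le_pow_right (by norm_num) (by omega)
      refine Nat.le_of_mul_le_mul_right ?_ (show 0 < 2 ^ l by positivity)
      linarith
  have hMR : 2 ^ b * 2 ^ (a + 1) = 2 ^ n * 2 ^ s := by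
    rw [← pow_add, ← pow_add]
    congr 1
    omega
  set P := (Finset.range (2 ^ (a + 1) + 1)).filter Nat.Prime with hPdef
  have hP : ∀ p ∈ P, p.Prime := fun p hp => (Finset.mem_filter.1 hp).2
  have hP' : ∀ p ∈ P, 0 < p ∧ p ≤ 2 ^ (a + 1) := fun p hp =>
    ⟨(hP p hp).pos, Nat.lt_succ_iff.1 (Finset.mem_range.1 (Finset.mem_filter.1 hp).1)⟩
  have hRP : 2 ^ (a + 1) ≤ 2 * n * P.card := by
    refine (two_pow_le_mul_card_primes (by omega)).trans ?_
    refine Nat.mul_le_mul_right _ (by omega)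
  have hP0 : 0 < P.card := by
    by_contra h
    rw [Nat.eq_zero_of_not_pos h, mul_zero] at hRP
    exact absurd (Nat.le_zero.1 hRP) (by positivity)
  -- The Markov condition asks for `8 * 2 ^ l * |P| + 2 * n * 2 ^ n ≤ M * |P|`; with the factor `10`
  -- in `hM1` and `hM2` the two terms take eight and two tenths of the right side.
  have hM1 : 10 * 2 ^ l ≤ 2 ^ b := by
    refine Nat.le_of_mul_le_mul_right ?_ (show 0 < 2 ^ (a + 1) by positivity)
    rw [hMR]
    calc 10 * 2 ^ l * 2 ^ (a + 1) ≤ 10 * 2 ^ l * (4 * n * τ) := Nat.mul_le_mul_left _ hR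
      _ = 20 * n * (2 * 2 ^ l * τ) := by ring
      _ ≤ 20 * n * 2 ^ n := Nat.mul_le_mul_left _ hlT
      _ ≤ 20 * n ^ 2 * 2 ^ n := by rw [sq, ← mul_assoc]; exact Nat.mul_le_mul_right _ (Nat.le_mul_of_pos_right _ hn)
      _ ≤ 2 ^ s * 2 ^ n := Nat.mul_le_mul_right _ hs1
      _ = _ := mul_comm _ _
  have hM2 : 10 * (n * 2 ^ n) ≤ 2 ^ b * P.card := by
    refine Nat.le_of_mul_le_mul_left ?_ (show 0 < 2 * n by omega)
    calc 2 * n * (10 * (n * 2 ^ n)) = 20 * n ^ 2 * 2 ^ n := by ring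
      _ ≤ 2 ^ s * 2 ^ n := Nat.mul_le_mul_right _ hs1
      _ = 2 ^ b * 2 ^ (a + 1) := by rw [hMR, mul_comm]
      _ ≤ 2 ^ b * (2 * n * P.card) := Nat.mul_le_mul_left _ hRP
      _ = _ := by ring
  have hS := card_mul_card_le_sum_goodTargets hv hP hTlt (M := 2 ^ b) (f := 4 * 2 ^ l)
    (fun t ht => (hT t ht).2) (by positivity) (by
      have := Nat.mul_le_mul_right P.card hM1
      linarith)
  have hS' := sum_sq_card_goodTargets_le (n := n) (v := v) hP hTlt (2 ^ b)
  rw [← hτ] at hS hS'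
  refine ⟨a, by omega, b, by omega, ?_⟩
  refine one_le_mul_expect_hit_of_moments hu (a := a + 1) (b := b) (l := 2 ^ l) (P := P) (T := T)
    (by omega) (by omega) (by positivity) (by positivity) hP' (fun t ht => (hT t ht).1)
    ?_ ((second_moment_bound (n := n) (t := τ) (K := 2 ^ s) (c := 2 ^ n) ?_ hR ?_ hMR ?_ ?_).trans
      (Nat.mul_le_mul_right _ ?_))
  · have := Nat.mul_pos hP0 hτ0
    omega
  · calc 2 ^ (a + 1) * τ ≤ 2 * n * P.card * τ := Nat.mul_le_mul_right _ hRP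
      _ = 2 * n * (P.card * τ) := by ring
      _ ≤ 2 * n * (2 * _) := Nat.mul_le_mul_left _ hS
      _ = _ := by ring
  · exact hS'.trans (Nat.add_le_add_right hS _)
  · calc 2 ^ n ≤ 2 ^ (3 + k + 2 * k) := Nat.pow_le_pow_right (by norm_num) (by omega)
      _ = 8 * 2 ^ k * 4 ^ k := by rw [pow_add, pow_add, ← four_pow_two]; norm_num
      _ ≤ 8 * 2 ^ k * (4 * n * 2 ^ l * τ) := Nat.mul_le_mul_left _ hDT
      _ = _ := by ring
  -- The decisive exponent count. If `a = k`, it reduces to `2n ≤ 5k + 5 + l`, tight up to a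
  -- constant at `l = 0`; otherwise `a + 1 + l ≥ 2k` and `6k + 4` suffices.
  · calc (2 ^ n) ^ 2 = 2 ^ (2 * n) := by rw [← pow_mul, mul_comm]
      _ ≤ 2 ^ (4 + (a + 1 + l) + 2 * k + 2 * k) := Nat.pow_le_pow_right (by norm_num) (by omega)
      _ = 16 * (2 ^ (a + 1) * 2 ^ l) * (2 ^ k) ^ 2 * 4 ^ k := by
        rw [pow_add, pow_add, pow_add, ← four_pow_two, ← pow_mul, mul_comm k 2, pow_add 2 (a + 1) l,
          four_pow_two]
        norm_num
      _ ≤ 16 * (2 ^ (a + 1) * 2 ^ l) * (2 ^ k) ^ 2 * (4 * n * 2 ^ l * τ) :=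
        Nat.mul_le_mul_left _ hDT
      _ = _ := by ring
  -- The coefficients sum to `409600 + 10240 + 32 + 16 < 2 ^ 19`.
  · have h1 : (2 ^ s) ^ 2 ≤ (40 * n ^ 2) ^ 2 := Nat.pow_le_pow_left (by omega) 2
    have h2 : 256 * n ^ 2 * (2 ^ s) ^ 2 ≤ 256 * n ^ 2 * (40 * n ^ 2) ^ 2 := Nat.mul_le_mul_left _ h1
    have h3 : 256 * n ^ 2 * 2 ^ s ≤ 256 * n ^ 2 * (40 * n ^ 2) := Nat.mul_le_mul_left _ (by omega)
    have h4 : n ^ 4 ≤ n ^ 6 := Nat.pow_le_pow_right hn (by norm_num)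
    have h5 : n ^ 3 ≤ n ^ 6 := Nat.pow_le_pow_right hn (by norm_num)
    have h6 : n ^ 2 ≤ n ^ 6 := Nat.pow_le_pow_right hn (by norm_num)
    have e1 : 256 * n ^ 2 * (40 * n ^ 2) ^ 2 = 409600 * n ^ 6 := by ring
    have e2 : 256 * n ^ 2 * (40 * n ^ 2) = 10240 * n ^ 4 := by ring
    omega

end PES

/-! ### Independent trials and amplification -/

namespace PES

open scoped BigOperators

variable {n : ℕ} {v : ℕ → ℕ}

/-! ### Coins -/

instance isProbabilityMeasure_coinMeasure : IsProbabilityMeasure coinMeasure := by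
  unfold coinMeasure; infer_instance

theorem coinMeasure_real_cylinder {ι : Type*} [Fintype ι] {φ : ι → ℕ} (hφ : Function.Injective φ)
    (β : ι → Bool) : coinMeasure.real {ω | ∀ i, ω (φ i) = β i} = (1 / 2) ^ Fintype.card ι := by
  have hset : {ω : ℕ → Bool | ∀ i, ω (φ i) = β i}
      = Set.pi (Finset.univ.map ⟨φ, hφ⟩ : Finset ℕ) fun k => {b | ∀ i, φ i = k → b = β i} := by
    ext ω
    simp only [Set.mem_ofPred_eq, Set.mem_pi, Finset.coe_map, Function.Embedding.coeFn_mk,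
      Finset.coe_univ, Set.image_univ, Set.mem_range]
    constructor
    · rintro h _ _ i rfl
      exact h i
    · exact fun h i => h _ ⟨i, rfl⟩ i rfl
  rw [Measure.real, hset, coinMeasure,
    Measure.infinitePi_pi _ fun _ _ => (Set.toFinite _).measurableSet, Finset.prod_map]
  have : ∀ i : ι, (PMF.uniformOfFintype Bool).toMeasure
      {b | ∀ i', φ i' = (⟨φ, hφ⟩ : ι ↪ ℕ) i → b = β i'} = 2⁻¹ := fun i => by
    have : {b | ∀ i', φ i' = (⟨φ, hφ⟩ : ι ↪ ℕ) i → b = β i'} = {β i} := by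
      ext b
      simp only [Function.Embedding.coeFn_mk, Set.mem_ofPred_eq, Set.mem_singleton_iff]
      exact ⟨fun h => h i rfl, fun h i' hi => by rw [h, hφ hi]⟩
    rw [this, PMF.toMeasure_apply_singleton _ _ (measurableSet_singleton _)]
    simp
  rw [Finset.prod_congr rfl fun i _ => this i]
  simp

/-- Blocks of coins at different places are independent. -/
theorem coinMeasure_real_blocks_le {ι κ : Type*} [Fintype ι] [Fintype κ] [DecidableEq ι]
    [DecidableEq κ] {φ : ι → κ → ℕ}
    (hφ : ∀ i j i' j', φ i j = φ i' j' → i = i' ∧ j = j') (S : Finset (κ → Bool)) :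
    coinMeasure.real {ω | ∀ i, (fun j => ω (φ i j)) ∈ S}
      ≤ (S.card / 2 ^ Fintype.card κ) ^ Fintype.card ι := by
  have hsub : {ω : ℕ → Bool | ∀ i, (fun j => ω (φ i j)) ∈ S}
      = ⋃ β ∈ Fintype.piFinset fun _ : ι => S, {ω | ∀ x : ι × κ, ω (φ x.1 x.2) = β x.1 x.2} := by
    ext ω
    simp only [Set.mem_ofPred_eq, Set.mem_iUnion, Fintype.mem_piFinset, exists_prop]
    constructor
    · exact fun h => ⟨fun i j => ω (φ i j), h, fun _ => rfl⟩
    · rintro ⟨β, hβ, h⟩ i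
      rw [show (fun j => ω (φ i j)) = β i from funext fun j => h (i, j)]
      exact hβ i
  rw [hsub]
  refine (measureReal_biUnion_finset_le _ _).trans_eq ?_
  have hinj : Function.Injective fun x : ι × κ => φ x.1 x.2 := fun x y h => by
    obtain ⟨h1, h2⟩ := hφ _ _ _ _ h
    exact Prod.ext h1 h2
  rw [Finset.sum_congr rfl fun β _ => coinMeasure_real_cylinder hinj fun x => β x.1 x.2,
    Finset.sum_const, Fintype.card_piFinset, Finset.prod_const, Finset.card_univ, nsmul_eq_mul,
    Fintype.card_prod, mul_comm (Fintype.card ι), pow_mul, Nat.cast_pow, ← mul_pow]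
  congr 1
  rw [div_pow, one_pow, mul_one_div]

/-- The number with the given bits. -/
def bitNum {B : ℕ} (x : Fin B → Bool) : ℕ := ∑ j, (x j).toNat * 2 ^ (j : ℕ)

theorem coinNum_eq_bitNum (ω : ℕ → Bool) (B i : ℕ) :
    coinNum ω B i = bitNum fun j : Fin B => ω (i * B + j) :=
  (Fin.sum_univ_eq_sum_range (fun j => (ω (i * B + j)).toNat * 2 ^ j) B).symm

/-- Induction peels off the lowest bit: a number is that bit plus twice a uniform number of one bit
less. -/
theorem uniformBits_bitNum (B : ℕ) : UniformBits B (bitNum (B := B)) := by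
  induction B with
  | zero =>
    intro h
    simp [bitNum]
  | succ B ih =>
    intro h
    have hcons : ∀ (b : Bool) (x : Fin B → Bool),
        bitNum (Fin.cons b x : Fin (B + 1) → Bool) = b.toNat + 2 * bitNum x := fun b x => by
      unfold bitNum
      rw [Fin.sum_univ_succ, Finset.mul_sum]
      simp only [Fin.cons_zero, Fin.cons_succ, Fin.val_zero, Fin.val_succ, pow_zero, mul_one, pow_succ]
      exact congrArg (b.toNat + ·) (Finset.sum_congr rfl fun j _ => by ring)
    rw [expect_fin_succ]
    simp only [hcons]
    rw [Finset.expect_comm, ih fun y => 𝔼 b : Bool, h (b.toNat + 2 * y), pow_succ', sum_range_mul,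
      pow_succ', ← div_div]
    congr 1
    rw [Finset.sum_div]
    refine Finset.sum_congr rfl fun y _ => ?_
    rw [Fintype.expect_eq_sum_div_card, Finset.sum_range_succ, Finset.sum_range_one]
    simp [add_comm]

/-! ### The trials succeed -/

/-- A trial with the given coins finds a collision. -/
def BlockHit (n : ℕ) (v : ℕ → ℕ) (a b : ℕ)
    (x : Fin (2 ^ (2 * n / 5) + 2 ^ (2 * n / 5) + 1 + 1) × Fin (2 * n + 6) → Bool) : Prop :=
  Hit n v (a + 1) b (bitNum fun j => x (0, j)) (bitNum fun j => x (1, j))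
    (fun i : Fin (2 ^ (2 * n / 5)) => bitNum fun j => x ((i.castAdd _).succ.succ, j))
    (fun i : Fin (2 ^ (2 * n / 5)) => bitNum fun j => x ((i.natAdd _).succ.succ, j))

open Classical in
-- The average over modulus, residue and the two batches is rewritten as a proportion of coin
-- blocks, the form in which independence of the trials is available.
theorem exists_trial_blocks (hn : 0 < n) (hv : ∑ t ∈ Finset.range n, v t < 2 ^ n)
    (hD : (weights n v).card + 4 ^ (2 * n / 5) < 2 ^ n) :
    ∃ a ≤ 2 * n / 5, ∃ b ≤ 2 * n + 6,
      ((Finset.univ.filter fun x => ¬ BlockHit n v a b x).card /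
        2 ^ Fintype.card (Fin (2 ^ (2 * n / 5) + 2 ^ (2 * n / 5) + 1 + 1) × Fin (2 * n + 6)) : ℝ)
        ≤ 1 - 1 / (2 ^ 19 * n ^ 6 : ℕ) := by
  obtain ⟨a, ha, b, hb, h⟩ := exists_trial_parameters (uniformBits_bitNum _) hn hv hD
  refine ⟨a, ha, b, hb, ?_⟩
  have h1 : 𝔼 x, (if BlockHit n v a b x then (1 : ℝ) else 0)
      = 𝔼 y : Fin (2 * n + 6) → Bool, 𝔼 y' : Fin (2 * n + 6) → Bool,
        𝔼 u : Fin (2 ^ (2 * n / 5)) → Fin (2 * n + 6) → Bool,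
        𝔼 u' : Fin (2 ^ (2 * n / 5)) → Fin (2 * n + 6) → Bool,
        if Hit n v (a + 1) b (bitNum y) (bitNum y') (fun i => bitNum (u i)) (fun i => bitNum (u' i))
          then (1 : ℝ) else 0 := by
    refine (Fintype.expect_equiv (Equiv.curry _ _ Bool) _
      (fun x : Fin (2 ^ (2 * n / 5) + 2 ^ (2 * n / 5) + 1 + 1) → Fin (2 * n + 6) → Bool =>
        if Hit n v (a + 1) b (bitNum (x 0)) (bitNum (x 1))
          (fun i : Fin (2 ^ (2 * n / 5)) => bitNum (x (i.castAdd _).succ.succ))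
          (fun i : Fin (2 ^ (2 * n / 5)) => bitNum (x (i.natAdd _).succ.succ))
        then (1 : ℝ) else 0) fun x => rfl).trans ?_
    rw [expect_fin_succ]
    refine Finset.expect_congr rfl fun y _ => ?_
    rw [expect_fin_succ]
    refine Finset.expect_congr rfl fun y' _ => ?_
    rw [expect_fin_add]
    refine Finset.expect_congr rfl fun u _ => Finset.expect_congr rfl fun u' _ => ?_
    rw [← Fin.succ_zero_eq_one]
    simp only [Fin.cons_zero, Fin.cons_succ, Fin.append_left, Fin.append_right]
  rw [← h1, Fintype.expect_eq_sum_div_card, Finset.sum_boole] at h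
  have hsplit := Finset.card_filter_add_card_filter_not (s := Finset.univ) (BlockHit n v a b)
  rw [Finset.card_univ, ← Nat.cast_inj (R := ℝ), Nat.cast_add] at hsplit
  have hcard : (Fintype.card (Fin (2 ^ (2 * n / 5) + 2 ^ (2 * n / 5) + 1 + 1) × Fin (2 * n + 6) →
      Bool) : ℝ)
      = 2 ^ Fintype.card (Fin (2 ^ (2 * n / 5) + 2 ^ (2 * n / 5) + 1 + 1) × Fin (2 * n + 6)) := by
    rw [Fintype.card_fun, Fintype.card_bool]; push_cast; rfl
  rw [hcard] at h hsplit
  have hq : (0 : ℝ) < (2 ^ 19 * n ^ 6 : ℕ) := by positivity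
  rw [← div_le_iff₀' hq] at h
  rw [eq_sub_of_add_eq' hsplit, sub_div, div_self (by positivity)]
  linarith

/-- The place of the `j`-th coin of the `c`-th random number of the trial `e`. -/
def coinPos (n e c j : ℕ) : ℕ := trialPos n e c * (2 * n + 6) + j

theorem coinPos_injective {e c j e' c' j' : ℕ} (hc : c < 2 + 2 * 2 ^ (2 * n / 5))
    (hc' : c' < 2 + 2 * 2 ^ (2 * n / 5)) (hj : j < 2 * n + 6) (hj' : j' < 2 * n + 6)
    (h : coinPos n e c j = coinPos n e' c' j') : e = e' ∧ c = c' ∧ j = j' := by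
  have key : ∀ {x y x' y' w : ℕ}, y < w → y' < w → x * w + y = x' * w + y' → x = x' ∧ y = y' :=
    fun {x y x' y' w} hy hy' h => by
      have h1 : x = x' := by
        have := congrArg (· / w) h
        simpa [Nat.mul_add_div (show 0 < w by omega), mul_comm _ w, Nat.div_eq_of_lt hy,
          Nat.div_eq_of_lt hy'] using this
      subst h1
      exact ⟨rfl, by omega⟩
  obtain ⟨h1, h2⟩ := key hj hj' h
  obtain ⟨h3, h4⟩ := key hc hc' h1
  exact ⟨h3, h4, h2⟩

theorem collides_of_blockHit {e a b : ℕ} (he : e < 2 ^ 28 * (n + 1) ^ 9)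
    (hea : e % (2 * n / 5 + 1) = a) (heb : e / (2 * n / 5 + 1) % (2 * n + 6 + 1) = b) {ω : ℕ → Bool}
    (h : BlockHit n v a b fun x => ω (coinPos n e x.1 x.2)) :
    Collides n v (trialSet n v (coinNum ω (2 * n + 6))) := by
  obtain ⟨i, j, hne, heq⟩ := h
  simp only [coinPos, ← coinNum_eq_bitNum] at hne heq
  refine ⟨trialMask n v (coinNum ω (2 * n + 6)) e i, ⟨e, he, i, by omega, rfl⟩,
    trialMask n v (coinNum ω (2 * n + 6)) e (2 ^ (2 * n / 5) + j), ⟨e, he, _, by omega, rfl⟩, ?_⟩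
  rw [trialMask, trialMask, trialRes, trialP, trialR, trialM, hea, heb,
    show 2 + (i : ℕ) = ((i.castAdd (2 ^ (2 * n / 5))).succ.succ : ℕ) by simp; omega,
    show 2 + (2 ^ (2 * n / 5) + (j : ℕ)) = ((j.natAdd (2 ^ (2 * n / 5))).succ.succ : ℕ) by
      simp; omega]
  exact ⟨hne, heq⟩

/-- The left side is at most `e ^ (-5)`, and already `0.37 ^ 5 < 0.01`. -/
theorem one_sub_one_div_pow_le {q : ℕ} (hq : 0 < q) : (1 - 1 / (q : ℝ)) ^ (5 * q) ≤ 1 / 100 := by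
  have h1 : (1 - 1 / (q : ℝ)) ^ q ≤ 0.37 :=
    (Real.one_sub_div_pow_le_exp_neg (by exact_mod_cast hq)).trans
      (Real.exp_neg_one_lt_d9.le.trans (by norm_num))
  have h0 : 0 ≤ 1 - 1 / (q : ℝ) := by
    rw [sub_nonneg, div_le_one (by exact_mod_cast hq)]
    exact_mod_cast hq
  rw [mul_comm, pow_mul]
  exact (pow_le_pow_left₀ (pow_nonneg h0 _) h1 5).trans (by norm_num)

theorem coinMeasure_collides_trialSet (hn : 0 < n) (hv : ∑ t ∈ Finset.range n, v t < 2 ^ n)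
    (hD : (weights n v).card + 4 ^ (2 * n / 5) < 2 ^ n) :
    99 / 100 ≤ coinMeasure {ω | Collides n v (trialSet n v (coinNum ω (2 * n + 6)))} := by
  classical
  obtain ⟨a, ha, b, hb, h⟩ := exists_trial_blocks hn hv hD
  set q := 2 ^ 19 * n ^ 6 with hq
  have hq0 : 0 < q := by positivity
  -- The trial number encodes `a` and `b` in mixed radix, so these `5 q` trials all use the right
  -- parameters. That they are among the `2 ^ 28 (n + 1) ^ 9` trials is the reason for that number.
  set E : Fin (5 * q) → ℕ := fun i => a + (2 * n / 5 + 1) * (b + (2 * n + 6 + 1) * i) with hE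
  have hEa : ∀ i, E i % (2 * n / 5 + 1) = a := fun i => by
    rw [hE, Nat.add_mul_mod_self_left, Nat.mod_eq_of_lt (by omega)]
  have hEb' : ∀ i, E i / (2 * n / 5 + 1) = b + (2 * n + 6 + 1) * i := fun i => by
    rw [hE, Nat.add_mul_div_left _ _ (by omega), Nat.div_eq_of_lt (by omega), zero_add]
  have hEb : ∀ i, E i / (2 * n / 5 + 1) % (2 * n + 6 + 1) = b := fun i => by
    rw [hEb', Nat.add_mul_mod_self_left, Nat.mod_eq_of_lt (by omega)]
  have hEinj : ∀ i j, E i = E j → i = j := fun i j hij => by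
    have := hEb' i
    rw [hij, hEb' j] at this
    have := Nat.eq_of_mul_eq_mul_left (by omega) (Nat.add_left_cancel this)
    exact Fin.ext this.symm
  have hElt : ∀ i, E i < 2 ^ 28 * (n + 1) ^ 9 := fun i => by
    have hi := i.2
    have h1 : b + (2 * n + 6 + 1) * i < (2 * n + 6 + 1) * (5 * q) := by
      calc b + (2 * n + 6 + 1) * i < (2 * n + 6 + 1) * 1 + (2 * n + 6 + 1) * i := by omega
        _ = (2 * n + 6 + 1) * (1 + i) := by ring
        _ ≤ _ := Nat.mul_le_mul_left _ (by omega)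
    calc E i < (2 * n / 5 + 1) * 1 + (2 * n / 5 + 1) * (b + (2 * n + 6 + 1) * i) := by
          rw [hE]; dsimp only; omega
      _ = (2 * n / 5 + 1) * (1 + (b + (2 * n + 6 + 1) * i)) := by ring
      _ ≤ (n + 1) * ((2 * n + 6 + 1) * (5 * q)) := Nat.mul_le_mul (by omega) (by omega)
      _ ≤ (n + 1) * ((7 * (n + 1)) * (5 * (2 ^ 19 * (n + 1) ^ 6))) := by
          rw [hq]
          gcongr <;> omega
      _ = 35 * 2 ^ 19 * ((n + 1) ^ 8 * 1) := by ring
      _ ≤ 2 ^ 28 * ((n + 1) ^ 8 * (n + 1)) :=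
          Nat.mul_le_mul (by norm_num) (Nat.mul_le_mul_left _ (by omega))
      _ = _ := by ring
  have hw : 2 ^ (2 * n / 5) + 2 ^ (2 * n / 5) + 1 + 1 = 2 + 2 * 2 ^ (2 * n / 5) := by omega
  have hbad := coinMeasure_real_blocks_le
    (φ := fun i (x : Fin (2 ^ (2 * n / 5) + 2 ^ (2 * n / 5) + 1 + 1) × Fin (2 * n + 6)) =>
      coinPos n (E i) x.1 x.2)
    (fun i x j y hxy => by
      obtain ⟨h1, h2, h3⟩ := coinPos_injective (hw ▸ x.1.2) (hw ▸ y.1.2) x.2.2 y.2.2 hxy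
      exact ⟨hEinj _ _ h1, Prod.ext (Fin.ext h2) (Fin.ext h3)⟩)
    (Finset.univ.filter fun x => ¬ BlockHit n v a b x)
  rw [Fintype.card_fin] at hbad
  have hbad' := hbad.trans ((pow_le_pow_left₀ (by positivity) h _).trans (one_sub_one_div_pow_le hq0))
  have hcompl : {ω | Collides n v (trialSet n v (coinNum ω (2 * n + 6)))}ᶜ
      ⊆ {ω | ∀ i, (fun x : Fin (2 ^ (2 * n / 5) + 2 ^ (2 * n / 5) + 1 + 1) × Fin (2 * n + 6) =>
        ω (coinPos n (E i) x.1 x.2)) ∈ Finset.univ.filter fun x => ¬ BlockHit n v a b x} :=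
    fun ω hω i => by
      rw [Finset.mem_filter]
      exact ⟨Finset.mem_univ _, fun hit => hω (collides_of_blockHit (hElt i) (hEa i) (hEb i) hit)⟩
  have h1 := (measureReal_mono (μ := coinMeasure) hcompl).trans hbad'
  -- Subadditivity alone turns the bound for the complement into one for the event, without
  -- measurability.
  have h2 := measureReal_union_le (μ := coinMeasure)
    {ω | Collides n v (trialSet n v (coinNum ω (2 * n + 6)))}
    {ω | Collides n v (trialSet n v (coinNum ω (2 * n + 6)))}ᶜ
  rw [Set.union_compl_self, probReal_univ] at h2
  rw [← ofReal_measureReal, show (99 / 100 : ENNReal) = ENNReal.ofReal (99 / 100) by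
    rw [ENNReal.ofReal_div_of_pos (by norm_num)]; norm_num]
  exact ENNReal.ofReal_le_ofReal (by linarith)

end PES

/-! ### The theorem -/

theorem theorem1 :
    ∃ (c : PES.Cmd) (q : Polynomial ℕ),
      ∀ (n : ℕ) (w : Fin n → ℕ), PES.IsInstance w →
        (∀ ω : ℕ → Bool, ∃ (s : PES.State) (t : ℕ),
          PES.Exec ω c (PES.start w) s t ∧
            (t : ℝ) ≤ ((q.eval n : ℕ) : ℝ) * (2 : ℝ) ^ ((0.4 : ℝ) * (n : ℝ))) ∧
        (99 / 100 : ENNReal) ≤ PES.coinMeasure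
          {ω : ℕ → Bool | ∃ (s : PES.State) (t : ℕ),
            PES.Exec ω c (PES.start w) s t ∧
              PES.IsSolution w (s.subset n 1) (s.subset n 2)} := by
  -- The last factor is `(B + 1) ^ 2` for the word length `B = 12n + 60`.
  refine ⟨PES.solve, Polynomial.C (2 ^ 50) * (Polynomial.X + 1) ^ 10 *
    (Polynomial.C 12 * Polynomial.X + Polynomial.C 61) ^ 2, fun n w hw => ⟨fun ω => ?_, ?_⟩⟩
  · obtain ⟨s, t, he, ht, -⟩ := PES.solve_run hw ω
    refine ⟨s, t, he, ?_⟩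
    have h1 : (2 : ℝ) ^ (2 * n / 5) ≤ (2 : ℝ) ^ ((0.4 : ℝ) * (n : ℝ)) := by
      rw [← Real.rpow_natCast]
      refine Real.rpow_le_rpow_of_exponent_le (by norm_num) ?_
      refine Nat.cast_div_le.trans (le_of_eq ?_)
      push_cast
      ring
    have h2 : (t : ℝ) ≤ 2 ^ 50 * (n + 1) ^ 10 * 2 ^ (2 * n / 5) * (12 * n + 60 + 1) ^ 2 := by
      exact_mod_cast ht
    simp only [Polynomial.eval_mul, Polynomial.eval_pow, Polynomial.eval_add, Polynomial.eval_C,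
      Polynomial.eval_X, Polynomial.eval_one]
    push_cast
    calc (t : ℝ) ≤ 2 ^ 50 * (n + 1) ^ 10 * (12 * n + 61) ^ 2 * 2 ^ (2 * n / 5) :=
          h2.trans_eq (by ring)
      _ ≤ 2 ^ 50 * (n + 1) ^ 10 * (12 * n + 61) ^ 2 * (2 : ℝ) ^ ((0.4 : ℝ) * (n : ℝ)) :=
          mul_le_mul_of_nonneg_left h1 (by positivity)
      _ = _ := by norm_num
  · set v := PES.sorted n (PES.input w) with hv
    have hW : ∑ t ∈ Finset.range n, v t < 2 ^ n - 1 := by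
      rw [hv, PES.sum_sorted, PES.sum_input]
      exact hw.2
    have hn : 0 < n := by
      rcases Nat.eq_zero_or_pos n with rfl | h
      · simp at hW
      · exact h
    have hs : ∀ i j, i ≤ j → j < n → v i ≤ v j := fun i j =>
      PES.rank_sorted fun i hi => PES.sorted_rank hi
    -- A collision in either part suffices; for the deterministic part it is required for every
    -- inverse table, because the one used is only known to exist.
    have hrun : ∀ ω, PES.Collides n v (PES.trialSet n v (PES.coinNum ω (2 * n + 6))) ∨
        (∀ d, PES.InvTable n v d → PES.Collides n v (PES.searchSet n v d)) →
        ∃ (s : PES.State) (t : ℕ), PES.Exec ω PES.solve (PES.start w) s t ∧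
          PES.IsSolution w (s.subset n 1) (s.subset n 2) := fun ω h => by
      obtain ⟨s, t, he, -, -, d, hd, hsol⟩ := PES.solve_run hw ω
      refine ⟨s, t, he, hsol ?_⟩
      rcases h with h | h
      · exact h.mono Set.subset_union_right
      · exact (h d hd).mono Set.subset_union_left
    -- With many collisions the trials succeed with probability `0.99`; otherwise the search
    -- succeeds for every outcome of the coins.
    by_cases hD : (PES.weights n v).card + 4 ^ (2 * n / 5) < 2 ^ n
    · exact (PES.coinMeasure_collides_trialSet hn (by omega) hD).trans
        (measure_mono fun ω hω => hrun ω (Or.inl hω))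
    · have huniv : {ω : ℕ → Bool | ∃ (s : PES.State) (t : ℕ),
          PES.Exec ω PES.solve (PES.start w) s t ∧
            PES.IsSolution w (s.subset n 1) (s.subset n 2)} = Set.univ :=
        Set.eq_univ_of_forall fun ω => hrun ω (Or.inr fun d hd =>
          PES.collides_searchSet hn hs hW (not_lt.1 hD) hd)
      rw [huniv, measure_univ]
      exact ENNReal.div_le_of_le_mul (by norm_num)
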